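/- Let $\mathcal{O}(S^1)$ be the space of real-analytic functions $S^1\to\mathbb{C}$ with the (locally convex) inductive limit topology of the spaces $\mathcal{O}(U_n)$, $n\ge 1$, of holomorphic functions on $U_n=\{1-\frac1n<|z|<1+\frac1n\}$ with the topology of uniform convergence on compact sets. A subset $X$ of $\mathcal{O}(S^1)$ carries the Frölicher structure generated by the smooth curves $\gamma\in C^\infty(\mathbb{R},\mathcal{O}(S^1))$ with values in $X$: its functions are the $f\colon X\to\mathbb{R}$ such that $f\circ\gamma$ is $C^\infty$ for all these $\gamma$, and its curves are the $\gamma\colon\mathbb{R}\to X$ such that $f\circ\gamma$ is $C^\infty$ for all these $f$. A map between two such sets is Fr-smooth if it maps curves of the first structure to curves of the second. A complex deformation is an injective real-analytic map $\phi\colon S^1\to\mathbb{C}\setminus\{0\}$ with nowhere vanishing derivative and with winding number $+1$ around $0$. Let $\mathrm{Def}_{\mathbb{C}}(S^1)\subset\mathcal{O}(S^1)$ be the set of complex deformations, $\mathrm{Diff}_+^{\mathrm{an}}(S^1)\subset\mathcal{O}(S^1)$ the set of orientation-preserving real-analytic diffeomorphisms of $S^1$, and $\mathcal{U}\subset\mathrm{Def}_{\mathbb{C}}(S^1)$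 the set of complex deformations $u$ that are the restriction to $S^1$ of a function $F$ which is holomorphic in a neighbourhood of the closed unit disk, injective on the open unit disk, and satisfies $F(0)=0$ and $F'(0)>0$. **Proposition.** For every $\phi\in\mathrm{Def}_{\mathbb{C}}(S^1)$ there is exactly one pair $(\phi_{\mathrm{diff}},\phi_{\mathrm{univ}})\in\mathrm{Diff}_+^{\mathrm{an}}(S^1)\times\mathcal{U}$ such that $$\phi=\phi_{\mathrm{univ}}\circ\phi_{\mathrm{diff}}.$$ Moreover, the maps $\phi\mapsto\phi_{\mathrm{diff}}$, $\mathrm{Def}_{\mathbb{C}}(S^1)\to\mathrm{Diff}_+^{\mathrm{an}}(S^1)$, and $\phi\mapsto\phi_{\mathrm{univ}}$, $\mathrm{Def}_{\mathbb{C}}(S^1)\to\mathcal{U}$, are Fr-smooth. -/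

import Mathlib

open Set Filter Topology
open scoped ContDiff

noncomputable section

namespace CDef

/-! ### Frölicher spaces -/

/-- A Frölicher structure on `X`: a set of curves `ℝ → X` and a set of functions `X → ℝ`
which determine each other through smoothness of the composites `ℝ → ℝ`. -/
structure FrolicherStructure (X : Type*) where
  curves : Set (ℝ → X)
  functions : Set (X → ℝ)
  curves_eq : curves = {γ | ∀ f ∈ functions, ContDiff ℝ ∞ (f ∘ γ)}
  functions_eq : functions = {f | ∀ γ ∈ curves, ContDiff ℝ ∞ (f ∘ γ)}

/-- The Frölicher structure generated by a set `C₀` of initial curves. -/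
def FrolicherStructure.generate {X : Type*} (C₀ : Set (ℝ → X)) : FrolicherStructure X where
  functions := {f | ∀ γ ∈ C₀, ContDiff ℝ ∞ (f ∘ γ)}
  curves := {γ | ∀ f : X → ℝ, (∀ η ∈ C₀, ContDiff ℝ ∞ (f ∘ η)) → ContDiff ℝ ∞ (f ∘ γ)}
  curves_eq := rfl
  functions_eq := by
    ext f
    exact ⟨fun hf _ hγ => hγ f hf, fun hf γ hγ => hf γ fun _ hg => hg γ hγ⟩

/-- Frölicher smoothness: smooth curves are mapped to smooth curves. -/
def FrSmooth {X Y : Type*} (SX : FrolicherStructure X) (SY : FrolicherStructure Y)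
    (Q : X → Y) : Prop :=
  ∀ γ ∈ SX.curves, Q ∘ γ ∈ SY.curves

/-! ### The space `𝒪(S¹)` of real-analytic functions on the circle, as an inductive limit -/

/-- Real-analyticity of a complex function on the circle, in the angular coordinate `θ`,
`z = e^{iθ}`. -/
def IsRealAnalytic (f : Circle → ℂ) : Prop :=
  AnalyticOnNhd ℝ (fun θ : ℝ => f (Circle.exp θ)) univ

/-- The real-analytic functions `S¹ → ℂ`, as a subspace of all functions. -/
def realAnalyticSubmodule : Submodule ℂ (Circle → ℂ) where
  carrier := {f | IsRealAnalytic f}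
  zero_mem' := fun _ _ => analyticAt_const
  add_mem' := fun hf hg θ hθ => (hf θ hθ).add (hg θ hθ)
  smul_mem' := fun c _ hf θ hθ => (analyticAt_const (v := c)).mul (hf θ hθ)

/-- The vector space `𝒪(S¹)`. (It is a type of its own, so that it does not inherit the
topology of pointwise convergence.) -/
def OCircle : Type := realAnalyticSubmodule

namespace OCircle

instance : AddCommGroup OCircle := inferInstanceAs (AddCommGroup realAnalyticSubmodule)
instance : Module ℂ OCircle := inferInstanceAs (Module ℂ realAnalyticSubmodule)

instance : CoeFun OCircle (fun _ => Circle → ℂ) := ⟨fun f => f.1⟩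

end OCircle

/-- The annular neighbourhoods `1 - 1/n < |z| < 1 + 1/n` of the circle; the argument `m` stands
for `n = m + 1`. -/
def annulus (m : ℕ) : Set ℂ := {z | 1 - 1 / ((m : ℝ) + 1) < ‖z‖ ∧ ‖z‖ < 1 + 1 / ((m : ℝ) + 1)}

theorem circle_mem_annulus (m : ℕ) (z : Circle) : (z : ℂ) ∈ annulus m := by
  have h : (0 : ℝ) < 1 / ((m : ℝ) + 1) := by positivity
  simp only [annulus, mem_ofPred_eq, Circle.norm_coe]
  constructor <;> linarith

theorem isOpen_annulus (m : ℕ) : IsOpen (annulus m) :=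
  (isOpen_lt continuous_const continuous_norm).inter (isOpen_lt continuous_norm continuous_const)

/-- The holomorphic functions on an annulus, with the topology of uniform convergence on compact
sets (inherited from the compact-open topology of `C(annulus m, ℂ)`). -/
def OAnnulus (m : ℕ) : Submodule ℂ C(annulus m, ℂ) where
  carrier := {f | ∃ F : ℂ → ℂ, DifferentiableOn ℂ F (annulus m) ∧ ∀ z : annulus m, f z = F z}
  zero_mem' := ⟨fun _ => 0, differentiableOn_const 0, fun _ => rfl⟩
  add_mem' := by
    rintro f g ⟨F, hF, hfF⟩ ⟨G, hG, hgG⟩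
    exact ⟨fun z => F z + G z, hF.add hG, fun z => by simp [hfF, hgG]⟩
  smul_mem' := by
    rintro c f ⟨F, hF, hfF⟩
    exact ⟨fun z => c * F z, hF.const_mul c, fun z => by simp [hfF]⟩

theorem isRealAnalytic_restrictCircle (m : ℕ) (f : OAnnulus m) :
    IsRealAnalytic fun z => f.1 ⟨z, circle_mem_annulus m z⟩ := by
  obtain ⟨F, hF, hfF⟩ := f.2
  intro θ _
  have h1 : AnalyticAt ℝ F (Circle.exp θ : ℂ) :=
    (hF.analyticAt ((isOpen_annulus m).mem_nhds (circle_mem_annulus m _))).restrictScalars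
  have h2 : AnalyticAt ℝ (fun t : ℝ => Complex.exp ((t : ℂ) * Complex.I)) θ := by
    have h3 : AnalyticAt ℝ (fun t : ℝ => (t : ℂ) * Complex.I) θ :=
      (Complex.ofRealCLM.analyticAt θ).mul analyticAt_const
    exact ((Complex.differentiable_exp.analyticAt _).restrictScalars (𝕜 := ℝ)).comp h3
  have h4 := AnalyticAt.comp (g := F) (f := fun t : ℝ => Complex.exp ((t : ℂ) * Complex.I))
    (x := θ) (by simpa [Circle.coe_exp] using h1) h2
  simpa [hfF, Function.comp_def, Circle.coe_exp] using h4

/-- Restriction of holomorphic functions from an annulus to the circle. -/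
def restrictCircle (m : ℕ) (f : OAnnulus m) : OCircle :=
  ⟨fun z => f.1 ⟨z, circle_mem_annulus m z⟩, isRealAnalytic_restrictCircle m f⟩

/-- The inductive limit topology on `𝒪(S¹)`, in locally convex spaces: the finest locally convex
vector space topology for which all restriction maps `𝒪(U_n) → 𝒪(S¹)` are continuous. -/
instance OCircle.topology : TopologicalSpace OCircle :=
  sInf {t : TopologicalSpace OCircle | (∀ m, @Continuous _ _ _ t (restrictCircle m)) ∧
    @IsTopologicalAddGroup OCircle t _ ∧
    @ContinuousSMul ℂ OCircle _ _ t ∧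
    @LocallyConvexSpace ℝ OCircle _ _ _ _ t}

/-- `C^∞(ℝ, 𝒪(S¹))`: all iterated derivatives exist, as limits of difference quotients in the
topology of `𝒪(S¹)`. -/
def IsSmoothCurve (γ : ℝ → OCircle) : Prop :=
  ∃ g : ℕ → ℝ → OCircle, g 0 = γ ∧
    ∀ k t, Tendsto (slope (g k) t) (𝓝[≠] t) (𝓝 (g (k + 1) t))

/-- The Frölicher structure of a space `X` of real-analytic functions on the circle
(`ι : X → 𝒪(S¹)` being the inclusion): it is generated by the smooth curves in `𝒪(S¹)` which take
values in `X`. -/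
def subspaceFr {X : Type} (ι : X → OCircle) : FrolicherStructure X :=
  FrolicherStructure.generate {γ | IsSmoothCurve (ι ∘ γ)}

/-! ### Complex deformations and the two types of factors -/

/-- The derivative with respect to the angular coordinate. -/
def angDeriv (f : Circle → ℂ) (θ : ℝ) : ℂ := deriv (fun t : ℝ => f (Circle.exp t)) θ

/-- The winding number around `0` of the loop `θ ↦ f (e^{iθ})`, for `f` smooth without zeros. -/
def windingNumber (f : Circle → ℂ) : ℂ :=
  (2 * Real.pi * Complex.I)⁻¹ *
    ∫ θ in (0 : ℝ)..(2 * Real.pi), angDeriv f θ / f (Circle.exp θ)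

/-- Complex deformations: real-analytic embeddings `S¹ → ℂ ∖ {0}` with winding number `1`. -/
structure IsComplexDeformation (φ : OCircle) : Prop where
  injective : Function.Injective φ
  immersion : ∀ θ, angDeriv φ θ ≠ 0
  ne_zero : ∀ z, φ z ≠ 0
  winding : windingNumber φ = 1

/-- The space `Def_ℂ(S¹)` of complex deformations. -/
def DefC : Type := {φ : OCircle // IsComplexDeformation φ}

/-- The orientation-preserving real-analytic diffeomorphisms of the circle. -/
structure DiffAn where
  toEquiv : Circle ≃ Circle
  analytic : IsRealAnalytic fun z => (toEquiv z : ℂ)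
  analytic_symm : IsRealAnalytic fun z => (toEquiv.symm z : ℂ)
  orientation : windingNumber (fun z => (toEquiv z : ℂ)) = 1

/-- A diffeomorphism of the circle, as an element of `𝒪(S¹)`. -/
def DiffAn.toOCircle (d : DiffAn) : OCircle := ⟨fun z => (d.toEquiv z : ℂ), d.analytic⟩

/-- The complex deformations which are (the boundary values of) a univalent function `F` on the
open unit disk with analytic boundary behaviour, normalized by `F 0 = 0` and `F' 0 > 0`. -/
def UnivN : Type :=
  {u : DefC // ∃ F : ℂ → ℂ, AnalyticOnNhd ℂ F (Metric.closedBall 0 1) ∧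
    InjOn F (Metric.ball 0 1) ∧ F 0 = 0 ∧ (∃ r : ℝ, 0 < r ∧ deriv F 0 = r) ∧
    ∀ z : Circle, F z = u.1 z}

/-- A normalized univalent function, through its boundary values, as an element of `𝒪(S¹)`. -/
def UnivN.toOCircle (u : UnivN) : OCircle := u.1.1

/-- The decomposition `φ = u ∘ d`. -/
def IsDecomposition (φ : DefC) (d : DiffAn) (u : UnivN) : Prop :=
  ∀ z : Circle, φ.1 z = u.toOCircle (d.toEquiv z)

/-- The Frölicher structure of the complex deformations. -/
def DefC.fr : FrolicherStructure DefC := subspaceFr Subtype.val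

/-- The Frölicher structure of the diffeomorphisms. -/
def DiffAn.fr : FrolicherStructure DiffAn := subspaceFr DiffAn.toOCircle

/-- The Frölicher structure of the normalized univalent functions. -/
def UnivN.fr : FrolicherStructure UnivN := subspaceFr UnivN.toOCircle

end CDef

end

/-!
A complex deformation `φ` extends to a holomorphic embedding `Φ` of an annulus around the unit circle.
The univalent factor has to be the normalized conformal map `F` from the disk to the inside of the
curve `φ(S¹)`, and the other factor has to be `F⁻¹ ∘ φ`. The conformal map is constructed in such a
way that its dependence on `φ` is visible, by solving a linear equation in a fixed Banach space.

**The two sides of the curve.** The points off the curve `Φ(|z| = σ)` are separated by the winding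
number, the Cauchy integral of the constant one. It is locally constant off the curve and jumps by
one across it, so it is one on one side and zero on the other (`NiceMap.wind_values`). Both sides come
with a maximum principle.

**Existence.** The inverse of `F` is sought in the form `G(w) = w exp (H(w) - i Im H(0))`, where `H` is
holomorphic inside the curve and `Re H = -log |w|` on it. In the coordinate `z`, put
`h = u + (g - g*)`, where `u = -½ Log (Φ Φ*)`, where `g` is holomorphic outside a disk and vanishes at
infinity, and where `g*(z) = conj (g (1 / conj z))`. Then `Re h = Re u = -log |Φ|` on the unit circle
for every `g`, and `h` continues to the inside of the curve if and only if `g` solves a linear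
equation (`WeldingSolution`). This equation has the form `(1 + K) g = f` with `K` compact and
real-linear. Its kernel is trivial (`WeldingSolution.eq_zero`): for `u = 0` the function `h` is
imaginary on the circle, hence constant by the maximum principle, and then `g` is zero by Liouville's
theorem. So the equation has a solution by the Fredholm alternative (`exists_welding_family`).

The function `D = G ∘ Φ = Φ exp (h - i Im H(0))` is holomorphic on an annulus and has modulus one and
winding number one on the unit circle. By Hopf's lemma the real part of `z D' / D` is positive there
(`WeldingSolution.circ_logDeriv_re_pos`), so `D` is a diffeomorphism of the circle
(`circle_bijective`). The Cauchy integral `F` of `Φ` along the image of a slightly larger circle under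
`D` is holomorphic near the closed disk. It satisfies `F ∘ D = Φ` on the annulus
(`WeldingSolution.univ_comp_circ`), because `Φ - F ∘ D` continues to both sides and vanishes by
Liouville's theorem. Then `F` inverts `G`, which is onto the disk
(`WeldingSolution.ball_subset_riem`), so `F` is univalent, and `φ = F ∘ D` is a decomposition.

**Uniqueness.** Two univalent factors of `φ` have the same boundary curve, hence the same image of the
disk. By the Schwarz lemma applied to the transition functions they are equal
(`NormalizedUnivalent.eqOn`).

**Smoothness.** It suffices to test on the smooth curves which generate the Frölicher structures. A
smooth curve in `𝒪(S¹)` is the same as a curve which locally, for every finite `k`, is a `C^k` family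
of holomorphic functions on a fixed annulus (`HolFam`). In one direction
(`IsSmoothCurve.exists_holFam`) this rests on the fact that a family of Fourier coefficients which is
bounded for all subexponential weights decays exponentially at a uniform rate; in the other
(`isSmoothCurve_of_holFam`), on Cauchy's formula. The operations above are smooth operations in
Banach algebras of continuous functions and of operators, including the inversion of `1 + K`, so `D`
and `F` are `C^k` families on a fixed annulus (`exists_decomposition_family`).
-/

open scoped ContDiff

noncomputable section

namespace CDef

/-! ### Contour integrals on an annulus -/

/-- The open annulus `a < |z| < b`. -/
def ann (a b : ℝ) : Set ℂ := {z | a < ‖z‖ ∧ ‖z‖ < b}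

theorem mem_ann {a b : ℝ} {z : ℂ} : z ∈ ann a b ↔ a < ‖z‖ ∧ ‖z‖ < b := Iff.rfl

theorem isOpen_ann (a b : ℝ) : IsOpen (ann a b) :=
  (isOpen_lt continuous_const continuous_norm).inter (isOpen_lt continuous_norm continuous_const)

theorem ann_mono {a b a' b' : ℝ} (ha : a' ≤ a) (hb : b ≤ b') : ann a b ⊆ ann a' b' :=
  fun _ hz => ⟨ha.trans_lt hz.1, hz.2.trans_le hb⟩

theorem sphere_subset_ann {a b σ : ℝ} (ha : a < σ) (hb : σ < b) :
    Metric.sphere (0 : ℂ) σ ⊆ ann a b := by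
  intro z hz
  rw [mem_sphere_zero_iff_norm] at hz
  exact ⟨hz ▸ ha, hz ▸ hb⟩

/-- The contour integral `(2πi)⁻¹ ∮ f(ζ) dζ` over the circle `|ζ| = σ`. -/
def cint (σ : ℝ) (f : ℂ → ℂ) : ℂ := (2 * Real.pi * Complex.I : ℂ)⁻¹ * ∮ ζ in C(0, σ), f ζ

theorem cint_congr {σ : ℝ} (hσ : 0 ≤ σ) {f g : ℂ → ℂ} (h : ∀ z, ‖z‖ = σ → f z = g z) :
    cint σ f = cint σ g := by
  unfold cint
  rw [circleIntegral.integral_congr hσ fun z hz => h z (by simpa using hz)]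

theorem cint_add {σ : ℝ} (hσ : 0 ≤ σ) {f g : ℂ → ℂ} (hf : ContinuousOn f (Metric.sphere 0 σ))
    (hg : ContinuousOn g (Metric.sphere 0 σ)) :
    cint σ (fun z => f z + g z) = cint σ f + cint σ g := by
  unfold cint
  rw [circleIntegral.integral_add (hf.circleIntegrable hσ) (hg.circleIntegrable hσ), mul_add]

theorem cint_sub {σ : ℝ} (hσ : 0 ≤ σ) {f g : ℂ → ℂ} (hf : ContinuousOn f (Metric.sphere 0 σ))
    (hg : ContinuousOn g (Metric.sphere 0 σ)) :
    cint σ (fun z => f z - g z) = cint σ f - cint σ g := by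
  unfold cint
  rw [circleIntegral.integral_sub (hf.circleIntegrable hσ) (hg.circleIntegrable hσ), mul_sub]

theorem cint_const_mul (σ : ℝ) (c : ℂ) (f : ℂ → ℂ) :
    cint σ (fun z => c * f z) = c * cint σ f := by
  unfold cint
  rw [circleIntegral.integral_const_mul]; ring

theorem norm_cint_le {σ : ℝ} (hσ : 0 ≤ σ) {f : ℂ → ℂ} {C : ℝ} (h : ∀ z, ‖z‖ = σ → ‖f z‖ ≤ C) :
    ‖cint σ f‖ ≤ σ * C := by
  have := circleIntegral.norm_two_pi_i_inv_smul_integral_le_of_norm_le_const (c := 0) hσ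
    (f := f) (C := C) fun z hz => h z (by simpa using hz)
  simpa [cint] using this

/-- The integral over `|ζ| = σ` as an average over the unit circle. -/
theorem cint_eq_average (σ : ℝ) (f : ℂ → ℂ) :
    cint σ f = (2 * Real.pi : ℂ)⁻¹ *
      ∫ θ in (0 : ℝ)..2 * Real.pi, circleMap 0 σ θ * f (circleMap 0 σ θ) := by
  unfold cint circleIntegral
  simp only [deriv_circleMap, smul_eq_mul]
  have : ∀ θ : ℝ, circleMap 0 σ θ * Complex.I * f (circleMap 0 σ θ) =
      Complex.I * (circleMap 0 σ θ * f (circleMap 0 σ θ)) := fun θ => by ring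
  simp only [this, intervalIntegral.integral_const_mul]
  have hI := Complex.I_ne_zero
  field_simp

theorem cint_shift_of_le {a b σ τ : ℝ} (ha : 0 ≤ a) {f : ℂ → ℂ} (hσ : a < σ) (hστ : σ ≤ τ)
    (hτ : τ < b) (hf : DifferentiableOn ℂ f (ann a b)) : cint τ f = cint σ f := by
  unfold cint
  rw [Complex.circleIntegral_eq_of_differentiable_on_annulus_off_countable (ha.trans_lt hσ) hστ
    countable_empty]
  · refine hf.continuousOn.mono fun z hz => ?_
    simp only [Set.mem_sdiff, Metric.mem_closedBall, dist_zero_right, Metric.mem_ball, not_lt] at hz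
    exact ⟨hσ.trans_le hz.2, hz.1.trans_lt hτ⟩
  · rintro z ⟨⟨hz, hz'⟩, -⟩
    simp only [Metric.mem_closedBall, dist_zero_right, Metric.mem_ball, not_le] at hz hz'
    exact hf.differentiableAt ((isOpen_ann a b).mem_nhds ⟨hσ.trans hz', hz.trans hτ⟩)

/-- Cauchy's theorem on an annulus: the radius of the contour does not matter. -/
theorem cint_shift {a b σ τ : ℝ} (ha : 0 ≤ a) {f : ℂ → ℂ} (hσ : σ ∈ Ioo a b) (hτ : τ ∈ Ioo a b)
    (hf : DifferentiableOn ℂ f (ann a b)) : cint σ f = cint τ f := by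
  rcases le_total σ τ with h | h
  · exact (cint_shift_of_le ha hσ.1 h hτ.2 hf).symm
  · exact cint_shift_of_le ha hτ.1 h hσ.2 hf

/-- A form of Cauchy's theorem in which the function need only be holomorphic at the points of the
closed annulus between the two contours. -/
theorem cint_shift_closed {σ τ : ℝ} (hσ : 0 < σ) (hστ : σ ≤ τ) {f : ℂ → ℂ}
    (hf : ∀ z, σ ≤ ‖z‖ → ‖z‖ ≤ τ → DifferentiableAt ℂ f z) : cint τ f = cint σ f := by
  unfold cint
  rw [Complex.circleIntegral_eq_of_differentiable_on_annulus_off_countable hσ hστ countable_empty]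
  · intro z hz
    simp only [Set.mem_sdiff, Metric.mem_closedBall, dist_zero_right, Metric.mem_ball, not_lt] at hz
    exact (hf z hz.2 hz.1).continuousAt.continuousWithinAt
  · rintro z ⟨⟨hz, hz'⟩, -⟩
    simp only [Metric.mem_closedBall, dist_zero_right, Metric.mem_ball, not_le] at hz hz'
    exact hf z hz'.le hz.le

theorem cint_eq_zero_of_disk {σ : ℝ} (hσ : 0 ≤ σ) {f : ℂ → ℂ}
    (hf : ∀ z, ‖z‖ ≤ σ → DifferentiableAt ℂ f z) : cint σ f = 0 := by
  unfold cint
  rw [Complex.circleIntegral_eq_zero_of_differentiable_on_off_countable hσ countable_empty]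
  · simp
  · intro z hz
    exact (hf z (by simpa using hz)).continuousAt.continuousWithinAt
  · rintro z ⟨hz, -⟩
    exact hf z (by simpa using (Metric.mem_ball.1 hz).le)

theorem cint_inv_sub_inside {σ : ℝ} {w : ℂ} (hw : ‖w‖ < σ) :
    cint σ (fun ζ => (ζ - w)⁻¹) = 1 := by
  unfold cint
  rw [circleIntegral.integral_sub_inv_of_mem_ball (by simpa using hw)]
  exact inv_mul_cancel₀ (by simp [Real.pi_ne_zero])

theorem cint_inv_sub_outside {σ : ℝ} (hσ : 0 ≤ σ) {w : ℂ} (hw : σ < ‖w‖) :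
    cint σ (fun ζ => (ζ - w)⁻¹) = 0 := by
  refine cint_eq_zero_of_disk hσ fun z hz => ?_
  have : z - w ≠ 0 := fun h => by
    rw [sub_eq_zero] at h; subst h; exact absurd hw (not_lt.2 hz)
  fun_prop (disch := assumption)

/-- Cauchy's formula on a disk. -/
theorem cint_cauchy_disk {σ : ℝ} {f : ℂ → ℂ}
    (hf : ∀ z, ‖z‖ ≤ σ → DifferentiableAt ℂ f z) {z : ℂ} (hz : ‖z‖ < σ) :
    cint σ (fun ζ => f ζ / (ζ - z)) = f z := by
  unfold cint
  have h := DiffContOnCl.two_pi_i_inv_smul_circleIntegral_sub_inv_smul (R := σ) (c := 0) (w := z)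
    (f := f) ?_ (by simpa using hz)
  · simp only [smul_eq_mul] at h
    rw [← h]
    simp only [div_eq_inv_mul]
  · refine DifferentiableOn.diffContOnCl fun x hx => ?_
    refine (hf x ?_).differentiableWithinAt
    simpa using Metric.closure_ball_subset_closedBall hx

/-- Cauchy's formula on an annulus. -/
theorem cint_cauchy_annulus {a b σ τ : ℝ} (ha : 0 ≤ a) {f : ℂ → ℂ} (hσ : a < σ) (hτ : τ < b)
    (hf : DifferentiableOn ℂ f (ann a b)) {z : ℂ} (hσz : σ < ‖z‖) (hzτ : ‖z‖ < τ) :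
    cint τ (fun ζ => f ζ / (ζ - z)) - cint σ (fun ζ => f ζ / (ζ - z)) = f z := by
  have hz : z ∈ ann a b := ⟨hσ.trans hσz, hzτ.trans hτ⟩
  have hd : DifferentiableOn ℂ (dslope f z) (ann a b) :=
    (Complex.differentiableOn_dslope ((isOpen_ann a b).mem_nhds hz)).2 hf
  -- Away from `z` the integrand is `dslope f z ζ + f z / (ζ - z)`. The first summand has no
  -- singularity, and the second one is integrated explicitly.
  have hs := cint_shift ha (σ := τ) (τ := σ) ⟨hσ.trans (hσz.trans hzτ), hτ⟩
    ⟨hσ, hσz.trans (hzτ.trans hτ)⟩ hd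
  have key : ∀ s : ℝ, a < s → s < b → s ≠ ‖z‖ →
      cint s (fun ζ => f ζ / (ζ - z)) = cint s (dslope f z) + f z * cint s (fun ζ => (ζ - z)⁻¹) := by
    intro s h1 h2 h3
    have hne : ∀ ζ ∈ Metric.sphere (0 : ℂ) s, ζ - z ≠ 0 := fun ζ hζ h => by
      rw [sub_eq_zero] at h; subst h; exact h3 (by simpa using hζ.symm)
    rw [← cint_const_mul, ← cint_add (ha.trans h1.le) (hd.continuousOn.mono (sphere_subset_ann h1 h2))]
    · refine cint_congr (ha.trans h1.le) fun ζ hζ => ?_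
      have h0 := hne ζ (by simpa using hζ)
      have h' : ζ ≠ z := fun h => h0 (by simp [h])
      rw [dslope_of_ne _ h', slope_def_field]
      field_simp; ring
    · exact continuousOn_const.mul ((continuousOn_id.sub continuousOn_const).inv₀ hne)
  rw [key τ (hσ.trans (hσz.trans hzτ)) hτ hzτ.ne', key σ hσ (hσz.trans (hzτ.trans hτ)) hσz.ne, hs,
    cint_inv_sub_inside hzτ, cint_inv_sub_outside (ha.trans hσ.le) hσz]
  ring

/-- Integrals depending holomorphically on a parameter through a Cauchy kernel. -/
theorem hasDerivAt_cauchyKernel_integral {p q : ℝ → ℂ} (hp : Continuous p) (hq : Continuous q)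
    {w₀ : ℂ} (hw : ∀ θ ∈ Icc 0 (2 * Real.pi), q θ ≠ w₀) :
    HasDerivAt (fun w => ∫ θ in (0 : ℝ)..2 * Real.pi, p θ / (q θ - w))
      (∫ θ in (0 : ℝ)..2 * Real.pi, p θ / (q θ - w₀) ^ 2) w₀ := by
  have hpi : (0 : ℝ) ≤ 2 * Real.pi := by positivity
  obtain ⟨δ, hδ, hδ'⟩ : ∃ δ > 0, ∀ θ ∈ Icc 0 (2 * Real.pi), δ ≤ ‖q θ - w₀‖ := by
    obtain ⟨x, hx, hx'⟩ := (isCompact_Icc (a := (0:ℝ)) (b := 2 * Real.pi)).exists_isMinOn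
      ⟨0, by simp [hpi]⟩ (f := fun θ => ‖q θ - w₀‖) (by fun_prop)
    exact ⟨_, norm_pos_iff.2 (sub_ne_zero.2 (hw x hx)), fun θ hθ => hx' hθ⟩
  obtain ⟨M, hM⟩ : ∃ M, ∀ θ ∈ Icc 0 (2 * Real.pi), ‖p θ‖ ≤ M :=
    (isCompact_Icc (a := (0:ℝ)) (b := 2 * Real.pi)).exists_bound_of_continuousOn hp.continuousOn
  have hfar : ∀ θ ∈ Icc 0 (2 * Real.pi), ∀ w ∈ Metric.ball w₀ (δ / 2), δ / 2 ≤ ‖q θ - w‖ := by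
    intro θ hθ w hw
    have h1 := hδ' θ hθ
    have h2 : ‖q θ - w₀‖ ≤ ‖q θ - w‖ + ‖w - w₀‖ := by
      simpa using norm_add_le (q θ - w) (w - w₀)
    have h3 : ‖w - w₀‖ < δ / 2 := by simpa [dist_eq_norm] using hw
    linarith
  have hIoc : Set.uIoc 0 (2 * Real.pi) ⊆ Icc 0 (2 * Real.pi) := by
    rw [uIoc_of_le hpi]; exact Ioc_subset_Icc_self
  refine (intervalIntegral.hasDerivAt_integral_of_dominated_loc_of_deriv_le
    (F := fun w θ => p θ / (q θ - w)) (F' := fun w θ => p θ / (q θ - w) ^ 2)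
    (bound := fun _ => M / (δ / 2) ^ 2) (Metric.ball_mem_nhds w₀ (half_pos hδ)) ?_ ?_ ?_ ?_ ?_ ?_).2
  · refine Eventually.of_forall fun w => ?_
    exact (hp.measurable.div (hq.measurable.sub_const w)).aestronglyMeasurable
  · refine ContinuousOn.intervalIntegrable ?_
    rw [uIcc_of_le hpi]
    exact hp.continuousOn.div (by fun_prop) fun θ hθ => sub_ne_zero.2 (hw θ hθ)
  · exact (hp.measurable.div ((hq.measurable.sub_const w₀).pow_const 2)).aestronglyMeasurable
  · refine Eventually.of_forall fun θ hθ w hw => ?_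
    have h1 := hfar θ (hIoc hθ) w hw
    rw [norm_div, norm_pow]
    have := hM θ (hIoc hθ)
    have h0 : 0 ≤ M := (norm_nonneg _).trans this
    gcongr
  · exact intervalIntegrable_const
  · refine Eventually.of_forall fun θ hθ w hw => ?_
    have h1 := hfar θ (hIoc hθ) w hw
    have h0 : q θ - w ≠ 0 := norm_pos_iff.1 (lt_of_lt_of_le (half_pos hδ) h1)
    have := ((hasDerivAt_const w (p θ)).div ((hasDerivAt_id w).const_sub (q θ)) h0)
    exact this.congr_deriv (by simp)

/-- The Cauchy integral `w ↦ (2πi)⁻¹ ∮ f dΦ / (Φ - w)` of a density `f` along the image under `Φ`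
of the circle of radius `σ`. -/
def CT (Φ : ℂ → ℂ) (σ : ℝ) (f : ℂ → ℂ) (w : ℂ) : ℂ :=
  cint σ (fun ζ => f ζ * deriv Φ ζ / (Φ ζ - w))

section CauchyTransform

variable {a b σ τ : ℝ} {Φ f : ℂ → ℂ}

theorem continuousOn_comp_circleMap {g : ℂ → ℂ} {σ : ℝ} (hσ : 0 ≤ σ)
    (hg : ContinuousOn g (Metric.sphere 0 σ)) : Continuous fun θ : ℝ => g (circleMap 0 σ θ) :=
  hg.comp_continuous (continuous_circleMap 0 σ) fun θ => circleMap_mem_sphere 0 hσ θ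

theorem CT_differentiableAt (hσ : 0 < σ) (hΦ : ContinuousOn Φ (Metric.sphere 0 σ))
    (hΦ' : ContinuousOn (deriv Φ) (Metric.sphere 0 σ)) (hf : ContinuousOn f (Metric.sphere 0 σ))
    {w : ℂ} (hw : w ∉ Φ '' Metric.sphere 0 σ) : DifferentiableAt ℂ (CT Φ σ f) w := by
  have h1 : CT Φ σ f = fun w => (2 * Real.pi : ℂ)⁻¹ * ∫ θ in (0 : ℝ)..2 * Real.pi,
      circleMap 0 σ θ * (f (circleMap 0 σ θ) * deriv Φ (circleMap 0 σ θ)) /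
        (Φ (circleMap 0 σ θ) - w) := by
    funext w
    rw [CT, cint_eq_average]
    simp only [mul_div_assoc]
  rw [h1]
  refine DifferentiableAt.const_mul (hasDerivAt_cauchyKernel_integral ?_
    (continuousOn_comp_circleMap hσ.le hΦ) ?_).differentiableAt _
  · exact (continuous_circleMap 0 σ).mul ((continuousOn_comp_circleMap hσ.le hf).mul
      (continuousOn_comp_circleMap hσ.le hΦ'))
  · intro θ _ h
    exact hw ⟨_, circleMap_mem_sphere 0 hσ.le θ, h⟩

/-- The Cauchy integral is dominated by `M / (‖w‖ - L)`, where `L` bounds the curve. -/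
theorem CT_tendsto_zero (hσ : 0 < σ) (hΦ : ContinuousOn Φ (Metric.sphere 0 σ))
    (hΦ' : ContinuousOn (deriv Φ) (Metric.sphere 0 σ)) (hf : ContinuousOn f (Metric.sphere 0 σ)) :
    Tendsto (CT Φ σ f) (cocompact ℂ) (𝓝 0) := by
  obtain ⟨M, hM⟩ := (isCompact_sphere (0 : ℂ) σ).exists_bound_of_continuousOn (hf.mul hΦ')
  obtain ⟨L, hL⟩ := (isCompact_sphere (0 : ℂ) σ).exists_bound_of_continuousOn hΦ
  have hM0 : 0 ≤ M := (norm_nonneg _).trans (hM σ (by simp [abs_of_pos hσ]))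
  have h1 : Tendsto (fun w : ℂ => σ * (M / (‖w‖ - L))) (cocompact ℂ) (𝓝 0) := by
    have : Tendsto (fun w : ℂ => ‖w‖ - L) (cocompact ℂ) atTop :=
      tendsto_atTop_add_const_right _ (-L) (tendsto_norm_cocompact_atTop (E := ℂ))
    simpa using (this.const_div_atTop M).const_mul σ
  refine squeeze_zero_norm' ?_ h1
  filter_upwards [(tendsto_norm_cocompact_atTop (E := ℂ)).eventually (eventually_gt_atTop L)]
    with w hw
  refine norm_cint_le hσ.le fun z hz => ?_
  have hz' : z ∈ Metric.sphere (0 : ℂ) σ := by simpa using hz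
  rw [norm_div]
  have h3 : ‖w‖ - L ≤ ‖Φ z - w‖ := by
    have := norm_sub_norm_le w (Φ z)
    rw [norm_sub_rev] at this
    linarith [hL z hz']
  have h4 : 0 < ‖w‖ - L := by linarith
  have : ‖f z * deriv Φ z‖ ≤ M := hM z hz'
  gcongr

/-- The contour of the Cauchy integral may be moved as long as the image curves do not cross `w`. -/
theorem CT_shift_closed (hσ : 0 < σ) (hστ : σ ≤ τ) (hΦ : DifferentiableOn ℂ Φ (ann a b))
    (hf : DifferentiableOn ℂ f (ann a b)) (ha : a < σ) (hb : τ < b) {w : ℂ}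
    (hw : ∀ z, σ ≤ ‖z‖ → ‖z‖ ≤ τ → Φ z ≠ w) : CT Φ τ f w = CT Φ σ f w := by
  refine cint_shift_closed hσ hστ fun z h1 h2 => ?_
  have hz : ann a b ∈ 𝓝 z := (isOpen_ann a b).mem_nhds ⟨ha.trans_le h1, h2.trans_lt hb⟩
  have := sub_ne_zero.2 (hw z h1 h2)
  exact ((hf.differentiableAt hz).mul ((hΦ.deriv (isOpen_ann a b)).differentiableAt hz)).div
    ((hΦ.differentiableAt hz).sub_const w) this

/-- The jump relation for the Cauchy integral. Its kernel differs from the Cauchy kernel of the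
annulus by the factor `Φ' ζ / dslope Φ z ζ`, which is one at `ζ = z`. -/
theorem CT_jump (ha : 0 ≤ a) (hΦ : DifferentiableOn ℂ Φ (ann a b)) (hinj : InjOn Φ (ann a b))
    (hf : DifferentiableOn ℂ f (ann a b)) (hσ : a < σ) (hτ : τ < b) {z : ℂ}
    (hz' : deriv Φ z ≠ 0) (hσz : σ < ‖z‖) (hzτ : ‖z‖ < τ) :
    CT Φ τ f (Φ z) - CT Φ σ f (Φ z) = f z := by
  have hz : z ∈ ann a b := ⟨hσ.trans hσz, hzτ.trans hτ⟩
  have hd : DifferentiableOn ℂ (dslope Φ z) (ann a b) :=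
    (Complex.differentiableOn_dslope ((isOpen_ann a b).mem_nhds hz)).2 hΦ
  have hne : ∀ ζ ∈ ann a b, dslope Φ z ζ ≠ 0 := by
    intro ζ hζ
    rcases eq_or_ne ζ z with rfl | h
    · rwa [dslope_same]
    · rw [dslope_of_ne _ h, slope_def_field]
      exact div_ne_zero (sub_ne_zero.2 fun e => h (hinj hζ hz e)) (sub_ne_zero.2 h)
  have h1 := cint_cauchy_annulus ha hσ hτ ((hf.mul (hΦ.deriv (isOpen_ann a b))).div hd hne) hσz hzτ
  have key : ∀ s : ℝ, a < s → s < b → s ≠ ‖z‖ → CT Φ s f (Φ z) =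
      cint s (fun ζ => (f ζ * deriv Φ ζ / dslope Φ z ζ) / (ζ - z)) := by
    intro s h1 h2 h3
    refine cint_congr (ha.trans h1.le) fun ζ hζ => ?_
    have h' : ζ ≠ z := fun h => h3 (by rw [← hζ, h])
    rw [dslope_of_ne _ h', slope_def_field]
    have := sub_ne_zero.2 h'
    field_simp
  rw [key τ (hσ.trans (hσz.trans hzτ)) hτ hzτ.ne', key σ hσ (hσz.trans (hzτ.trans hτ)) hσz.ne]
  simp only [Pi.div_apply, Pi.mul_apply] at h1
  rw [h1, dslope_same]
  field_simp

end CauchyTransform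

/-! ### The two sides of an analytic Jordan curve -/

/-- An annulus is the image of a vertical strip under the exponential function. -/
theorem isPreconnected_ann {a b : ℝ} (ha : 0 < a) : IsPreconnected (ann a b) := by
  rcases le_or_gt b 0 with hb | hb
  · convert isPreconnected_empty
    ext z
    simp only [mem_ann, mem_empty_iff_false, iff_false, not_and, not_lt]
    exact fun _ => hb.trans (norm_nonneg z)
  have h : ann a b = Complex.exp '' (Complex.re ⁻¹' Ioo (Real.log a) (Real.log b)) := by
    ext z
    constructor
    · rintro ⟨h1, h2⟩
      have hz : 0 < ‖z‖ := ha.trans h1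
      refine ⟨Complex.log z, ?_, Complex.exp_log (norm_pos_iff.1 hz)⟩
      simp only [mem_preimage, Complex.log_re, mem_Ioo]
      exact ⟨Real.log_lt_log ha h1, Real.log_lt_log hz h2⟩
    · rintro ⟨w, ⟨h1, h2⟩, rfl⟩
      rw [mem_ann, Complex.norm_exp]
      exact ⟨(Real.log_lt_iff_lt_exp ha).1 h1, (Real.lt_log_iff_exp_lt hb).1 h2⟩
  rw [h]
  refine IsPreconnected.image ?_ _ Complex.continuous_exp.continuousOn
  have : Convex ℝ (Complex.re ⁻¹' Ioo (Real.log a) (Real.log b)) :=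
    (convex_Ioo _ _).linear_preimage Complex.reLm
  exact this.isPreconnected

/-- A neighbourhood of a circle contains an annulus around it. -/
theorem exists_ann_subset_of_isOpen {U : Set ℂ} (hU : IsOpen U) {τ : ℝ} (hτ : 0 < τ)
    (h : Metric.sphere (0 : ℂ) τ ⊆ U) : ∃ δ > 0, ∀ z : ℂ, |‖z‖ - τ| < δ → z ∈ U := by
  obtain ⟨δ, hδ, hsub⟩ := (isCompact_sphere (0 : ℂ) τ).exists_thickening_subset_open hU h
  refine ⟨min δ τ, lt_min hδ hτ, fun z hz => hsub ?_⟩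
  have hz0 : 0 < ‖z‖ := by
    have := (abs_lt.1 (hz.trans_le (min_le_right _ _))).1
    linarith
  rw [Metric.mem_thickening_iff]
  refine ⟨(τ / ‖z‖ : ℝ) • z, ?_, ?_⟩
  · simp [abs_of_pos hτ, hz0.ne']
  · have : z - (τ / ‖z‖ : ℝ) • z = ((‖z‖ - τ) / ‖z‖ : ℝ) • z := by
      rw [sub_div, sub_smul, div_self hz0.ne', one_smul]
    rw [dist_eq_norm, this, norm_smul, Real.norm_eq_abs, abs_div, abs_norm,
      div_mul_cancel₀ _ hz0.ne']
    exact hz.trans_le (min_le_left _ _)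

/-- A holomorphic embedding of an annulus around the unit circle into `ℂ ∖ {0}`, whose restriction
to the unit circle has winding number one around the origin. -/
structure NiceMap (a b : ℝ) (Φ : ℂ → ℂ) : Prop where
  pos : 0 < a
  lt_one : a < 1
  one_lt : 1 < b
  diff : DifferentiableOn ℂ Φ (ann a b)
  inj : InjOn Φ (ann a b)
  ne_zero : ∀ z ∈ ann a b, Φ z ≠ 0
  deriv_ne : ∀ z ∈ ann a b, deriv Φ z ≠ 0
  wind : CT Φ 1 (fun _ => 1) 0 = 1

/-- The points off the curve `Φ(|z| = σ)` around which it winds once. -/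
def inside (Φ : ℂ → ℂ) (σ : ℝ) : Set ℂ := {w | w ∉ Φ '' Metric.sphere 0 σ ∧ CT Φ σ (fun _ => 1) w = 1}

/-- The points off the curve `Φ(|z| = σ)` around which it does not wind. -/
def outside (Φ : ℂ → ℂ) (σ : ℝ) : Set ℂ := {w | w ∉ Φ '' Metric.sphere 0 σ ∧ CT Φ σ (fun _ => 1) w = 0}

namespace NiceMap

variable {a b σ τ : ℝ} {Φ : ℂ → ℂ}

theorem mono (h : NiceMap a b Φ) {a' b' : ℝ} (ha : a ≤ a') (ha' : a' < 1) (hb : b' ≤ b)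
    (hb' : 1 < b') : NiceMap a' b' Φ where
  pos := h.pos.trans_le ha
  lt_one := ha'
  one_lt := hb'
  diff := h.diff.mono (ann_mono ha hb)
  inj := h.inj.mono (ann_mono ha hb)
  ne_zero z hz := h.ne_zero z (ann_mono ha hb hz)
  deriv_ne z hz := h.deriv_ne z (ann_mono ha hb hz)
  wind := h.wind

theorem differentiableAt (h : NiceMap a b Φ) {z : ℂ} (hz : z ∈ ann a b) : DifferentiableAt ℂ Φ z :=
  h.diff.differentiableAt ((isOpen_ann a b).mem_nhds hz)

theorem differentiableOn_deriv (h : NiceMap a b Φ) : DifferentiableOn ℂ (deriv Φ) (ann a b) :=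
  h.diff.deriv (isOpen_ann a b)

theorem pos_of_mem (h : NiceMap a b Φ) (hσ : σ ∈ Ioo a b) : 0 < σ := h.pos.trans hσ.1

theorem one_mem (h : NiceMap a b Φ) : (1 : ℝ) ∈ Ioo a b := ⟨h.lt_one, h.one_lt⟩

theorem map_nhds (h : NiceMap a b Φ) {z : ℂ} (hz : z ∈ ann a b) :
    map Φ (𝓝 z) = 𝓝 (Φ z) := by
  have hs : HasStrictDerivAt Φ (deriv Φ z) z :=
    (h.diff.analyticAt ((isOpen_ann a b).mem_nhds hz)).hasStrictDerivAt
  exact hs.map_nhds_eq (h.deriv_ne z hz)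

theorem isClosed_curve (h : NiceMap a b Φ) (hσ : σ ∈ Ioo a b) :
    IsClosed (Φ '' Metric.sphere 0 σ) :=
  ((isCompact_sphere (0 : ℂ) σ).image_of_continuousOn
    (h.diff.continuousOn.mono (sphere_subset_ann hσ.1 hσ.2))).isClosed

theorem notMem_curve (h : NiceMap a b Φ) (hσ : σ ∈ Ioo a b) {z : ℂ} (hz : z ∈ ann a b)
    (hne : ‖z‖ ≠ σ) : Φ z ∉ Φ '' Metric.sphere 0 σ := by
  rintro ⟨ζ, hζ, e⟩
  have := h.inj (sphere_subset_ann hσ.1 hσ.2 hζ) hz e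
  exact hne (by rw [← this]; simpa using hζ)

theorem CT_differentiableAt (h : NiceMap a b Φ) (hσ : σ ∈ Ioo a b) {f : ℂ → ℂ}
    (hf : ContinuousOn f (Metric.sphere 0 σ)) {w : ℂ} (hw : w ∉ Φ '' Metric.sphere 0 σ) :
    DifferentiableAt ℂ (CT Φ σ f) w :=
  CDef.CT_differentiableAt (h.pos_of_mem hσ)
    (h.diff.continuousOn.mono (sphere_subset_ann hσ.1 hσ.2))
    (h.differentiableOn_deriv.continuousOn.mono (sphere_subset_ann hσ.1 hσ.2)) hf hw

theorem CT_tendsto_zero (h : NiceMap a b Φ) (hσ : σ ∈ Ioo a b) {f : ℂ → ℂ}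
    (hf : ContinuousOn f (Metric.sphere 0 σ)) : Tendsto (CT Φ σ f) (cocompact ℂ) (𝓝 0) :=
  CDef.CT_tendsto_zero (h.pos_of_mem hσ)
    (h.diff.continuousOn.mono (sphere_subset_ann hσ.1 hσ.2))
    (h.differentiableOn_deriv.continuousOn.mono (sphere_subset_ann hσ.1 hσ.2)) hf

/-- The winding number is locally constant off the curve, because `(Φ - w) / (Φ - w₀)` stays in the
slit plane for `w` near `w₀`. -/
theorem wind_locally_const (h : NiceMap a b Φ) (hσ : σ ∈ Ioo a b) {w₀ : ℂ}
    (hw : w₀ ∉ Φ '' Metric.sphere 0 σ) :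
    ∀ᶠ w in 𝓝 w₀, CT Φ σ (fun _ => 1) w = CT Φ σ (fun _ => 1) w₀ := by
  have hσ0 := h.pos_of_mem hσ
  obtain ⟨δ, hδ, hδ'⟩ := Metric.isOpen_iff.1 (h.isClosed_curve hσ).isOpen_compl w₀ hw
  filter_upwards [Metric.ball_mem_nhds w₀ hδ] with w hw1
  have hcont := h.diff.continuousOn.mono (sphere_subset_ann hσ.1 hσ.2)
  have hcont' := h.differentiableOn_deriv.continuousOn.mono (sphere_subset_ann hσ.1 hσ.2)
  have hd : ∀ z ∈ Metric.sphere (0 : ℂ) σ, ‖w - w₀‖ < ‖Φ z - w₀‖ := by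
    intro z hz
    have h1 : Φ z ∉ Metric.ball w₀ δ := fun h1 => hδ' h1 ⟨z, hz, rfl⟩
    rw [Metric.mem_ball, dist_eq_norm, not_lt] at h1
    exact (by simpa [dist_eq_norm] using hw1 : ‖w - w₀‖ < δ).trans_le h1
  have hne0 : ∀ z ∈ Metric.sphere (0 : ℂ) σ, Φ z - w₀ ≠ 0 := fun z hz =>
    norm_pos_iff.1 ((norm_nonneg _).trans_lt (hd z hz))
  have hne : ∀ z ∈ Metric.sphere (0 : ℂ) σ, Φ z - w ≠ 0 := by
    intro z hz e
    have := hd z hz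
    rw [sub_eq_zero] at e
    rw [e] at this
    exact lt_irrefl _ this
  unfold CT
  rw [← sub_eq_zero, ← cint_sub hσ0.le]
  rotate_left
  · exact (continuousOn_const.mul hcont').div (hcont.sub continuousOn_const) hne
  · exact (continuousOn_const.mul hcont').div (hcont.sub continuousOn_const) hne0
  unfold cint
  -- The difference of the two integrands is the derivative of `log ((Φ - w) / (Φ - w₀))`.
  rw [circleIntegral.integral_eq_zero_of_hasDerivWithinAt
    (f := fun z => Complex.log ((Φ z - w) / (Φ z - w₀))) hσ0.le, mul_zero]
  intro z hz
  have hΦ : HasDerivAt Φ (deriv Φ z) z :=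
    (h.differentiableAt (sphere_subset_ann hσ.1 hσ.2 hz)).hasDerivAt
  have hq : HasDerivAt (fun x => (Φ x - w) / (Φ x - w₀))
      ((deriv Φ z * (Φ z - w₀) - (Φ z - w) * deriv Φ z) / (Φ z - w₀) ^ 2) z :=
    (hΦ.sub_const w).div (hΦ.sub_const w₀) (hne0 z hz)
  have hslit : (Φ z - w) / (Φ z - w₀) ∈ Complex.slitPlane := by
    have e : (Φ z - w) / (Φ z - w₀) = 1 + (w₀ - w) / (Φ z - w₀) := by
      have := hne0 z hz
      field_simp; ring
    rw [e]
    refine Complex.mem_slitPlane_of_norm_lt_one ?_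
    rw [norm_div, norm_sub_rev, div_lt_one (norm_pos_iff.2 (hne0 z hz))]
    exact hd z hz
  have h1 := hne0 z hz
  have h2 := hne z hz
  refine ((hq.clog hslit).congr_deriv ?_).hasDerivWithinAt
  field_simp

/-- On an annulus on one side of the circle of radius `σ`, the winding number around the points `Φ
z` is constant, as it is locally constant. -/
theorem wind_comp_const (h : NiceMap a b Φ) (hσ : σ ∈ Ioo a b) {c d : ℝ} (hc : a ≤ c) (hd : d ≤ b)
    (hcd : d ≤ σ ∨ σ ≤ c) {z z' : ℂ} (hz : z ∈ ann c d) (hz' : z' ∈ ann c d) :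
    CT Φ σ (fun _ => 1) (Φ z) = CT Φ σ (fun _ => 1) (Φ z') := by
  have hsub : ann c d ⊆ ann a b := ann_mono hc hd
  have hcurve : ∀ x ∈ ann c d, Φ x ∉ Φ '' Metric.sphere 0 σ := by
    intro x hx
    refine h.notMem_curve hσ (hsub hx) ?_
    rcases hcd with h1 | h1
    · exact (hx.2.trans_le h1).ne
    · exact (h1.trans_lt hx.1).ne'
  have hloc : ∀ x ∈ ann c d, (fun y => CT Φ σ (fun _ => 1) (Φ y)) =ᶠ[𝓝 x]
      fun _ => CT Φ σ (fun _ => 1) (Φ x) := fun x hx =>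
    (h.differentiableAt (hsub hx)).continuousAt.eventually (h.wind_locally_const hσ (hcurve x hx))
  refine (isOpen_ann c d).is_const_of_deriv_eq_zero (𝕜 := ℂ)
    (f := fun y => CT Φ σ (fun _ => 1) (Φ y)) (isPreconnected_ann (h.pos.trans_le hc)) ?_ ?_ hz hz'
  · exact fun x hx => ((hloc x hx).differentiableAt_iff.2
      (differentiableAt_const _)).differentiableWithinAt
  · intro x hx
    rw [(hloc x hx).deriv_eq]; simp

theorem wind_zero (h : NiceMap a b Φ) (hσ : σ ∈ Ioo a b) : CT Φ σ (fun _ => 1) 0 = 1 := by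
  refine Eq.trans ?_ h.wind
  refine cint_shift h.pos.le hσ h.one_mem ?_
  refine DifferentiableOn.div ((differentiableOn_const 1).mul h.differentiableOn_deriv)
    (h.diff.sub_const 0) fun z hz => ?_
  simpa using h.ne_zero z hz

theorem zero_notMem_curve (h : NiceMap a b Φ) (hσ : σ ∈ Ioo a b) :
    (0 : ℂ) ∉ Φ '' Metric.sphere 0 σ := by
  rintro ⟨z, hz, e⟩
  exact h.ne_zero z (sphere_subset_ann hσ.1 hσ.2 hz) e

/-- The winding number jumps by one across the curve. -/
theorem wind_jump (h : NiceMap a b Φ) (hσ : σ ∈ Ioo a b) {z z' : ℂ} (hz : z ∈ ann a σ)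
    (hz' : z' ∈ ann σ b) :
    CT Φ σ (fun _ => 1) (Φ z) = CT Φ σ (fun _ => 1) (Φ z') + 1 := by
  obtain ⟨τ, h1, h2⟩ := exists_between hz'.2
  have hτ : τ ∈ Ioo a b := ⟨hσ.1.trans (hz'.1.trans h1), h2⟩
  -- The winding number of the larger curve `Φ(|z| = τ)`, with `Φ z'` between the two curves, is
  -- compared with that of `Φ(|z| = σ)`: around `Φ z` they agree, around `Φ z'` they differ by the
  -- jump.
  have e1 : CT Φ σ (fun _ => 1) (Φ z) = CT Φ τ (fun _ => 1) (Φ z) := by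
    refine (CT_shift_closed (h.pos_of_mem hσ) (hz'.1.trans h1).le h.diff (differentiableOn_const _)
      hσ.1 h2 fun ζ h3 h4 e => ?_).symm
    have := h.inj ⟨hσ.1.trans_le h3, h4.trans_lt h2⟩ (ann_mono le_rfl hσ.2.le hz) e
    rw [this] at h3
    exact absurd hz.2 (not_lt.2 h3)
  have e2 : CT Φ τ (fun _ => 1) (Φ z) = CT Φ τ (fun _ => 1) (Φ z') :=
    h.wind_comp_const hτ le_rfl h2.le (Or.inl le_rfl) (ann_mono le_rfl (hz'.1.trans h1).le hz)
      ⟨hσ.1.trans hz'.1, h1⟩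
  have e3 := CT_jump h.pos.le h.diff h.inj (differentiableOn_const (c := (1 : ℂ))) hσ.1 h2
    (h.deriv_ne z' ⟨hσ.1.trans hz'.1, hz'.2⟩) hz'.1 h1
  rw [e1, e2]
  linear_combination e3

/-- Off the curve, the winding number takes no value other than those next to the curve: the set of
points where it does is open and closed in the plane. -/
theorem wind_trichotomy (h : NiceMap a b Φ) (hσ : σ ∈ Ioo a b) {z z' w : ℂ} (hz : z ∈ ann a σ)
    (hz' : z' ∈ ann σ b) (hw : w ∉ Φ '' Metric.sphere 0 σ) :
    CT Φ σ (fun _ => 1) w = CT Φ σ (fun _ => 1) (Φ z) ∨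
      CT Φ σ (fun _ => 1) w = CT Φ σ (fun _ => 1) (Φ z') := by
  by_contra! hcon
  set S : Set ℂ := {x | x ∉ Φ '' Metric.sphere 0 σ ∧
    CT Φ σ (fun _ => 1) x = CT Φ σ (fun _ => 1) w} with hS
  have hopen : IsOpen S := by
    rw [isOpen_iff_mem_nhds]
    rintro x ⟨hx1, hx2⟩
    filter_upwards [h.wind_locally_const hσ hx1,
      (h.isClosed_curve hσ).isOpen_compl.mem_nhds hx1] with y hy1 hy2
    exact ⟨hy2, hy1.trans hx2⟩
  have hclosed : IsClosed S := by
    rw [← isOpen_compl_iff, isOpen_iff_mem_nhds]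
    intro x hx
    by_cases hxc : x ∈ Φ '' Metric.sphere 0 σ
    · obtain ⟨ζ, hζ, rfl⟩ := hxc
      have hζ' := sphere_subset_ann hσ.1 hσ.2 hζ
      rw [← h.map_nhds hζ', mem_map]
      filter_upwards [(isOpen_ann a b).mem_nhds hζ'] with y hy
      rintro ⟨hy1, hy2⟩
      rcases lt_trichotomy ‖y‖ σ with h1 | h1 | h1
      · exact hcon.1 (hy2.symm.trans
          (h.wind_comp_const hσ le_rfl hσ.2.le (Or.inl le_rfl) ⟨hy.1, h1⟩ hz))
      · exact hy1 ⟨y, by simpa using h1, rfl⟩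
      · exact hcon.2 (hy2.symm.trans
          (h.wind_comp_const hσ hσ.1.le le_rfl (Or.inr le_rfl) ⟨h1, hy.2⟩ hz'))
    · filter_upwards [h.wind_locally_const hσ hxc] with y hy1
      rintro ⟨-, hy2⟩
      exact hx ⟨hxc, hy1.symm.trans hy2⟩
  have huniv : S = univ := IsClopen.eq_univ ⟨hclosed, hopen⟩ ⟨w, hw, rfl⟩
  have : Φ σ ∈ S := huniv ▸ mem_univ _
  exact this.1 ⟨σ, by simp [abs_of_pos (h.pos_of_mem hσ)], rfl⟩

/-- The values next to the curve differ by one, and the winding number takes no others. It is one at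
the origin and tends to zero at infinity, so the values are one and zero. -/
theorem wind_values (h : NiceMap a b Φ) (hσ : σ ∈ Ioo a b) {z z' : ℂ} (hz : z ∈ ann a σ)
    (hz' : z' ∈ ann σ b) :
    CT Φ σ (fun _ => 1) (Φ z) = 1 ∧ CT Φ σ (fun _ => 1) (Φ z') = 0 := by
  have hj := h.wind_jump hσ hz hz'
  have h1 := h.wind_trichotomy hσ hz hz' (h.zero_notMem_curve hσ)
  rw [h.wind_zero hσ] at h1
  rcases h1 with h1 | h1
  · refine ⟨h1.symm, ?_⟩
    rw [← h1] at hj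
    linear_combination -hj
  · exfalso
    rw [← h1] at hj
    -- If the origin were on the outer side, the two values would be two and one, which contradicts
    -- the limit zero at infinity.
    have ht := h.CT_tendsto_zero hσ (f := fun _ => 1) continuousOn_const
    have hb : ∀ᶠ w in cocompact ℂ, ‖CT Φ σ (fun _ => 1) w‖ < 1 := by
      simpa using ht.norm.eventually (gt_mem_nhds (by simp))
    have hc : ∀ᶠ w in cocompact ℂ, w ∉ Φ '' Metric.sphere 0 σ :=
      ((isCompact_sphere (0 : ℂ) σ).image_of_continuousOn
        (h.diff.continuousOn.mono (sphere_subset_ann hσ.1 hσ.2))).compl_mem_cocompact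
    obtain ⟨w, hw1, hw2⟩ := (hb.and hc).exists
    rcases h.wind_trichotomy hσ hz hz' hw2 with h2 | h2
    · rw [h2, hj] at hw1; norm_num at hw1
    · rw [h2, ← h1] at hw1; norm_num at hw1

theorem exists_mem_ann (h : NiceMap a b Φ) {c d : ℝ} (hc : a ≤ c) (hcd : c < d) :
    ∃ z : ℂ, z ∈ ann c d := by
  obtain ⟨r, h1, h2⟩ := exists_between hcd
  have : 0 < r := h.pos.trans_le (hc.trans h1.le)
  exact ⟨r, by simpa [mem_ann, abs_of_pos this] using ⟨h1, h2⟩⟩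

theorem map_mem_inside (h : NiceMap a b Φ) (hσ : σ ∈ Ioo a b) {z : ℂ} (hz : z ∈ ann a σ) :
    Φ z ∈ inside Φ σ := by
  obtain ⟨z', hz'⟩ := h.exists_mem_ann hσ.1.le hσ.2
  exact ⟨h.notMem_curve hσ (ann_mono le_rfl hσ.2.le hz) hz.2.ne, (h.wind_values hσ hz hz').1⟩

theorem map_mem_outside (h : NiceMap a b Φ) (hσ : σ ∈ Ioo a b) {z : ℂ} (hz : z ∈ ann σ b) :
    Φ z ∈ outside Φ σ := by
  obtain ⟨z', hz'⟩ := h.exists_mem_ann le_rfl hσ.1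
  exact ⟨h.notMem_curve hσ (ann_mono hσ.1.le le_rfl hz) hz.1.ne', (h.wind_values hσ hz' hz).2⟩

theorem mem_inside_or_outside (h : NiceMap a b Φ) (hσ : σ ∈ Ioo a b) {w : ℂ}
    (hw : w ∉ Φ '' Metric.sphere 0 σ) : w ∈ inside Φ σ ∨ w ∈ outside Φ σ := by
  obtain ⟨z, hz⟩ := h.exists_mem_ann le_rfl hσ.1
  obtain ⟨z', hz'⟩ := h.exists_mem_ann hσ.1.le hσ.2
  obtain ⟨e1, e2⟩ := h.wind_values hσ hz hz'
  rcases h.wind_trichotomy hσ hz hz' hw with h1 | h1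
  · exact Or.inl ⟨hw, h1.trans e1⟩
  · exact Or.inr ⟨hw, h1.trans e2⟩

theorem zero_mem_inside (h : NiceMap a b Φ) (hσ : σ ∈ Ioo a b) : (0 : ℂ) ∈ inside Φ σ :=
  ⟨h.zero_notMem_curve hσ, h.wind_zero hσ⟩

theorem notMem_outside_of_inside {w : ℂ} (hw : w ∈ inside Φ σ) : w ∉ outside Φ σ :=
  fun h => zero_ne_one (h.2.symm.trans hw.2)

theorem isOpen_inside (h : NiceMap a b Φ) (hσ : σ ∈ Ioo a b) : IsOpen (inside Φ σ) := by
  rw [isOpen_iff_mem_nhds]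
  rintro x ⟨hx1, hx2⟩
  filter_upwards [h.wind_locally_const hσ hx1,
    (h.isClosed_curve hσ).isOpen_compl.mem_nhds hx1] with y hy1 hy2
  exact ⟨hy2, hy1.trans hx2⟩

theorem isOpen_outside (h : NiceMap a b Φ) (hσ : σ ∈ Ioo a b) : IsOpen (outside Φ σ) := by
  rw [isOpen_iff_mem_nhds]
  rintro x ⟨hx1, hx2⟩
  filter_upwards [h.wind_locally_const hσ hx1,
    (h.isClosed_curve hσ).isOpen_compl.mem_nhds hx1] with y hy1 hy2
  exact ⟨hy2, hy1.trans hx2⟩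

theorem closure_inside (h : NiceMap a b Φ) (hσ : σ ∈ Ioo a b) :
    closure (inside Φ σ) ⊆ inside Φ σ ∪ Φ '' Metric.sphere 0 σ := by
  intro x hx
  by_contra hcon
  simp only [mem_union, not_or] at hcon
  rcases h.mem_inside_or_outside hσ hcon.2 with h1 | h1
  · exact hcon.1 h1
  · obtain ⟨y, hy1, hy2⟩ := mem_closure_iff.1 hx _ (h.isOpen_outside hσ) h1
    exact notMem_outside_of_inside hy2 hy1

theorem closure_outside (h : NiceMap a b Φ) (hσ : σ ∈ Ioo a b) :
    closure (outside Φ σ) ⊆ outside Φ σ ∪ Φ '' Metric.sphere 0 σ := by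
  intro x hx
  by_contra hcon
  simp only [mem_union, not_or] at hcon
  rcases h.mem_inside_or_outside hσ hcon.2 with h1 | h1
  · obtain ⟨y, hy1, hy2⟩ := mem_closure_iff.1 hx _ (h.isOpen_inside hσ) h1
    exact notMem_outside_of_inside hy1 hy2
  · exact hcon.1 h1

theorem isBounded_inside (h : NiceMap a b Φ) (hσ : σ ∈ Ioo a b) :
    Bornology.IsBounded (inside Φ σ) := by
  have ht := h.CT_tendsto_zero hσ (f := fun _ => 1) continuousOn_const
  have hb : ∀ᶠ w in cocompact ℂ, ‖CT Φ σ (fun _ => 1) w‖ < 1 := by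
    simpa using ht.norm.eventually (gt_mem_nhds (by simp))
  rw [← Metric.cobounded_eq_cocompact] at hb
  refine (Bornology.isBounded_def.2 ?_)
  filter_upwards [hb] with w hw hw'
  rw [hw'.2] at hw
  norm_num at hw

/-- The inside grows with the radius: moving the contour crosses only points between the two curves,
which are outside the smaller one. -/
theorem inside_mono (h : NiceMap a b Φ) (hσ : σ ∈ Ioo a b) (hτ : τ ∈ Ioo a b) (hστ : σ ≤ τ) :
    inside Φ σ ⊆ inside Φ τ := by
  intro w hw
  by_cases hw' : ∃ z, σ ≤ ‖z‖ ∧ ‖z‖ ≤ τ ∧ Φ z = w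
  · exfalso
    obtain ⟨z, h1, h2, rfl⟩ := hw'
    rcases h1.eq_or_lt with h1 | h1
    · exact hw.1 ⟨z, by simpa using h1.symm, rfl⟩
    · exact notMem_outside_of_inside hw (h.map_mem_outside hσ ⟨h1, h2.trans_lt hτ.2⟩)
  · push Not at hw'
    refine ⟨?_, ?_⟩
    · rintro ⟨z, hz, e⟩
      rw [mem_sphere_zero_iff_norm] at hz
      exact hw' z (hστ.trans hz.ge) hz.le e
    · rw [CT_shift_closed (h.pos_of_mem hσ) hστ h.diff (differentiableOn_const _) hσ.1 hτ.2 hw']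
      exact hw.2

/-- The outside shrinks as the radius grows. -/
theorem outside_mono (h : NiceMap a b Φ) (hσ : σ ∈ Ioo a b) (hτ : τ ∈ Ioo a b) (hστ : σ ≤ τ) :
    outside Φ τ ⊆ outside Φ σ := by
  intro w hw
  by_cases hw' : ∃ z, σ ≤ ‖z‖ ∧ ‖z‖ ≤ τ ∧ Φ z = w
  · exfalso
    obtain ⟨z, h1, h2, rfl⟩ := hw'
    rcases h2.eq_or_lt with h2 | h2
    · exact hw.1 ⟨z, by simpa using h2, rfl⟩
    · exact notMem_outside_of_inside (h.map_mem_inside hτ ⟨hσ.1.trans_le h1, h2⟩) hw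
  · push Not at hw'
    refine ⟨?_, ?_⟩
    · rintro ⟨z, hz, e⟩
      rw [mem_sphere_zero_iff_norm] at hz
      exact hw' z hz.ge (hz.le.trans hστ) e
    · rw [← CT_shift_closed (h.pos_of_mem hσ) hστ h.diff (differentiableOn_const _) hσ.1 hτ.2 hw']
      exact hw.2

theorem curve_subset_inside (h : NiceMap a b Φ) (hσ : σ ∈ Ioo a b) (hτ : τ ∈ Ioo a b)
    (hστ : σ < τ) : Φ '' Metric.sphere 0 σ ⊆ inside Φ τ := by
  rintro _ ⟨z, hz, rfl⟩
  rw [mem_sphere_zero_iff_norm] at hz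
  exact h.map_mem_inside hτ ⟨hz ▸ hσ.1, hz ▸ hστ⟩

theorem curve_subset_outside (h : NiceMap a b Φ) (hσ : σ ∈ Ioo a b) (hτ : τ ∈ Ioo a b)
    (hστ : σ < τ) : Φ '' Metric.sphere 0 τ ⊆ outside Φ σ := by
  rintro _ ⟨z, hz, rfl⟩
  rw [mem_sphere_zero_iff_norm] at hz
  exact h.map_mem_outside hσ ⟨hz ▸ hστ, hz ▸ hτ.2⟩

/-- A point inside a level curve is also inside the nearby smaller ones. -/
theorem exists_mem_inside_of_mem (h : NiceMap a b Φ) (hτ : τ ∈ Ioo a b) {w : ℂ}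
    (hw : w ∈ inside Φ τ) : ∃ σ₀ ∈ Ioo a τ, ∀ σ ∈ Ioo σ₀ τ, w ∈ inside Φ σ := by
  by_cases hw' : ∃ z ∈ ann a b, Φ z = w
  · obtain ⟨z, hz, rfl⟩ := hw'
    have hzτ : ‖z‖ < τ := by
      by_contra hcon
      rcases (not_lt.1 hcon).eq_or_lt with h1 | h1
      · exact hw.1 ⟨z, by simpa using h1.symm, rfl⟩
      · exact notMem_outside_of_inside hw (h.map_mem_outside hτ ⟨h1, hz.2⟩)
    exact ⟨‖z‖, ⟨hz.1, hzτ⟩, fun σ hσ =>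
      h.map_mem_inside ⟨hz.1.trans hσ.1, hσ.2.trans hτ.2⟩ ⟨hz.1, hσ.1⟩⟩
  · push Not at hw'
    obtain ⟨σ₀, h1, h2⟩ := exists_between hτ.1
    refine ⟨σ₀, ⟨h1, h2⟩, fun σ hσ => ?_⟩
    have hσ' : σ ∈ Ioo a b := ⟨h1.trans hσ.1, hσ.2.trans hτ.2⟩
    refine ⟨?_, ?_⟩
    · rintro ⟨z, hz, e⟩
      exact hw' z (sphere_subset_ann hσ'.1 hσ'.2 hz) e
    · rw [← CT_shift_closed (h.pos_of_mem hσ') hσ.2.le h.diff (differentiableOn_const _) hσ'.1 hτ.2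
        fun z h3 h4 => hw' z ⟨hσ'.1.trans_le h3, h4.trans_lt hτ.2⟩]
      exact hw.2

/-- The maximum principle on the inside of a level curve. -/
theorem norm_le_of_level (h : NiceMap a b Φ) (hσ : σ ∈ Ioo a b) (hτ : τ ∈ Ioo a b) (hστ : σ < τ)
    {Y : ℂ → ℂ} (hY : DifferentiableOn ℂ Y (inside Φ τ)) {M : ℝ}
    (hM : ∀ z, ‖z‖ = σ → ‖Y (Φ z)‖ ≤ M) {w : ℂ} (hw : w ∈ inside Φ σ) : ‖Y w‖ ≤ M := by
  have hcl : closure (inside Φ σ) ⊆ inside Φ τ := (h.closure_inside hσ).trans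
    (union_subset (h.inside_mono hσ hτ hστ.le) (h.curve_subset_inside hσ hτ hστ))
  refine Complex.norm_le_of_forall_mem_frontier_norm_le (h.isBounded_inside hσ)
    (hY.mono hcl).diffContOnCl ?_ (subset_closure hw)
  intro x hx
  rw [(h.isOpen_inside hσ).frontier_eq] at hx
  rcases h.closure_inside hσ hx.1 with h1 | ⟨z, hz, rfl⟩
  · exact absurd h1 hx.2
  · exact hM z (by simpa using hz)

/-- The maximum principle on the outside of a level curve. -/
theorem norm_le_of_level_outside (h : NiceMap a b Φ) (hσ : σ ∈ Ioo a b) (hτ : τ ∈ Ioo a b)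
    (hτσ : τ < σ) {Y : ℂ → ℂ} (hY : DifferentiableOn ℂ Y (outside Φ τ))
    (hY0 : Tendsto Y (cocompact ℂ) (𝓝 0)) {M : ℝ}
    (hM : ∀ z, ‖z‖ = σ → ‖Y (Φ z)‖ ≤ M) {w : ℂ} (hw : w ∈ outside Φ σ) : ‖Y w‖ ≤ M := by
  have hM0 : 0 ≤ M := (norm_nonneg _).trans (hM σ (by simp [abs_of_pos (h.pos_of_mem hσ)]))
  have hcl : closure (outside Φ σ) ⊆ outside Φ τ := (h.closure_outside hσ).trans
    (union_subset (h.outside_mono hτ hσ hτσ.le) (h.curve_subset_outside hτ hσ hτσ))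
  -- For `w` outside the curve, the principle is applied to the part of the outside in a disk so
  -- large that `|Y| < ε` on its boundary.
  refine le_of_forall_pos_le_add fun ε hε => ?_
  have hev : ∀ᶠ x in cocompact ℂ, ‖Y x‖ < ε := by
    simpa using hY0.norm.eventually (gt_mem_nhds (by simpa using hε))
  rw [← Metric.cobounded_eq_cocompact, ← comap_norm_atTop, eventually_comap] at hev
  obtain ⟨L₀, hL₀⟩ := eventually_atTop.1 hev
  set L := max L₀ (‖w‖ + 1)
  have hfar : ∀ x, L ≤ ‖x‖ → ‖Y x‖ ≤ M + ε := fun x hx =>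
    (hL₀ _ ((le_max_left _ _).trans hx) x rfl).le.trans (by linarith)
  have hwL : w ∈ Metric.ball (0 : ℂ) L := by
    rw [mem_ball_zero_iff]
    exact (lt_add_one _).trans_le (le_max_right _ _)
  refine Complex.norm_le_of_forall_mem_frontier_norm_le (U := outside Φ σ ∩ Metric.ball 0 L)
    (Metric.isBounded_ball.subset inter_subset_right)
    (hY.mono ((closure_mono inter_subset_left).trans hcl)).diffContOnCl ?_
    (subset_closure ⟨hw, hwL⟩)
  intro x hx
  rw [((h.isOpen_outside hσ).inter Metric.isOpen_ball).frontier_eq] at hx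
  by_cases hxL : L ≤ ‖x‖
  · exact hfar x hxL
  · rcases h.closure_outside hσ (closure_mono inter_subset_left hx.1) with h1 | ⟨z, hz, rfl⟩
    · exact absurd ⟨h1, by simpa using hxL⟩ hx.2
    · exact (hM z (by simpa using hz)).trans (by linarith)

end NiceMap

/-- A bound on the circle `|z| = τ` holds up to `ε` on nearby circles. -/
theorem exists_norm_lt_near_circle {a b τ : ℝ} (hτ0 : 0 < τ) (hτ : τ ∈ Ioo a b) {y : ℂ → ℂ}
    (hy : ContinuousOn y (ann a b)) {M ε : ℝ} (hε : 0 < ε) (hM : ∀ z, ‖z‖ = τ → ‖y z‖ ≤ M) :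
    ∃ δ > 0, ∀ z, |‖z‖ - τ| < δ → z ∈ ann a b ∧ ‖y z‖ < M + ε := by
  have hU : IsOpen (ann a b ∩ (fun z => ‖y z‖) ⁻¹' Iio (M + ε)) :=
    hy.norm.isOpen_inter_preimage (isOpen_ann a b) isOpen_Iio
  obtain ⟨δ, hδ, h⟩ := exists_ann_subset_of_isOpen hU hτ0 fun z hz =>
    ⟨sphere_subset_ann hτ.1 hτ.2 hz, (hM z (by simpa using hz)).trans_lt (by linarith)⟩
  exact ⟨δ, hδ, fun z hz => h z hz⟩

namespace NiceMap

variable {a b σ τ : ℝ} {Φ : ℂ → ℂ}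

/-- The maximum principle on the inside of the curve, for functions continuous up to the curve in
the coordinate `Φ`. -/
theorem norm_le_inside (h : NiceMap a b Φ) {Y y : ℂ → ℂ} (hY : DifferentiableOn ℂ Y (inside Φ 1))
    (hy : ContinuousOn y (ann a b)) (hYy : ∀ z ∈ ann a 1, Y (Φ z) = y z) {M : ℝ}
    (hM : ∀ z, ‖z‖ = 1 → ‖y z‖ ≤ M) {w : ℂ} (hw : w ∈ inside Φ 1) : ‖Y w‖ ≤ M := by
  refine le_of_forall_pos_le_add fun ε hε => ?_
  obtain ⟨δ, hδ, hδ'⟩ := exists_norm_lt_near_circle one_pos h.one_mem hy hε hM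
  obtain ⟨σ₀, hσ₀, hin⟩ := h.exists_mem_inside_of_mem h.one_mem hw
  obtain ⟨σ, h1, h2⟩ := exists_between (max_lt hσ₀.2 (sub_lt_self 1 hδ) : max σ₀ (1 - δ) < 1)
  have h3 : σ₀ < σ := (le_max_left _ _).trans_lt h1
  have h4 : 1 - δ < σ := (le_max_right _ _).trans_lt h1
  refine h.norm_le_of_level ⟨hσ₀.1.trans h3, h2.trans h.one_lt⟩ h.one_mem h2 hY ?_ (hin σ ⟨h3, h2⟩)
  intro z hz
  rw [hYy z ⟨by rw [hz]; exact hσ₀.1.trans h3, by rw [hz]; exact h2⟩]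
  refine (hδ' z ?_).2.le
  rw [hz, abs_lt]
  constructor <;> linarith

/-- The maximum principle on the outside of the curve. -/
theorem norm_le_outside (h : NiceMap a b Φ) {Y y : ℂ → ℂ} (hY : DifferentiableOn ℂ Y (outside Φ 1))
    (hY0 : Tendsto Y (cocompact ℂ) (𝓝 0))
    (hy : ContinuousOn y (ann a b)) (hYy : ∀ z ∈ ann 1 b, Y (Φ z) = y z) {M : ℝ}
    (hM : ∀ z, ‖z‖ = 1 → ‖y z‖ ≤ M) {z : ℂ} (hz : z ∈ ann 1 b) : ‖y z‖ ≤ M := by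
  refine le_of_forall_pos_le_add fun ε hε => ?_
  obtain ⟨δ, hδ, hδ'⟩ := exists_norm_lt_near_circle one_pos h.one_mem hy hε hM
  obtain ⟨σ, h1, h2⟩ := exists_between (lt_min hz.1 (lt_add_of_pos_right 1 hδ) :
    1 < min ‖z‖ (1 + δ))
  have h3 : σ < ‖z‖ := h2.trans_le (min_le_left _ _)
  have h4 : σ < 1 + δ := h2.trans_le (min_le_right _ _)
  have hσ : σ ∈ Ioo a b := ⟨h.lt_one.trans h1, h3.trans hz.2⟩
  rw [← hYy z hz]
  refine h.norm_le_of_level_outside hσ h.one_mem h1 hY hY0 ?_ (h.map_mem_outside hσ ⟨h3, hz.2⟩)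
  intro x hx
  rw [hYy x ⟨by rw [hx]; exact h1, by rw [hx]; exact hσ.2⟩]
  refine (hδ' x ?_).2.le
  rw [hx, abs_lt]
  constructor <;> linarith

/-- A holomorphic function on the annulus which, on the outer half, continues to the outside of the
curve with value zero at infinity and, on the inner half, is dominated by its values on the unit
circle, vanishes: by the maximum principle it is constant, and by Liouville's theorem the constant
is zero. -/
theorem eq_zero_of_outside (h : NiceMap a b Φ) {q Y : ℂ → ℂ} (hq : DifferentiableOn ℂ q (ann a b))
    (hY : DifferentiableOn ℂ Y (outside Φ 1)) (hY0 : Tendsto Y (cocompact ℂ) (𝓝 0))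
    (hYq : ∀ z ∈ ann 1 b, Y (Φ z) = q z)
    (hin : ∀ M, (∀ z, ‖z‖ = 1 → ‖q z‖ ≤ M) → ∀ z ∈ ann a 1, ‖q z‖ ≤ M) :
    ∀ z ∈ ann a b, q z = 0 := by
  have hS : Metric.sphere (0 : ℂ) 1 ⊆ ann a b := sphere_subset_ann h.lt_one h.one_lt
  obtain ⟨z₀, hz₀, hmax⟩ := (isCompact_sphere (0 : ℂ) 1).exists_isMaxOn ⟨1, by simp⟩
    (hq.continuousOn.mono hS).norm
  have hM : ∀ z, ‖z‖ = 1 → ‖q z‖ ≤ ‖q z₀‖ := fun z hz => hmax (by simpa using hz)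
  have hmax' : IsMaxOn (norm ∘ q) (ann a b) z₀ := by
    intro z hz
    rcases lt_trichotomy ‖z‖ 1 with h1 | h1 | h1
    · exact hin _ hM z ⟨hz.1, h1⟩
    · exact hM z h1
    · exact h.norm_le_outside hY hY0 hq.continuousOn hYq hM ⟨h1, hz.2⟩
  have hconst := Complex.eqOn_of_isPreconnected_of_isMaxOn_norm (isPreconnected_ann h.pos)
    (isOpen_ann a b) hq (hS hz₀) hmax'
  -- The constant value `c` of `q` is removed: the function equal to `Y - c` outside the curve and
  -- to `0` elsewhere is entire, because `Y ∘ Φ - c = 0` in the outer half of the annulus.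
  set c := q z₀
  classical
  set Z : ℂ → ℂ := fun w => if w ∈ outside Φ 1 then Y w - c else 0 with hZ
  have hZd : Differentiable ℂ Z := by
    intro w
    by_cases hw : w ∈ outside Φ 1
    · have : Z =ᶠ[𝓝 w] fun w => Y w - c := by
        filter_upwards [(h.isOpen_outside h.one_mem).mem_nhds hw] with x hx
        simp [hZ, hx]
      rw [this.differentiableAt_iff]
      exact (hY.differentiableAt ((h.isOpen_outside h.one_mem).mem_nhds hw)).sub_const c
    · have : Z =ᶠ[𝓝 w] fun _ => 0 := by
        by_cases hw' : w ∈ inside Φ 1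
        · filter_upwards [(h.isOpen_inside h.one_mem).mem_nhds hw'] with x hx
          simp [hZ, notMem_outside_of_inside hx]
        · have hwc : w ∈ Φ '' Metric.sphere 0 1 := by
            by_contra hwc
            rcases h.mem_inside_or_outside h.one_mem hwc with h1 | h1
            exacts [hw' h1, hw h1]
          obtain ⟨z, hz, rfl⟩ := hwc
          rw [← h.map_nhds (hS hz), EventuallyEq, eventually_map]
          filter_upwards [(isOpen_ann a b).mem_nhds (hS hz)] with x hx
          by_cases hx' : Φ x ∈ outside Φ 1
          · have hx1 : 1 < ‖x‖ := by
              by_contra hcon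
              rcases (not_lt.1 hcon).eq_or_lt with h1 | h1
              · exact hx'.1 ⟨x, by simpa using h1, rfl⟩
              · exact notMem_outside_of_inside (h.map_mem_inside h.one_mem ⟨hx.1, h1⟩) hx'
            simp only [hZ, if_pos hx']
            rw [hYq x ⟨hx1, hx.2⟩, hconst hx]
            simp [c]
          · simp [hZ, hx']
      rw [this.differentiableAt_iff]
      exact differentiableAt_const _
  -- By Liouville's theorem, the limit `-c` at infinity is the value at the origin, which is inside.
  have hlim : Tendsto Z (cocompact ℂ) (𝓝 (0 - c)) := by
    refine (hY0.sub_const c).congr' ?_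
    have h1 : ∀ᶠ w in cocompact ℂ, w ∉ closure (inside Φ 1) :=
      (h.isBounded_inside h.one_mem).isCompact_closure.compl_mem_cocompact
    have h2 : ∀ᶠ w in cocompact ℂ, w ∉ Φ '' Metric.sphere 0 1 :=
      ((isCompact_sphere (0 : ℂ) 1).image_of_continuousOn
        (h.diff.continuousOn.mono hS)).compl_mem_cocompact
    filter_upwards [h1, h2] with w hw1 hw2
    have : w ∈ outside Φ 1 :=
      (h.mem_inside_or_outside h.one_mem hw2).resolve_left fun h3 => hw1 (subset_closure h3)
    simp [hZ, this]
  have hZ0 := hZd.apply_eq_of_tendsto_cocompact (0 : ℂ) hlim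
  have hc0 : c = 0 := by
    have : Z 0 = 0 := by simp [hZ, notMem_outside_of_inside (h.zero_mem_inside h.one_mem)]
    rw [this] at hZ0
    linear_combination hZ0
  intro z hz
  have := hconst hz
  simp only [Function.const_apply] at this
  rw [this]; exact hc0

end NiceMap

/-! ### The linear boundary value problem -/

/-- Reflection of a function in the unit circle: `f*(z) = conj (f (1 / conj z))`. -/
def circleConj (f : ℂ → ℂ) (z : ℂ) : ℂ := (starRingEnd ℂ) (f ((starRingEnd ℂ z)⁻¹))

theorem circleConj_of_norm_eq_one (f : ℂ → ℂ) {z : ℂ} (hz : ‖z‖ = 1) :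
    circleConj f z = (starRingEnd ℂ) (f z) := by
  have : (starRingEnd ℂ z)⁻¹ = z := by
    rw [Complex.inv_def]
    simp [Complex.normSq_eq_norm_sq, hz]
  rw [circleConj, this]

theorem norm_conj_inv (z : ℂ) : ‖(starRingEnd ℂ z)⁻¹‖ = ‖z‖⁻¹ := by
  rw [norm_inv, RCLike.norm_conj]

theorem conj_inv_mem_ann {a b : ℝ} (ha : 0 < a) (hb : 0 < b) {z : ℂ} (hz : z ∈ ann b⁻¹ a⁻¹) :
    (starRingEnd ℂ z)⁻¹ ∈ ann a b := by
  have h0 : 0 < ‖z‖ := (inv_pos.2 hb).trans hz.1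
  rw [mem_ann, norm_conj_inv]
  exact ⟨(lt_inv_comm₀ ha h0).2 hz.2, (inv_lt_comm₀ h0 hb).2 hz.1⟩

theorem differentiableAt_circleConj {f : ℂ → ℂ} {z : ℂ} (hz : z ≠ 0)
    (hf : DifferentiableAt ℂ f (starRingEnd ℂ z)⁻¹) : DifferentiableAt ℂ (circleConj f) z := by
  have h1 : DifferentiableAt ℂ (fun w => f w⁻¹) (starRingEnd ℂ z) :=
    DifferentiableAt.comp (g := f) _ hf (differentiableAt_inv (by simpa using hz))
  have h2 := h1.conj_conj
  rw [Complex.conj_conj] at h2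
  exact h2

theorem continuousOn_circleConj_sphere {f : ℂ → ℂ} {ρ : ℝ} (hρ : 0 < ρ)
    (hf : ContinuousOn f (Metric.sphere 0 ρ)) :
    ContinuousOn (circleConj f) (Metric.sphere 0 ρ⁻¹) := by
  have hmaps : MapsTo (fun z : ℂ => (starRingEnd ℂ z)⁻¹) (Metric.sphere 0 ρ⁻¹)
      (Metric.sphere 0 ρ) := by
    intro z hz
    rw [mem_sphere_zero_iff_norm] at hz ⊢
    rw [norm_conj_inv, hz, inv_inv]
  refine Complex.continuous_conj.comp_continuousOn (hf.comp ?_ hmaps)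
  refine Complex.continuous_conj.continuousOn.inv₀ fun z hz => ?_
  rw [mem_sphere_zero_iff_norm] at hz
  have : z ≠ 0 := by
    rintro rfl
    simp [hρ.ne] at hz
  simpa using this

theorem CT_id (σ : ℝ) (f : ℂ → ℂ) (z : ℂ) : CT (fun w => w) σ f z = cint σ (fun ζ => f ζ / (ζ - z)) := by
  simp [CT]

theorem differentiableAt_cauchy {σ : ℝ} (hσ : 0 < σ) {f : ℂ → ℂ}
    (hf : ContinuousOn f (Metric.sphere 0 σ)) {z : ℂ} (hz : ‖z‖ ≠ σ) :
    DifferentiableAt ℂ (fun z => cint σ (fun ζ => f ζ / (ζ - z))) z := by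
  have := CT_differentiableAt (Φ := fun w => w) hσ continuousOn_id (by simp [continuousOn_const]) hf
    (w := z) (by simpa using hz)
  simpa only [funext (CT_id σ f)] using this

theorem tendsto_cauchy_zero {σ : ℝ} (hσ : 0 < σ) {f : ℂ → ℂ}
    (hf : ContinuousOn f (Metric.sphere 0 σ)) :
    Tendsto (fun z => cint σ (fun ζ => f ζ / (ζ - z))) (cocompact ℂ) (𝓝 0) := by
  have := CT_tendsto_zero (Φ := fun w => w) hσ continuousOn_id (by simp [continuousOn_const]) hf
  simpa only [funext (CT_id σ f)] using this

/-- The function whose part of negative order is the right-hand side of the equation defining a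
`WeldingSolution`: the difference of the two Cauchy integrals along the curve. -/
def weldRhs (Φ : ℂ → ℂ) (ρ : ℝ) (u g : ℂ → ℂ) (η : ℂ) : ℂ :=
  CT Φ ρ g (Φ η) + CT Φ ρ⁻¹ (fun ζ => u ζ - circleConj g ζ) (Φ η)

/-- A solution `g`, holomorphic in `|z| > m⁻¹`, of the linear equation which says that
`h = u + (g - g*)` has no part of negative order with respect to the Cauchy projections of the
curve `Φ`, up to functions holomorphic in the unit disk. Here `1 < m < ρ < R`. -/
structure WeldingSolution (m ρ R : ℝ) (Φ u g : ℂ → ℂ) : Prop where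
  one_lt_m : 1 < m
  m_lt : m < ρ
  ρ_lt : ρ < R
  nice : NiceMap R⁻¹ R Φ
  u_diff : DifferentiableOn ℂ u (ann R⁻¹ R)
  g_cont : ContinuousOn g (Metric.sphere 0 ρ)
  g_eq : ∀ z, m⁻¹ < ‖z‖ → g z = -cint m⁻¹ (fun η => weldRhs Φ ρ u g η / (η - z))

namespace WeldingSolution

variable {m ρ R : ℝ} {Φ u g : ℂ → ℂ}

/-- The sum `u + (g - g*)`, whose real part on the unit circle is that of `u`. -/
def sol (u g : ℂ → ℂ) (z : ℂ) : ℂ := u z + (g z - circleConj g z)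

theorem sol_re {z : ℂ} (hz : ‖z‖ = 1) : (sol u g z).re = (u z).re := by
  simp [sol, circleConj_of_norm_eq_one g hz]

section
variable (W : WeldingSolution m ρ R Φ u g)
include W

theorem radii : 0 < R⁻¹ ∧ R⁻¹ < ρ⁻¹ ∧ ρ⁻¹ < m⁻¹ ∧ m⁻¹ < 1 ∧ 1 < m ∧ m < ρ ∧ ρ < R := by
  have h1 := W.one_lt_m
  have h2 := W.m_lt
  have h3 := W.ρ_lt
  have hm : 0 < m := by linarith
  have hρ : 0 < ρ := by linarith
  have hR : 0 < R := by linarith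
  exact ⟨by positivity, inv_strictAnti₀ hρ h3, inv_strictAnti₀ hm h2, inv_lt_one_of_one_lt₀ h1,
    h1, h2, h3⟩

theorem nice_m : NiceMap m⁻¹ m Φ := by
  obtain ⟨h0, h1, h2, h3, h4, h5, h6⟩ := W.radii
  exact W.nice.mono (h1.trans h2).le h3 (h5.trans h6).le h4

theorem rhs_differentiableOn : DifferentiableOn ℂ (weldRhs Φ ρ u g) (ann ρ⁻¹ ρ) := by
  obtain ⟨h0, h1, h2, h3, h4, h5, h6⟩ := W.radii
  intro η hη
  have hη' : η ∈ ann R⁻¹ R := ann_mono h1.le h6.le hη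
  have hρ : ρ ∈ Ioo R⁻¹ R := ⟨by linarith, h6⟩
  have hρ' : ρ⁻¹ ∈ Ioo R⁻¹ R := ⟨h1, by linarith⟩
  have hΦ := W.nice.differentiableAt hη'
  refine (DifferentiableAt.add ?_ ?_).differentiableWithinAt
  · exact (W.nice.CT_differentiableAt hρ W.g_cont
      (W.nice.notMem_curve hρ hη' hη.2.ne)).comp η hΦ
  · refine (W.nice.CT_differentiableAt hρ' (ContinuousOn.sub ?_ ?_)
      (W.nice.notMem_curve hρ' hη' hη.1.ne')).comp η hΦ
    · exact W.u_diff.continuousOn.mono (sphere_subset_ann hρ'.1 hρ'.2)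
    · exact continuousOn_circleConj_sphere (by linarith) W.g_cont

theorem rhs_continuousOn {s : ℝ} (hs : s ∈ Ioo ρ⁻¹ ρ) :
    ContinuousOn (weldRhs Φ ρ u g) (Metric.sphere 0 s) :=
  W.rhs_differentiableOn.continuousOn.mono (sphere_subset_ann hs.1 hs.2)

theorem g_differentiableAt {z : ℂ} (hz : m⁻¹ < ‖z‖) : DifferentiableAt ℂ g z := by
  obtain ⟨h0, h1, h2, h3, h4, h5, h6⟩ := W.radii
  have hd := (differentiableAt_cauchy (by linarith)
    (W.rhs_continuousOn (s := m⁻¹) ⟨h2, by linarith⟩) hz.ne').neg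
  refine (EventuallyEq.differentiableAt_iff ?_).2 hd
  filter_upwards [(isOpen_lt continuous_const continuous_norm).mem_nhds hz] with x hx
  exact W.g_eq x hx

theorem g_tendsto : Tendsto g (cocompact ℂ) (𝓝 0) := by
  obtain ⟨h0, h1, h2, h3, h4, h5, h6⟩ := W.radii
  have := (tendsto_cauchy_zero (by linarith)
    (W.rhs_continuousOn (s := m⁻¹) ⟨h2, by linarith⟩)).neg
  rw [neg_zero] at this
  refine this.congr' ?_
  filter_upwards [(tendsto_norm_cocompact_atTop (E := ℂ)).eventually (eventually_gt_atTop m⁻¹)]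
    with z hz
  exact (W.g_eq z hz).symm

theorem circleConj_g_differentiableAt {z : ℂ} (hz0 : z ≠ 0) (hz : ‖z‖ < m) :
    DifferentiableAt ℂ (circleConj g) z := by
  refine differentiableAt_circleConj hz0 (W.g_differentiableAt ?_)
  rw [norm_conj_inv]
  exact inv_strictAnti₀ (norm_pos_iff.2 hz0) hz

theorem g_differentiableOn {b : ℝ} : DifferentiableOn ℂ g (ann m⁻¹ b) :=
  fun _ hz => (W.g_differentiableAt hz.1).differentiableWithinAt

theorem u_sub_differentiableOn :
    DifferentiableOn ℂ (fun z => u z - circleConj g z) (ann R⁻¹ m) := by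
  obtain ⟨h0, h1, h2, h3, h4, h5, h6⟩ := W.radii
  intro z hz
  have hz0 : z ≠ 0 := norm_pos_iff.1 (h0.trans hz.1)
  refine (DifferentiableAt.sub ?_ (W.circleConj_g_differentiableAt hz0 hz.2)).differentiableWithinAt
  exact W.u_diff.differentiableAt ((isOpen_ann _ _).mem_nhds ⟨hz.1, by linarith [hz.2]⟩)

theorem sol_differentiableOn : DifferentiableOn ℂ (sol u g) (ann m⁻¹ m) := by
  obtain ⟨h0, h1, h2, h3, h4, h5, h6⟩ := W.radii
  have e : sol u g = fun z => g z + (u z - circleConj g z) := by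
    funext z; simp only [sol]; ring
  rw [e]
  exact W.g_differentiableOn.add (W.u_sub_differentiableOn.mono (ann_mono (h1.trans h2).le le_rfl))

theorem sol_continuousOn_sphere {s : ℝ} (hs : s ∈ Ioo m⁻¹ m) :
    ContinuousOn (sol u g) (Metric.sphere 0 s) :=
  W.sol_differentiableOn.continuousOn.mono (sphere_subset_ann hs.1 hs.2)

/-- The Cauchy integral of `sol u g`, split into the part of `g`, which is holomorphic outside the
circle of radius `m⁻¹`, and that of `u - g*`, which is holomorphic in `R⁻¹ < |z| < m`. The contours
of the two parts can then be moved in opposite directions. -/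
theorem CT_sol {w : ℂ} (hw : w ∉ Φ '' Metric.sphere 0 1) :
    CT Φ 1 (sol u g) w = CT Φ 1 g w + CT Φ 1 (fun z => u z - circleConj g z) w := by
  obtain ⟨h0, h1, h2, h3, h4, h5, h6⟩ := W.radii
  have hS : Metric.sphere (0 : ℂ) 1 ⊆ ann m⁻¹ m := sphere_subset_ann h3 h4
  have hne : ∀ z ∈ Metric.sphere (0 : ℂ) 1, Φ z - w ≠ 0 := fun z hz e =>
    hw ⟨z, hz, sub_eq_zero.1 e⟩
  have c1 := W.nice_m.diff.continuousOn.mono hS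
  have c2 := W.nice_m.differentiableOn_deriv.continuousOn.mono hS
  unfold CT
  rw [← cint_add zero_le_one]
  · refine cint_congr zero_le_one fun z hz => ?_
    have := hne z (by simpa using hz)
    simp only [sol]
    field_simp; ring
  · exact ((W.g_differentiableOn.continuousOn.mono hS).mul c2).div (c1.sub continuousOn_const) hne
  · exact ((W.u_sub_differentiableOn.continuousOn.mono
      (hS.trans (ann_mono (h1.trans h2).le le_rfl))).mul c2).div (c1.sub continuousOn_const) hne

/-- The solution `g` agrees with the right-hand side before projection: their difference extends
holomorphically to the unit disk on one side and to the outside of the curve on the other. -/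
theorem g_eq_rhs : ∀ z ∈ ann m⁻¹ m, g z = weldRhs Φ ρ u g z := by
  obtain ⟨h0, h1, h2, h3, h4, h5, h6⟩ := W.radii
  have hsub : ann m⁻¹ m ⊆ ann R⁻¹ R := ann_mono (h1.trans h2).le (h5.trans h6).le
  -- By Cauchy's formula, `g - weldRhs` is minus the Cauchy integral of `weldRhs` over `|η| = m`,
  -- which is holomorphic in the disk.
  have hdisk : ∀ z ∈ ann m⁻¹ m, g z - weldRhs Φ ρ u g z =
      -cint m (fun η => weldRhs Φ ρ u g η / (η - z)) := by
    intro z hz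
    have := cint_cauchy_annulus (h0.trans h1).le h2 h5 W.rhs_differentiableOn hz.1 hz.2
    rw [W.g_eq z hz.1]
    linear_combination this
  have hQ : ∀ z, ‖z‖ < m →
      DifferentiableAt ℂ (fun z => -cint m (fun η => weldRhs Φ ρ u g η / (η - z))) z := fun z hz =>
    (differentiableAt_cauchy (by linarith) (W.rhs_continuousOn ⟨by linarith, h5⟩) hz.ne).neg
  have hone : (1 : ℝ) ∈ Ioo m⁻¹ m := ⟨h3, h4⟩
  have key := W.nice_m.eq_zero_of_outside (q := fun z => g z - weldRhs Φ ρ u g z)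
    (Y := fun w => -CT Φ 1 (sol u g) w)
    (W.g_differentiableOn.sub (W.rhs_differentiableOn.mono (ann_mono h2.le h5.le)))
    (fun w hw => (W.nice_m.CT_differentiableAt hone (W.sol_continuousOn_sphere hone)
      hw.1).neg.differentiableWithinAt)
    (by simpa using (W.nice_m.CT_tendsto_zero hone (W.sol_continuousOn_sphere hone)).neg)
    ?_ ?_
  · intro z hz
    exact sub_eq_zero.1 (key z hz)
  · intro z hz
    have hz' : z ∈ ann m⁻¹ m := ann_mono h3.le le_rfl hz
    have hnc := W.nice_m.notMem_curve hone hz' hz.1.ne'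
    rw [W.CT_sol hnc]
    -- Outside the curve, `g - weldRhs` is minus the Cauchy integral of `sol u g` over `|z| = 1`:
    -- moving the contour of the first part to `|z| = ρ` crosses the point at which it is evaluated,
    -- which contributes the value of `g`.
    have e1 := CT_jump (a := m⁻¹) (b := R) (by linarith)
      (W.nice.diff.mono (ann_mono (h1.trans h2).le le_rfl))
      (W.nice.inj.mono (ann_mono (h1.trans h2).le le_rfl)) W.g_differentiableOn h3 h6
      (W.nice.deriv_ne z (hsub hz')) hz.1 (hz.2.trans h5)
    have e2 := CT_shift_closed (a := R⁻¹) (b := m) (σ := ρ⁻¹) (τ := 1) (by linarith) (by linarith)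
      (W.nice.diff.mono (ann_mono le_rfl (h5.trans h6).le)) W.u_sub_differentiableOn h1 h4
      (w := Φ z) (fun ζ hζ1 hζ2 e => by
        have := W.nice.inj ⟨h1.trans_le hζ1, by linarith⟩ (hsub hz') e
        rw [this] at hζ2
        exact absurd hz.1 (not_lt.2 hζ2))
    rw [e2]
    simp only [weldRhs]
    linear_combination e1
  · intro M hM z hz
    have hz' : z ∈ ann m⁻¹ m := ann_mono le_rfl h4.le hz
    rw [hdisk z hz']
    -- The bound inside is the maximum principle on the unit disk.
    refine Complex.norm_le_of_forall_mem_frontier_norm_le (U := Metric.ball (0 : ℂ) 1)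
      (f := fun z => -cint m (fun η => weldRhs Φ ρ u g η / (η - z))) Metric.isBounded_ball ?_ ?_
      (subset_closure (by simpa using hz.2))
    · refine DifferentiableOn.diffContOnCl fun x hx => (hQ x ?_).differentiableWithinAt
      have : ‖x‖ ≤ 1 := by simpa using Metric.closure_ball_subset_closedBall hx
      linarith
    · intro x hx
      rw [frontier_ball (0 : ℂ) one_ne_zero, mem_sphere_zero_iff_norm] at hx
      have hx' : x ∈ ann m⁻¹ m := ⟨by rw [hx]; exact h3, by rw [hx]; exact h4⟩
      rw [← hdisk x hx']
      exact hM x hx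

/-- The function `sol u g` continues holomorphically to the inside of the curve, as its Cauchy
integral. -/
theorem CT_sol_eq {z : ℂ} (hz : z ∈ ann m⁻¹ 1) : CT Φ 1 (sol u g) (Φ z) = sol u g z := by
  obtain ⟨h0, h1, h2, h3, h4, h5, h6⟩ := W.radii
  have hz' : z ∈ ann m⁻¹ m := ann_mono le_rfl h4.le hz
  have hsub : ann m⁻¹ m ⊆ ann R⁻¹ R := ann_mono (h1.trans h2).le (h5.trans h6).le
  have hone : (1 : ℝ) ∈ Ioo m⁻¹ m := ⟨h3, h4⟩
  rw [W.CT_sol (W.nice_m.notMem_curve hone hz' hz.2.ne)]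
  have e1 := CT_jump (a := R⁻¹) (b := m) h0.le
    (W.nice.diff.mono (ann_mono le_rfl (h5.trans h6).le))
    (W.nice.inj.mono (ann_mono le_rfl (h5.trans h6).le)) W.u_sub_differentiableOn h1 h4
    (W.nice.deriv_ne z (hsub hz')) (h2.trans hz.1) hz.2
  have e2 := CT_shift_closed (a := m⁻¹) (b := R) (σ := 1) (τ := ρ) (f := g) one_pos (by linarith)
    (W.nice.diff.mono (ann_mono (h1.trans h2).le le_rfl)) W.g_differentiableOn h3 h6
    (w := Φ z) (fun ζ hζ1 hζ2 e => by
      have := W.nice.inj ⟨by linarith, by linarith⟩ (hsub hz') e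
      rw [this] at hζ1
      exact absurd hz.2 (not_lt.2 hζ1))
  rw [← e2]
  have e3 := W.g_eq_rhs z hz'
  simp only [weldRhs] at e3
  simp only [sol]
  linear_combination e1 - e3

theorem differentiableOn_CT_sol : DifferentiableOn ℂ (CT Φ 1 (sol u g)) (inside Φ 1) := by
  obtain ⟨h0, h1, h2, h3, h4, h5, h6⟩ := W.radii
  exact fun w hw => (W.nice_m.CT_differentiableAt ⟨h3, h4⟩ (W.sol_continuousOn_sphere ⟨h3, h4⟩)
      hw.1).differentiableWithinAt

end

/-- The homogeneous equation has only the trivial solution. For `u = 0`, the function `h = g - g*` is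
imaginary on the unit circle and continues to the inside of the curve, so it is constant. -/
theorem eq_zero (W : WeldingSolution m ρ R Φ (fun _ => 0) g) {z : ℂ} (hz : 1 ≤ ‖z‖) : g z = 0 := by
  obtain ⟨h0, h1, h2, h3, h4, h5, h6⟩ := W.radii
  set h := sol (fun _ => 0) g with hh
  have hre : ∀ z, ‖z‖ = 1 → (h z).re = 0 := fun z hz => by rw [sol_re hz]; simp
  have hsub1 : ann m⁻¹ 1 ⊆ ann m⁻¹ m := ann_mono le_rfl h4.le
  -- As `Re h = 0` on the unit circle, the maximum principle gives `|exp (± h)| ≤ 1` inside.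
  have hbound : ∀ c : ℂ, c.im = 0 → ∀ z ∈ ann m⁻¹ 1, ‖Complex.exp (c * h z)‖ ≤ 1 := by
    intro c hc z hz
    have := W.nice_m.norm_le_inside (Y := fun w => Complex.exp (c * CT Φ 1 h w))
      (y := fun z => Complex.exp (c * h z)) (M := 1)
      (W.differentiableOn_CT_sol.const_mul c).cexp
      ((continuousOn_const.mul W.sol_differentiableOn.continuousOn).cexp)
      (fun z hz => by simp only [hh]; rw [W.CT_sol_eq hz])
      (fun z hz => by
        simp only [Complex.norm_exp, Complex.mul_re, hre z hz, hc]
        simp)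
      (W.nice_m.map_mem_inside ⟨h3, h4⟩ hz)
    simpa [hh, W.CT_sol_eq hz] using this
  have hnorm : ∀ z ∈ ann m⁻¹ 1, ‖Complex.exp (h z)‖ = 1 := by
    intro z hz
    refine le_antisymm (by simpa using hbound 1 (by simp) z hz) ?_
    have := hbound (-1) (by simp) z hz
    rw [neg_one_mul, Complex.exp_neg, norm_inv] at this
    rwa [inv_le_one₀ (norm_pos_iff.2 (Complex.exp_ne_zero _))] at this
  obtain ⟨z₁, hz₁⟩ := W.nice_m.exists_mem_ann le_rfl h3
  have hdiff : DifferentiableOn ℂ h (ann m⁻¹ 1) := W.sol_differentiableOn.mono hsub1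
  have hexpconst := Complex.eqOn_of_isPreconnected_of_isMaxOn_norm (isPreconnected_ann (by linarith))
    (isOpen_ann m⁻¹ 1) hdiff.cexp hz₁ (fun x hx => by
      simp only [mem_ofPred_eq, Function.comp]
      rw [hnorm x hx, hnorm z₁ hz₁])
  have hderiv : EqOn (deriv h) 0 (ann m⁻¹ 1) := by
    intro x hx
    have hx' := (isOpen_ann m⁻¹ 1).mem_nhds hx
    have e1 := (hdiff.differentiableAt hx').hasDerivAt.cexp.deriv
    have e2 : deriv (fun z => Complex.exp (h z)) x = 0 := by
      have : (fun z => Complex.exp (h z)) =ᶠ[𝓝 x] fun _ => Complex.exp (h z₁) := by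
        filter_upwards [hx'] with y hy using hexpconst hy
      rw [this.deriv_eq]; simp
    rw [e2] at e1
    simpa using e1.symm
  have hc : ∀ x ∈ ann m⁻¹ 1, h x = h z₁ := fun x hx =>
    (isOpen_ann m⁻¹ 1).is_const_of_deriv_eq_zero (isPreconnected_ann (by linarith)) hdiff hderiv
      hx hz₁
  -- `g` outside the unit disk and `g* + c` inside fit together to a bounded entire function.
  set c := h z₁
  set V : ℂ → ℂ := Function.update (circleConj g) 0 0 with hV
  have hVd : DifferentiableOn ℂ V (Metric.ball 0 m) := by
    rw [← Complex.differentiableOn_compl_singleton_and_continuousAt_iff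
      (Metric.ball_mem_nhds (0 : ℂ) (by linarith : 0 < m))]
    constructor
    · rintro x ⟨hx1, hx2⟩
      have hx2' : x ≠ 0 := hx2
      refine (EventuallyEq.differentiableAt_iff ?_).2 (W.circleConj_g_differentiableAt hx2'
        (by simpa using hx1)) |>.differentiableWithinAt
      filter_upwards [isOpen_ne.mem_nhds hx2'] with y hy
      simp [hV, Function.update_of_ne hy]
    · rw [hV, continuousAt_update_same]
      have ht : Tendsto (fun z : ℂ => (starRingEnd ℂ z)⁻¹) (𝓝[≠] 0) (cocompact ℂ) := by
        rw [← Metric.cobounded_eq_cocompact]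
        have h5 : Tendsto (fun z : ℂ => starRingEnd ℂ z) (𝓝[≠] 0) (𝓝[≠] 0) := by
          refine tendsto_nhdsWithin_of_tendsto_nhds_of_eventually_within _ ?_ ?_
          · have : Tendsto (fun z : ℂ => starRingEnd ℂ z) (𝓝 0) (𝓝 (starRingEnd ℂ 0)) :=
              Complex.continuous_conj.tendsto 0
            rw [map_zero] at this
            exact this.mono_left nhdsWithin_le_nhds
          · filter_upwards [self_mem_nhdsWithin] with x hx
            simpa using hx
        exact Filter.tendsto_inv₀_nhdsNE_zero.comp h5
      have := (Complex.continuous_conj.tendsto 0).comp (W.g_tendsto.comp ht)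
      rw [map_zero] at this
      exact this
  set Z : ℂ → ℂ := fun x => if ‖x‖ < 1 then V x + c else g x with hZ
  have hZg : ∀ x, m⁻¹ < ‖x‖ → Z x = g x := by
    intro x hx
    by_cases hx1 : ‖x‖ < 1
    · have hx0 : x ≠ 0 := norm_pos_iff.1 (by linarith)
      have := hc x ⟨hx, hx1⟩
      simp only [hZ, if_pos hx1, hV, Function.update_of_ne hx0]
      rw [← this]
      simp only [hh, sol]
      ring
    · simp only [hZ, if_neg hx1]
  have hZd : Differentiable ℂ Z := by
    intro x
    by_cases hx1 : ‖x‖ < 1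
    · refine (EventuallyEq.differentiableAt_iff ?_).2
        ((hVd.differentiableAt (Metric.isOpen_ball.mem_nhds (by simp; linarith))).add_const c)
      filter_upwards [(isOpen_lt continuous_norm continuous_const).mem_nhds hx1] with y hy
      simp only [hZ]
      rw [if_pos hy]
    · have hx : m⁻¹ < ‖x‖ := by linarith
      refine (EventuallyEq.differentiableAt_iff ?_).2 (W.g_differentiableAt hx)
      filter_upwards [(isOpen_lt continuous_const continuous_norm).mem_nhds hx] with y hy
      exact hZg y hy
  have hZ0 := hZd.apply_eq_of_tendsto_cocompact z (c := 0) ?_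
  · rwa [hZg z (by linarith)] at hZ0
  · refine W.g_tendsto.congr' ?_
    filter_upwards [(tendsto_norm_cocompact_atTop (E := ℂ)).eventually (eventually_gt_atTop m⁻¹)]
      with x hx
    exact (hZg x hx).symm

end WeldingSolution

/-! ### From the boundary value problem to the circle map -/

/-- The points of the unit circle accumulate at each of its points. -/
theorem frequently_punctured_of_circle {z₀ : ℂ} (hz₀ : ‖z₀‖ = 1) {p : ℂ → Prop}
    (h : ∀ᶠ z in 𝓝 z₀, ‖z‖ = 1 → p z) : ∃ᶠ z in 𝓝[≠] z₀, p z := by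
  have hc : Tendsto (fun t : ℝ => z₀ * Complex.exp (t * Complex.I)) (𝓝[>] 0) (𝓝 z₀) := by
    have : Continuous fun t : ℝ => z₀ * Complex.exp (t * Complex.I) := by fun_prop
    have h := this.tendsto 0
    simp only [Complex.ofReal_zero, zero_mul, Complex.exp_zero, mul_one] at h
    exact h.mono_left nhdsWithin_le_nhds
  have hlt : ∀ᶠ t : ℝ in 𝓝[>] 0, t < Real.pi := nhdsWithin_le_nhds (gt_mem_nhds Real.pi_pos)
  have ht : Tendsto (fun t : ℝ => z₀ * Complex.exp (t * Complex.I)) (𝓝[>] 0) (𝓝[≠] z₀) := by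
    refine tendsto_nhdsWithin_of_tendsto_nhds_of_eventually_within _ hc ?_
    filter_upwards [self_mem_nhdsWithin, hlt] with t ht1 ht2 he
    have hz₀' : z₀ ≠ 0 := norm_pos_iff.1 (by rw [hz₀]; exact one_pos)
    have hs := congrArg Complex.im (mul_left_cancel₀ hz₀' (he.trans (mul_one z₀).symm))
    rw [Complex.exp_ofReal_mul_I_im, Complex.one_im] at hs
    exact (Real.sin_pos_of_pos_of_lt_pi ht1 ht2).ne' hs
  refine ht.frequently (Eventually.frequently ?_)
  filter_upwards [hc.eventually h] with t ht
  exact ht (by rw [norm_mul, hz₀, Complex.norm_exp_ofReal_mul_I, mul_one])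

/-- A holomorphic function on an annulus around the unit circle which vanishes on the unit circle
vanishes identically. -/
theorem eq_zero_of_eq_zero_on_circle {a b : ℝ} (ha : 0 < a) (ha1 : a < 1) (hb : 1 < b) {f : ℂ → ℂ}
    (hf : DifferentiableOn ℂ f (ann a b)) (h0 : ∀ z, ‖z‖ = 1 → f z = 0) :
    ∀ z ∈ ann a b, f z = 0 := by
  have h1 : (1 : ℂ) ∈ ann a b := by simpa [mem_ann] using ⟨ha1, hb⟩
  exact (hf.analyticOnNhd (isOpen_ann a b)).eqOn_zero_of_preconnected_of_frequently_eq_zero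
    (isPreconnected_ann ha) h1
    (frequently_punctured_of_circle norm_one (Eventually.of_forall fun z hz => h0 z hz))

/-- At a boundary point where a function with nonnegative values to the left vanishes, its derivative
is not positive. -/
theorem deriv_nonpos_of_left_nonneg {f : ℝ → ℝ} {f' x r : ℝ} (hr : r < x) (hf : HasDerivAt f f' x)
    (h0 : f x = 0) (h : ∀ y ∈ Ioo r x, 0 ≤ f y) : f' ≤ 0 := by
  have ht := (hasDerivAt_iff_tendsto_slope.1 hf).mono_left (nhdsLT_le_nhdsNE x)
  refine le_of_tendsto ht ?_
  filter_upwards [Ioo_mem_nhdsLT hr] with y hy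
  rw [slope_def_field, h0, sub_zero]
  exact div_nonpos_of_nonneg_of_nonpos (h y hy) (by linarith [hy.2])

namespace WeldingSolution

variable {m ρ R : ℝ} {Φ u g : ℂ → ℂ}

/-- The angle `Im H(0)`, where `H` is the Cauchy integral of `sol u g` along the curve. Rotating by
it makes the derivative of the conformal map `riem` at the origin positive. -/
def rot (Φ u g : ℂ → ℂ) : ℝ := (CT Φ 1 (sol u g) 0).im

/-- The circle map `D = Φ exp (h - i Im H(0))`, where `h = sol u g` and `H` is its Cauchy integral
along the curve, as a holomorphic function on an annulus. -/
def circ (Φ u g : ℂ → ℂ) (z : ℂ) : ℂ := Φ z * Complex.exp (sol u g z - rot Φ u g * Complex.I)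

/-- The conformal map `G(w) = w exp (H(w) - i Im H(0))` from the inside of the curve to the unit
disk, where `H` is the Cauchy integral of `sol u g` along the curve. -/
def riem (Φ u g : ℂ → ℂ) (w : ℂ) : ℂ :=
  w * Complex.exp (CT Φ 1 (sol u g) w - rot Φ u g * Complex.I)

section
variable (W : WeldingSolution m ρ R Φ u g)
include W

theorem circ_differentiableOn : DifferentiableOn ℂ (circ Φ u g) (ann m⁻¹ m) :=
  W.nice_m.diff.mul (W.sol_differentiableOn.sub_const _).cexp

theorem circ_ne_zero {z : ℂ} (hz : z ∈ ann m⁻¹ m) : circ Φ u g z ≠ 0 :=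
  mul_ne_zero (W.nice_m.ne_zero z hz) (Complex.exp_ne_zero _)

theorem riem_differentiableOn : DifferentiableOn ℂ (riem Φ u g) (inside Φ 1) :=
  differentiableOn_id.mul (W.differentiableOn_CT_sol.sub_const _).cexp

theorem riem_comp {z : ℂ} (hz : z ∈ ann m⁻¹ 1) : riem Φ u g (Φ z) = circ Φ u g z := by
  rw [riem, W.CT_sol_eq hz, circ]

/-- The winding number of the circle map is one: its logarithmic derivative differs from that of `Φ`
by the derivative of `sol u g`. -/
theorem circ_wind : CT (circ Φ u g) 1 (fun _ => 1) 0 = 1 := by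
  obtain ⟨h0, h1, h2, h3, h4, h5, h6⟩ := W.radii
  have hS : Metric.sphere (0 : ℂ) 1 ⊆ ann m⁻¹ m := sphere_subset_ann h3 h4
  have hcd : ContinuousOn (deriv (sol u g)) (Metric.sphere 0 1) :=
    (W.sol_differentiableOn.deriv (isOpen_ann _ _)).continuousOn.mono hS
  have hlog : CT (circ Φ u g) 1 (fun _ => 1) 0 =
      cint 1 (fun ζ => (1 : ℂ) * deriv Φ ζ / (Φ ζ - 0) + deriv (sol u g) ζ) := by
    refine cint_congr zero_le_one fun z hz => ?_
    have hz' : z ∈ ann m⁻¹ m := hS (by simpa using hz)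
    have hn := (isOpen_ann m⁻¹ m).mem_nhds hz'
    have e1 : HasDerivAt Φ (deriv Φ z) z := (W.nice_m.differentiableAt hz').hasDerivAt
    have e2 : HasDerivAt (sol u g) (deriv (sol u g) z) z :=
      (W.sol_differentiableOn.differentiableAt hn).hasDerivAt
    have e3 : HasDerivAt (circ Φ u g) _ z :=
      e1.mul ((e2.sub_const (rot Φ u g * Complex.I)).cexp)
    rw [e3.deriv]
    have n1 := W.nice_m.ne_zero z hz'
    have n2 := Complex.exp_ne_zero (sol u g z - rot Φ u g * Complex.I)
    simp only [circ]
    field_simp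
    ring
  rw [hlog, cint_add zero_le_one _ hcd]
  · have : cint 1 (deriv (sol u g)) = 0 := by
      unfold cint
      rw [circleIntegral.integral_eq_zero_of_hasDerivWithinAt (f := sol u g) zero_le_one, mul_zero]
      intro z hz
      exact (W.sol_differentiableOn.differentiableAt
        ((isOpen_ann m⁻¹ m).mem_nhds (hS hz))).hasDerivAt.hasDerivWithinAt
    rw [this, add_zero]
    exact W.nice_m.wind
  · refine (continuousOn_const.mul (W.nice_m.differentiableOn_deriv.continuousOn.mono hS)).div
      ((W.nice_m.diff.continuousOn.mono hS).sub continuousOn_const) fun z hz => ?_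
    simpa using W.nice_m.ne_zero z (hS hz)

end

section
variable (W : WeldingSolution m ρ R Φ u g)
  (hu : ∀ z, ‖z‖ = 1 → (u z).re = -Real.log ‖Φ z‖)
include W hu

theorem norm_circ {z : ℂ} (hz : ‖z‖ = 1) : ‖circ Φ u g z‖ = 1 := by
  obtain ⟨h0, h1, h2, h3, h4, h5, h6⟩ := W.radii
  have hne : Φ z ≠ 0 := W.nice_m.ne_zero z ⟨by rw [hz]; exact h3, by rw [hz]; exact h4⟩
  rw [circ, norm_mul, Complex.norm_exp]
  simp only [Complex.sub_re, Complex.re_ofReal_mul, Complex.I_re, mul_zero, sub_zero]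
  rw [sol_re hz, hu z hz, Real.exp_neg, Real.exp_log (norm_pos_iff.2 hne)]
  exact mul_inv_cancel₀ (norm_pos_iff.2 hne).ne'

/-- Inside the unit circle `|D| < 1`, by the maximum principle for `G`. If the bound were attained,
`D` would be constant, which its winding number excludes. -/
theorem norm_circ_lt_one {z : ℂ} (hz : z ∈ ann m⁻¹ 1) : ‖circ Φ u g z‖ < 1 := by
  obtain ⟨h0, h1, h2, h3, h4, h5, h6⟩ := W.radii
  have hle : ∀ x ∈ ann m⁻¹ 1, ‖circ Φ u g x‖ ≤ 1 := fun x hx => by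
    rw [← W.riem_comp hx]
    exact W.nice_m.norm_le_inside W.riem_differentiableOn W.circ_differentiableOn.continuousOn
      (fun z hz => W.riem_comp hz) (fun z hz => (W.norm_circ hu hz).le)
      (W.nice_m.map_mem_inside ⟨h3, h4⟩ hx)
  refine (hle z hz).lt_of_ne fun he => ?_
  have hd : DifferentiableOn ℂ (circ Φ u g) (ann m⁻¹ 1) :=
    W.circ_differentiableOn.mono (ann_mono le_rfl h4.le)
  have hconst := Complex.eqOn_of_isPreconnected_of_isMaxOn_norm (isPreconnected_ann (by linarith))
    (isOpen_ann m⁻¹ 1) hd hz (fun x hx => by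
      simp only [mem_ofPred_eq, Function.comp]
      rw [he]; exact hle x hx)
  obtain ⟨s, hs1, hs2⟩ := exists_between h3
  have hw := W.circ_wind
  have : CT (circ Φ u g) 1 (fun _ => 1) 0 = CT (circ Φ u g) s (fun _ => 1) 0 := by
    refine cint_shift (by linarith) (a := m⁻¹) (b := m) ⟨h3, h4⟩ ⟨hs1, hs2.trans h4⟩ ?_
    refine ((differentiableOn_const 1).mul (W.circ_differentiableOn.deriv (isOpen_ann _ _))).div
      (W.circ_differentiableOn.sub_const 0) fun x hx => ?_
    simpa using W.circ_ne_zero hx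
  rw [this] at hw
  have hz0 : CT (circ Φ u g) s (fun _ => 1) 0 = cint s (fun _ => 0) := by
    refine cint_congr (by linarith) fun x hx => ?_
    have : circ Φ u g =ᶠ[𝓝 x] fun _ => circ Φ u g z := by
      filter_upwards [(isOpen_ann m⁻¹ 1).mem_nhds
        (show x ∈ ann m⁻¹ 1 from ⟨by rw [hx]; exact hs1, by rw [hx]; exact hs2⟩)] with y hy
        using hconst hy
    rw [this.deriv_eq]
    simp
  rw [hz0] at hw
  simp [cint, circleIntegral] at hw

/-- The reflection principle `D D* = 1`, which holds on the unit circle and hence near it. -/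
theorem circ_mul_circleConj {z : ℂ} (hz : z ∈ ann m⁻¹ m) :
    circ Φ u g z * circleConj (circ Φ u g) z = 1 := by
  obtain ⟨h0, h1, h2, h3, h4, h5, h6⟩ := W.radii
  have hm0 : 0 < m := by linarith
  have hd : DifferentiableOn ℂ (fun z => circ Φ u g z * circleConj (circ Φ u g) z - 1)
      (ann m⁻¹ m) := by
    refine (W.circ_differentiableOn.mul ?_).sub_const 1
    intro x hx
    have hx0 : x ≠ 0 := norm_pos_iff.1 (by linarith [hx.1])
    refine (differentiableAt_circleConj hx0 (W.circ_differentiableOn.differentiableAt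
      ((isOpen_ann _ _).mem_nhds (conj_inv_mem_ann (by linarith) hm0 ?_)))).differentiableWithinAt
    rwa [inv_inv]
  refine sub_eq_zero.1 (eq_zero_of_eq_zero_on_circle (by linarith) h3 h4 hd ?_ z hz)
  intro x hx
  rw [circleConj_of_norm_eq_one _ hx, Complex.mul_conj, Complex.normSq_eq_norm_sq,
    W.norm_circ hu hx]
  simp

theorem one_lt_norm_circ {z : ℂ} (hz : z ∈ ann 1 m) : 1 < ‖circ Φ u g z‖ := by
  obtain ⟨h0, h1, h2, h3, h4, h5, h6⟩ := W.radii
  have e := congrArg norm (W.circ_mul_circleConj hu (ann_mono h3.le le_rfl hz))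
  rw [norm_mul, norm_one, circleConj, RCLike.norm_conj] at e
  have hlt : ‖circ Φ u g (starRingEnd ℂ z)⁻¹‖ < 1 := by
    refine W.norm_circ_lt_one hu ?_
    rw [mem_ann, norm_conj_inv]
    have := hz.1
    exact ⟨inv_strictAnti₀ (by linarith) hz.2, inv_lt_one_of_one_lt₀ hz.1⟩
  have hpos : 0 ≤ ‖circ Φ u g z‖ := norm_nonneg _
  nlinarith [norm_nonneg (circ Φ u g (starRingEnd ℂ z)⁻¹)]

/-- The maximum principle on a level curve slightly inside, on which `|G| = |D| < 1`. -/
theorem norm_riem_lt_one {w : ℂ} (hw : w ∈ inside Φ 1) : ‖riem Φ u g w‖ < 1 := by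
  obtain ⟨h0, h1, h2, h3, h4, h5, h6⟩ := W.radii
  obtain ⟨s, ⟨hs1, hs2⟩, hs⟩ := W.nice_m.exists_mem_inside_of_mem ⟨h3, h4⟩ hw
  obtain ⟨σ, hσ1, hσ2⟩ := exists_between hs2
  have hσ : σ ∈ Ioo m⁻¹ m := ⟨hs1.trans hσ1, hσ2.trans h4⟩
  obtain ⟨z₀, hz₀, hmax⟩ := (isCompact_sphere (0 : ℂ) σ).exists_isMaxOn
    ⟨σ, by simp; linarith⟩
    (W.circ_differentiableOn.continuousOn.mono (sphere_subset_ann hσ.1 hσ.2)).norm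
  have hmem : ∀ z : ℂ, ‖z‖ = σ → z ∈ ann m⁻¹ 1 := fun z hz => ⟨hz ▸ hσ.1, hz ▸ hσ2⟩
  refine (W.nice_m.norm_le_of_level hσ ⟨h3, h4⟩ hσ2 W.riem_differentiableOn (fun z hz => ?_)
    (hs σ ⟨hσ1, hσ2⟩)).trans_lt (W.norm_circ_lt_one hu (hmem z₀ (by simpa using hz₀)))
  rw [W.riem_comp (hmem z hz)]
  exact hmax (by simpa using hz)

/-- A power of `|D|` is dominated by `|z|` on an annulus inside the unit circle: this holds on both
boundary circles for a large exponent, so the maximum principle applies to `D ^ N / z`. -/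
theorem exists_norm_circ_pow_le : ∃ r ∈ Ioo m⁻¹ 1, ∃ N : ℕ,
    ∀ z, r < ‖z‖ → ‖z‖ < 1 → ‖circ Φ u g z‖ ^ N ≤ ‖z‖ := by
  obtain ⟨h0, h1, h2, h3, h4, h5, h6⟩ := W.radii
  obtain ⟨r, hr1, hr2⟩ := exists_between h3
  have hr0 : 0 < r := by linarith
  obtain ⟨z₀, hz₀, hmax⟩ := (isCompact_sphere (0 : ℂ) r).exists_isMaxOn
    ⟨r, by simp; linarith⟩
    (W.circ_differentiableOn.continuousOn.mono (sphere_subset_ann hr1 (hr2.trans h4))).norm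
  have hlt : ‖circ Φ u g z₀‖ < 1 := by
    rw [mem_sphere_zero_iff_norm] at hz₀
    exact W.norm_circ_lt_one hu ⟨hz₀ ▸ hr1, hz₀ ▸ hr2⟩
  obtain ⟨N, hN⟩ := exists_pow_lt_of_lt_one hr0 hlt
  refine ⟨r, ⟨hr1, hr2⟩, N, fun z hz1 hz2 => ?_⟩
  have hcl : closure (ann r 1) ⊆ {z | r ≤ ‖z‖ ∧ ‖z‖ ≤ 1} := by
    refine closure_minimal (fun z hz => ⟨hz.1.le, hz.2.le⟩) ?_
    exact (isClosed_le continuous_const continuous_norm).inter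
      (isClosed_le continuous_norm continuous_const)
  have hd : DiffContOnCl ℂ (fun z => circ Φ u g z ^ N / z) (ann r 1) := by
    refine DifferentiableOn.diffContOnCl fun x hx => ?_
    obtain ⟨hx1, hx2⟩ := hcl hx
    have hx0 : x ≠ 0 := norm_pos_iff.1 (hr0.trans_le hx1)
    exact (((W.circ_differentiableOn.differentiableAt ((isOpen_ann _ _).mem_nhds
      ⟨hr1.trans_le hx1, hx2.trans_lt h4⟩)).pow N).div differentiableAt_id hx0).differentiableWithinAt
  have hb : Bornology.IsBounded (ann r 1) :=
    Metric.isBounded_ball.subset (fun z hz => by simpa using hz.2 : ann r 1 ⊆ Metric.ball 0 1)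
  have := Complex.norm_le_of_forall_mem_frontier_norm_le (C := 1) hb hd ?_
    (subset_closure (⟨hz1, hz2⟩ : z ∈ ann r 1))
  · rw [norm_div, norm_pow, div_le_one (hr0.trans hz1)] at this
    exact this
  · intro x hx
    rw [(isOpen_ann r 1).frontier_eq] at hx
    obtain ⟨hx1, hx2⟩ := hcl hx.1
    rw [norm_div, norm_pow, div_le_one (hr0.trans_le hx1)]
    rcases hx1.eq_or_lt with h | h
    · rw [← h]
      refine le_trans ?_ hN.le
      gcongr
      exact hmax (by simpa using h.symm)
    · have hx3 : ‖x‖ = 1 := by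
        rcases hx2.eq_or_lt with h' | h'
        · exact h'
        · exact absurd ⟨h, h'⟩ hx.2
      rw [W.norm_circ hu hx3, one_pow, hx3]

/-- The logarithmic derivative `z D'(z) / D(z)` is positive on the unit circle (Hopf's lemma). -/
theorem circ_logDeriv_re_pos {z : ℂ} (hz : ‖z‖ = 1) :
    0 < (z * deriv (circ Φ u g) z / circ Φ u g z).re := by
  obtain ⟨h0, h1, h2, h3, h4, h5, h6⟩ := W.radii
  obtain ⟨r, ⟨hr1, hr2⟩, N, hN⟩ := W.exists_norm_circ_pow_le hu
  have hz' : z ∈ ann m⁻¹ m := ⟨by rw [hz]; exact h3, by rw [hz]; exact h4⟩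
  have hD : HasDerivAt (circ Φ u g) (deriv (circ Φ u g) z) ((1 : ℝ) * z) := by
    simpa using (W.circ_differentiableOn.differentiableAt
      ((isOpen_ann _ _).mem_nhds hz')).hasDerivAt
  have hD1 : HasDerivAt (fun x : ℝ => circ Φ u g (x * z)) (deriv (circ Φ u g) z * z) 1 := by
    have h1 : HasDerivAt (fun x : ℝ => (x : ℂ) * z) z 1 := by
      simpa using (Complex.ofRealCLM.hasDerivAt (x := (1 : ℝ))).mul_const z
    exact HasDerivAt.comp (h₂ := circ Φ u g) (h := fun x : ℝ => (x : ℂ) * z) 1 hD h1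
  have hD2 := (hD1.norm_sq.pow N)
  -- The function `x ^ 2 - |D (x z)| ^ (2 N)` vanishes at `x = 1` and is nonnegative to the left, so
  -- its derivative `2 - 2 N Re (z D' / D)` at `x = 1` is at most zero.
  have hD3 : HasDerivAt (fun x : ℝ => x ^ 2 - (‖circ Φ u g (x * z)‖ ^ 2) ^ N) _ 1 :=
    (hasDerivAt_pow 2 (1 : ℝ)).sub hD2
  have hle := deriv_nonpos_of_left_nonneg hr2 hD3 (by simp [W.norm_circ hu hz]) ?_
  · simp only [Complex.ofReal_one, one_mul, W.norm_circ hu hz, one_pow, mul_one] at hle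
    have e : z * deriv (circ Φ u g) z / circ Φ u g z =
        (starRingEnd ℂ) (circ Φ u g z) * (deriv (circ Φ u g) z * z) := by
      have h7 := W.circ_ne_zero hz'
      rw [div_eq_iff h7]
      have h8 : (starRingEnd ℂ) (circ Φ u g z) * circ Φ u g z = 1 := by
        rw [mul_comm, Complex.mul_conj, Complex.normSq_eq_norm_sq, W.norm_circ hu hz]; simp
      linear_combination (-(deriv (circ Φ u g) z * z)) * h8
    have e2 : inner ℝ (circ Φ u g z) (deriv (circ Φ u g) z * z) =
        (z * deriv (circ Φ u g) z / circ Φ u g z).re := by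
      rw [e, Complex.inner, mul_comm]
    rw [e2] at hle
    by_contra hcon
    push Not at hcon
    have : (N : ℝ) * (2 * (z * deriv (circ Φ u g) z / circ Φ u g z).re) ≤ 0 :=
      mul_nonpos_of_nonneg_of_nonpos (Nat.cast_nonneg N) (by linarith)
    norm_num at hle
    linarith
  · intro x hx
    have hx0 : 0 < x := by linarith [hx.1]
    have hnx : ‖(x : ℂ) * z‖ = x := by rw [norm_mul, hz]; simp [abs_of_pos hx0]
    have := hN (x * z) (by rw [hnx]; exact hx.1) (by rw [hnx]; exact hx.2)
    rw [hnx] at this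
    have h9 : (‖circ Φ u g (x * z)‖ ^ 2) ^ N = (‖circ Φ u g (x * z)‖ ^ N) ^ 2 := by ring
    rw [h9, sub_nonneg]
    gcongr

end

end WeldingSolution

/-! ### Restrictions of holomorphic functions to the circle -/

theorem hasDerivAt_comp_circleExp {F : ℂ → ℂ} {θ : ℝ}
    (hF : DifferentiableAt ℂ F (Circle.exp θ)) :
    HasDerivAt (fun t : ℝ => F (Circle.exp t))
      (deriv F (Circle.exp θ) * ((Circle.exp θ : ℂ) * Complex.I)) θ := by
  have h2 : HasDerivAt (fun t : ℝ => ((Circle.exp t : Circle) : ℂ))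
      ((Circle.exp θ : ℂ) * Complex.I) θ := by
    have h1 : HasDerivAt (fun t : ℝ => (t : ℂ) * Complex.I) Complex.I θ := by
      simpa using (Complex.ofRealCLM.hasDerivAt (x := θ)).mul_const Complex.I
    simpa [Circle.coe_exp] using h1.cexp
  exact HasDerivAt.comp (h₂ := F) θ hF.hasDerivAt h2

theorem angDeriv_restrict {F : ℂ → ℂ} {θ : ℝ} (hF : DifferentiableAt ℂ F (Circle.exp θ)) :
    angDeriv (fun z => F z) θ = deriv F (Circle.exp θ) * ((Circle.exp θ : ℂ) * Complex.I) :=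
  (hasDerivAt_comp_circleExp hF).deriv

theorem circleMap_eq_exp (θ : ℝ) : circleMap 0 1 θ = (Circle.exp θ : ℂ) := by
  simp [circleMap, Circle.coe_exp]

theorem windingNumber_restrict {F : ℂ → ℂ} (hF : ∀ z : ℂ, ‖z‖ = 1 → DifferentiableAt ℂ F z) :
    windingNumber (fun z => F z) = CT F 1 (fun _ => 1) 0 := by
  unfold windingNumber CT cint circleIntegral
  congr 1
  refine intervalIntegral.integral_congr fun θ _ => ?_
  simp only [deriv_circleMap, smul_eq_mul, circleMap_eq_exp]
  rw [angDeriv_restrict (hF _ (Circle.norm_coe _))]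
  ring

/-- A function holomorphic near the circle is real-analytic on the circle. -/
theorem isRealAnalytic_restrict {F : ℂ → ℂ} {U : Set ℂ} (hU : IsOpen U)
    (hS : ∀ z : ℂ, ‖z‖ = 1 → z ∈ U) (hF : DifferentiableOn ℂ F U) :
    IsRealAnalytic fun z => F z := by
  intro θ _
  have h1 : AnalyticAt ℝ F (Circle.exp θ : ℂ) :=
    (hF.analyticAt (hU.mem_nhds (hS _ (Circle.norm_coe _)))).restrictScalars
  have h2 : AnalyticAt ℝ (fun t : ℝ => Complex.exp ((t : ℂ) * Complex.I)) θ := by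
    have h3 : AnalyticAt ℝ (fun t : ℝ => (t : ℂ) * Complex.I) θ :=
      (Complex.ofRealCLM.analyticAt θ).mul analyticAt_const
    exact ((Complex.differentiable_exp.analyticAt _).restrictScalars (𝕜 := ℝ)).comp h3
  have h4 := AnalyticAt.comp (g := F) (f := fun t : ℝ => Complex.exp ((t : ℂ) * Complex.I))
    (x := θ) (by simpa [Circle.coe_exp] using h1) h2
  simpa [Function.comp_def, Circle.coe_exp] using h4

/-- A holomorphic function near the unit circle which is an embedding of the circle into `ℂ ∖ {0}`
with winding number one is a nice map on some annulus. -/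
theorem exists_niceMap {a b : ℝ} (ha : 0 < a) (ha1 : a < 1) (hb : 1 < b) {F : ℂ → ℂ}
    (hF : DifferentiableOn ℂ F (ann a b)) (hinj : InjOn F (Metric.sphere 0 1))
    (hne : ∀ z, ‖z‖ = 1 → F z ≠ 0) (hd : ∀ z, ‖z‖ = 1 → deriv F z ≠ 0)
    (hw : CT F 1 (fun _ => 1) 0 = 1) : ∃ a' ∈ Ioo a 1, ∃ b' ∈ Ioo 1 b, NiceMap a' b' F := by
  have hS : Metric.sphere (0 : ℂ) 1 ⊆ ann a b := sphere_subset_ann ha1 hb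
  have hn : ∀ z ∈ Metric.sphere (0 : ℂ) 1, ann a b ∈ 𝓝 z := fun z hz =>
    (isOpen_ann a b).mem_nhds (hS hz)
  obtain ⟨T, hT, hTinj⟩ := hinj.exists_mem_nhdsSet (isCompact_sphere 0 1)
    (fun z hz => (hF.differentiableAt (hn z hz)).continuousAt) (fun z hz => by
      have hs : HasStrictDerivAt F (deriv F z) z := (hF.analyticAt (hn z hz)).hasStrictDerivAt
      have hs' := hs.hasStrictFDerivAt_equiv (hd z (by simpa using hz))
      exact ⟨_, (HasStrictFDerivAt.toOpenPartialHomeomorph F hs').open_source.mem_nhds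
        (HasStrictFDerivAt.mem_toOpenPartialHomeomorph_source hs'),
        (HasStrictFDerivAt.toOpenPartialHomeomorph F hs').injOn⟩)
  obtain ⟨U, hU, hSU, hUT⟩ := mem_nhdsSet_iff_exists.1 hT
  have hV1 : IsOpen (ann a b ∩ F ⁻¹' {0}ᶜ) :=
    hF.continuousOn.isOpen_inter_preimage (isOpen_ann a b) isOpen_compl_singleton
  have hV2 : IsOpen (ann a b ∩ deriv F ⁻¹' {0}ᶜ) :=
    (hF.deriv (isOpen_ann a b)).continuousOn.isOpen_inter_preimage (isOpen_ann a b)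
      isOpen_compl_singleton
  obtain ⟨δ, hδ, h⟩ := exists_ann_subset_of_isOpen (hU.inter (hV1.inter hV2)) one_pos
    (fun z hz => ⟨hSU hz, ⟨hS hz, hne z (by simpa using hz)⟩, ⟨hS hz, hd z (by simpa using hz)⟩⟩)
  obtain ⟨a', h1, h2⟩ := exists_between (max_lt ha1 (sub_lt_self 1 hδ) : max a (1 - δ) < 1)
  obtain ⟨b', h3, h4⟩ := exists_between (lt_min hb (lt_add_of_pos_right 1 hδ) : 1 < min b (1 + δ))
  have ha' : a < a' := (le_max_left _ _).trans_lt h1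
  have hb' : b' < b := h4.trans_le (min_le_left _ _)
  have key : ∀ z ∈ ann a' b', z ∈ U ∩ ((ann a b ∩ F ⁻¹' {0}ᶜ) ∩ (ann a b ∩ deriv F ⁻¹' {0}ᶜ)) := by
    intro z hz
    refine h z (abs_lt.2 ⟨?_, ?_⟩)
    · linarith [hz.1, (le_max_right a (1 - δ)).trans_lt h1]
    · linarith [hz.2, h4.trans_le (min_le_right b (1 + δ))]
  exact ⟨a', ⟨ha', h2⟩, b', ⟨h3, hb'⟩,
    { pos := ha.trans ha'
      lt_one := h2
      one_lt := h3
      diff := hF.mono (ann_mono ha'.le hb'.le)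
      inj := hTinj.mono fun z hz => hUT (key z hz).1
      ne_zero := fun z hz => (key z hz).2.1.2
      deriv_ne := fun z hz => (key z hz).2.2.2
      wind := hw }⟩

/-- A holomorphic function near the unit circle which preserves the circle, with positive
logarithmic derivative and winding number one, is a bijection of the circle: it is `e^{iα}` for an
increasing function `α` of the angle with total increment `2π`. -/
theorem circle_bijective {a b : ℝ} (ha1 : a < 1) (hb : 1 < b) {D : ℂ → ℂ}
    (hD : DifferentiableOn ℂ D (ann a b)) (hnorm : ∀ z, ‖z‖ = 1 → ‖D z‖ = 1)
    (hpos : ∀ z, ‖z‖ = 1 → 0 < (z * deriv D z / D z).re) (hw : CT D 1 (fun _ => 1) 0 = 1) :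
    InjOn D (Metric.sphere 0 1) ∧ ∀ w, ‖w‖ = 1 → ∃ z, ‖z‖ = 1 ∧ D z = w := by
  have hS : Metric.sphere (0 : ℂ) 1 ⊆ ann a b := sphere_subset_ann ha1 hb
  set e : ℝ → ℂ := fun θ => circleMap 0 1 θ with he
  have he1 : ∀ θ, ‖e θ‖ = 1 := fun θ => by simp [he]
  have heS : ∀ θ, e θ ∈ Metric.sphere (0 : ℂ) 1 := fun θ => by simpa using he1 θ
  have hec : Continuous e := continuous_circleMap 0 1
  have hne : ∀ z, ‖z‖ = 1 → D z ≠ 0 := fun z hz h => by simpa [h] using hnorm z hz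
  -- The logarithmic derivative `κ` is real since `|D| = 1`, and `α` is its integral. Hence `D (e θ)
  -- = D (e 0) exp (i α θ)`, and the winding number is `α (2π) / 2π`.
  set κ : ℝ → ℂ := fun θ => e θ * deriv D (e θ) / D (e θ) with hκ
  have hκc : Continuous κ := by
    refine (hec.mul ?_).div ?_ fun θ => hne _ (he1 θ)
    · exact ((hD.deriv (isOpen_ann a b)).continuousOn.mono hS).comp_continuous hec heS
    · exact (hD.continuousOn.mono hS).comp_continuous hec heS
  have hDe : ∀ θ, HasDerivAt (fun t => D (e t)) (κ θ * Complex.I * D (e θ)) θ := by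
    intro θ
    have h1 : HasDerivAt D (deriv D (e θ)) (e θ) :=
      (hD.differentiableAt ((isOpen_ann a b).mem_nhds (hS (heS θ)))).hasDerivAt
    have h2 : HasDerivAt e (e θ * Complex.I) θ := hasDerivAt_circleMap 0 1 θ
    have h3 := HasDerivAt.comp (h₂ := D) θ h1 h2
    refine h3.congr_deriv ?_
    have := hne _ (he1 θ)
    simp only [hκ]
    field_simp
  have him : ∀ θ, (κ θ).im = 0 := by
    intro θ
    have h1 := (hDe θ).norm_sq
    have h2 : (fun t => ‖D (e t)‖ ^ 2) = fun _ => (1 : ℝ) := by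
      funext t; rw [hnorm _ (he1 t)]; norm_num
    rw [h2] at h1
    have h3 := h1.unique (hasDerivAt_const θ (1 : ℝ))
    have h4 : κ θ * Complex.I * D (e θ) * (starRingEnd ℂ) (D (e θ)) = κ θ * Complex.I := by
      rw [mul_assoc, Complex.mul_conj, Complex.normSq_eq_norm_sq, hnorm _ (he1 θ)]; simp
    rw [Complex.inner, h4] at h3
    simpa using h3
  set α : ℝ → ℝ := fun θ => ∫ t in (0 : ℝ)..θ, (κ t).re with hα
  have hκre : Continuous fun t => (κ t).re := Complex.continuous_re.comp hκc
  have hαd : ∀ θ, HasDerivAt α (κ θ).re θ := fun θ =>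
    intervalIntegral.integral_hasDerivAt_right (hκre.intervalIntegrable _ _)
      hκre.stronglyMeasurable.stronglyMeasurableAtFilter hκre.continuousAt
  have hαmono : StrictMono α := strictMono_of_deriv_pos fun θ => by
    rw [(hαd θ).deriv]; exact hpos _ (he1 θ)
  have hα0 : α 0 = 0 := by simp [hα]
  have hα2 : α (2 * Real.pi) = 2 * Real.pi := by
    have h1 : CT D 1 (fun _ => 1) 0 = (2 * Real.pi : ℂ)⁻¹ * (α (2 * Real.pi) : ℂ) := by
      rw [CT, cint_eq_average, hα]
      simp only
      rw [← intervalIntegral.integral_ofReal]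
      congr 1
      refine intervalIntegral.integral_congr fun θ _ => ?_
      have : ((κ θ).re : ℂ) = κ θ := Complex.ext (by simp) (by simp [him θ])
      rw [this]
      simp only [hκ, he]
      ring
    rw [hw] at h1
    have hpi : (2 * Real.pi : ℂ) ≠ 0 := by simp [Real.pi_ne_zero]
    have h2 : (α (2 * Real.pi) : ℂ) = ((2 * Real.pi : ℝ) : ℂ) := by
      push_cast
      field_simp at h1
      exact h1.symm
    exact_mod_cast h2
  have hlift : ∀ θ, D (e θ) = D (e 0) * Complex.exp (α θ * Complex.I) := by
    have hd : ∀ θ, HasDerivAt (fun t => D (e t) * Complex.exp (-(α t * Complex.I))) 0 θ := by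
      intro θ
      have h1 : HasDerivAt (fun t => (α t : ℂ)) ((κ θ).re : ℂ) θ := (hαd θ).ofReal_comp
      have h2 := (hDe θ).mul (h1.mul_const Complex.I).neg.cexp
      refine h2.congr_deriv ?_
      have : ((κ θ).re : ℂ) = κ θ := Complex.ext (by simp) (by simp [him θ])
      rw [this]
      ring
    intro θ
    have h3 := is_const_of_deriv_eq_zero (fun t => (hd t).differentiableAt)
      (fun t => (hd t).deriv) θ 0
    simp only [hα0] at h3
    rw [Complex.exp_neg] at h3
    have := Complex.exp_ne_zero (α θ * Complex.I)
    field_simp at h3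
    simp only [Complex.ofReal_zero, mul_zero, neg_zero, Complex.exp_zero, mul_one] at h3
    linear_combination h3
  have himg : ∀ z : ℂ, ‖z‖ = 1 → ∃ θ ∈ Ioc 0 (2 * Real.pi), e θ = z := by
    intro z hz
    have : z ∈ circleMap 0 1 '' Ioc 0 (2 * Real.pi) := by
      rw [image_circleMap_Ioc]; simpa using hz
    exact this
  constructor
  · intro z hz z' hz' heq
    obtain ⟨θ, hθ, rfl⟩ := himg z (by simpa using hz)
    obtain ⟨θ', hθ', rfl⟩ := himg z' (by simpa using hz')
    rw [hlift θ, hlift θ'] at heq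
    have h1 := mul_left_cancel₀ (hne _ (he1 0)) heq
    obtain ⟨n, hn⟩ := Complex.exp_eq_exp_iff_exists_int.1 h1
    have h2 : α θ = α θ' + n * (2 * Real.pi) := by
      have h3 : (α θ : ℂ) * Complex.I = ((α θ' + n * (2 * Real.pi) : ℝ) : ℂ) * Complex.I := by
        rw [hn]; push_cast; ring
      exact_mod_cast mul_right_cancel₀ Complex.I_ne_zero h3
    have b1 : 0 < α θ := hα0 ▸ hαmono hθ.1
    have b2 : α θ ≤ 2 * Real.pi := hα2 ▸ hαmono.monotone hθ.2
    have b3 : 0 < α θ' := hα0 ▸ hαmono hθ'.1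
    have b4 : α θ' ≤ 2 * Real.pi := hα2 ▸ hαmono.monotone hθ'.2
    have hpi := Real.pi_pos
    have hn0 : n = 0 := by
      have l1 : (n : ℝ) < 1 := by nlinarith
      have l2 : (-1 : ℝ) < n := by nlinarith
      have l1' : n < 1 := by exact_mod_cast l1
      have l2' : -1 < n := by exact_mod_cast l2
      omega
    rw [hn0] at h2
    simp only [Int.cast_zero, zero_mul, add_zero] at h2
    rw [hαmono.injective h2]
  · intro w hw1
    obtain ⟨β, hβ, hβw⟩ := himg (w / D (e 0)) (by rw [norm_div, hw1, hnorm _ (he1 0), div_one])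
    have hαc : Continuous α := continuous_iff_continuousAt.2 fun θ => (hαd θ).continuousAt
    obtain ⟨θ, -, hθ⟩ := intermediate_value_Icc (by positivity : (0 : ℝ) ≤ 2 * Real.pi)
      hαc.continuousOn (show β ∈ Icc (α 0) (α (2 * Real.pi)) by
        rw [hα0, hα2]; exact ⟨hβ.1.le, hβ.2⟩)
    refine ⟨e θ, he1 θ, ?_⟩
    rw [hlift θ, hθ]
    have : e β = Complex.exp (β * Complex.I) := by simp [he, circleMap]
    rw [← this, hβw]
    have := hne _ (he1 0)
    field_simp

/-! ### The univalent factor -/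

namespace WeldingSolution

variable {m ρ R σ : ℝ} {Φ u g : ℂ → ℂ}

section
variable (W : WeldingSolution m ρ R Φ u g)
include W

/-- The univalent factor `F` is the Cauchy integral of `Φ` along an image curve of `D` outside the
unit disk. -/
theorem univ_differentiableAt (hσ : σ ∈ Ioo 1 m) {w : ℂ}
    (hw : w ∉ circ Φ u g '' Metric.sphere 0 σ) :
    DifferentiableAt ℂ (CT (circ Φ u g) σ Φ) w := by
  obtain ⟨h0, h1, h2, h3, h4, h5, h6⟩ := W.radii
  have hS : Metric.sphere (0 : ℂ) σ ⊆ ann m⁻¹ m := sphere_subset_ann (h3.trans hσ.1) hσ.2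
  exact CDef.CT_differentiableAt (by linarith [hσ.1]) (W.circ_differentiableOn.continuousOn.mono hS)
    ((W.circ_differentiableOn.deriv (isOpen_ann _ _)).continuousOn.mono hS)
    (W.nice_m.diff.continuousOn.mono hS) hw

theorem isOpen_compl_curve_circ (hσ : σ ∈ Ioo m⁻¹ m) :
    IsOpen (circ Φ u g '' Metric.sphere 0 σ)ᶜ :=
  ((isCompact_sphere (0 : ℂ) σ).image_of_continuousOn (W.circ_differentiableOn.continuousOn.mono
    (sphere_subset_ann hσ.1 hσ.2))).isClosed.isOpen_compl

end

section
variable (W : WeldingSolution m ρ R Φ u g)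
  (hu : ∀ z, ‖z‖ = 1 → (u z).re = -Real.log ‖Φ z‖)
include W hu

theorem circ_bijective : InjOn (circ Φ u g) (Metric.sphere 0 1) ∧
    ∀ w, ‖w‖ = 1 → ∃ z, ‖z‖ = 1 ∧ circ Φ u g z = w := by
  obtain ⟨h0, h1, h2, h3, h4, h5, h6⟩ := W.radii
  exact circle_bijective h3 h4 W.circ_differentiableOn (fun z hz => W.norm_circ hu hz)
    (fun z hz => W.circ_logDeriv_re_pos hu hz) W.circ_wind

theorem exists_niceMap_circ : ∃ a ∈ Ioo m⁻¹ 1, ∃ b ∈ Ioo 1 m, NiceMap a b (circ Φ u g) := by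
  obtain ⟨h0, h1, h2, h3, h4, h5, h6⟩ := W.radii
  refine exists_niceMap (by linarith) h3 h4 W.circ_differentiableOn (W.circ_bijective hu).1
    (fun z hz h => ?_) (fun z hz h => ?_) W.circ_wind
  · have := W.norm_circ hu hz
    rw [h] at this; simp at this
  · have := W.circ_logDeriv_re_pos hu hz
    rw [h] at this; simp at this

theorem notMem_curve_circ (hσ : σ ∈ Ioo 1 m) {w : ℂ} (hw : ‖w‖ ≤ 1) :
    w ∉ circ Φ u g '' Metric.sphere 0 σ := by
  rintro ⟨z, hz, rfl⟩
  rw [mem_sphere_zero_iff_norm] at hz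
  exact absurd (W.one_lt_norm_circ hu ⟨hz ▸ hσ.1, hz ▸ hσ.2⟩) (not_lt.2 hw)

/-- The univalent factor does not depend on the radius of the contour. -/
theorem CT_circ_shift {τ : ℝ} (hσ : σ ∈ Ioo 1 m) (hτ : τ ∈ Ioo 1 m) {w : ℂ} (hw : ‖w‖ ≤ 1) :
    CT (circ Φ u g) σ Φ w = CT (circ Φ u g) τ Φ w := by
  obtain ⟨h0, h1, h2, h3, h4, h5, h6⟩ := W.radii
  wlog hle : τ ≤ σ generalizing σ τ
  · exact (this hτ hσ (not_le.1 hle).le).symm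
  refine CT_shift_closed (by linarith [hτ.1]) hle W.circ_differentiableOn W.nice_m.diff
    (h3.trans hτ.1) hσ.2 fun z hz1 hz2 h => ?_
  exact absurd (W.one_lt_norm_circ hu ⟨hτ.1.trans_le hz1, hz2.trans_lt hσ.2⟩)
    (not_lt.2 (h ▸ hw))

/-- `F ∘ D = Φ` near the unit circle. The difference continues to the outside of the curve
`D`, which is the outside of the unit disk, and, through the map `G`, to the inside of
the curve `Φ`. -/
theorem univ_comp_circ {a b : ℝ} (ha : a ∈ Ioo m⁻¹ 1) (hb : b ∈ Ioo 1 m)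
    (N : NiceMap a b (circ Φ u g)) (hσ : σ ∈ Ioo 1 b) {z : ℂ} (hz : z ∈ ann a σ) :
    CT (circ Φ u g) σ Φ (circ Φ u g z) = Φ z := by
  obtain ⟨h0, h1, h2, h3, h4, h5, h6⟩ := W.radii
  have hσm : σ ∈ Ioo 1 m := ⟨hσ.1, hσ.2.trans hb.2⟩
  have Nσ : NiceMap a σ (circ Φ u g) := N.mono le_rfl ha.2 hσ.2.le hσ.1
  have Pσ : NiceMap a σ Φ := W.nice_m.mono ha.1.le ha.2 (hσ.2.trans hb.2).le hσ.1
  have Pb : NiceMap a b Φ := W.nice_m.mono ha.1.le ha.2 hb.2.le hb.1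
  have hS1 : Metric.sphere (0 : ℂ) 1 ⊆ ann a b := sphere_subset_ann ha.2 hb.1
  have hc1 : ContinuousOn Φ (Metric.sphere 0 1) := Pb.diff.continuousOn.mono hS1
  have hshift : ∀ z ∈ ann a 1, CT (circ Φ u g) σ Φ (circ Φ u g z) =
      CT (circ Φ u g) 1 Φ (circ Φ u g z) := by
    intro z hz
    refine CT_shift_closed one_pos hσ.1.le N.diff Pb.diff ha.2 hσ.2 fun x hx1 hx2 h => ?_
    have := N.inj ⟨ha.2.trans_le hx1, hx2.trans_lt hσ.2⟩ (ann_mono le_rfl hb.1.le hz) h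
    rw [this] at hx1
    exact absurd hz.2 (not_lt.2 hx1)
  -- The Cauchy integral over `|z| = σ` splits by the jump relation outside the curve `D(|z| = 1)`.
  -- Inside, where the contour can be moved to `|z| = 1`, it is composed with `G`, since `D = G ∘
  -- Φ`.
  have key := Nσ.eq_zero_of_outside
    (q := fun z => Φ z - CT (circ Φ u g) σ Φ (circ Φ u g z))
    (Y := fun w => -CT (circ Φ u g) 1 Φ w) ?_ ?_ ?_ ?_ ?_
  · exact (sub_eq_zero.1 (key z hz)).symm
  · refine Pσ.diff.sub fun x hx => ?_
    have hx' : x ∈ ann a b := ann_mono le_rfl hσ.2.le hx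
    exact (DifferentiableAt.comp (g := CT (circ Φ u g) σ Φ) x (W.univ_differentiableAt hσm
      (N.notMem_curve ⟨ha.2.trans hσ.1, hσ.2⟩ hx' hx.2.ne))
      (N.differentiableAt hx')).differentiableWithinAt
  · exact fun w hw => (N.CT_differentiableAt N.one_mem hc1 hw.1).neg.differentiableWithinAt
  · simpa using (N.CT_tendsto_zero N.one_mem hc1).neg
  · intro x hx
    have := CT_jump (a := a) (b := b) (σ := 1) (τ := σ) (f := Φ) N.pos.le N.diff N.inj Pb.diff ha.2
      hσ.2 (z := x) (N.deriv_ne x ⟨ha.2.trans hx.1, hx.2.trans hσ.2⟩) hx.1 hx.2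
    linear_combination this
  · intro M hM x hx
    have hin := Pσ.map_mem_inside Pσ.one_mem hx
    have := Pσ.norm_le_inside (Y := fun w => w - CT (circ Φ u g) 1 Φ (riem Φ u g w))
      (y := fun z => Φ z - CT (circ Φ u g) σ Φ (circ Φ u g z)) (M := M) ?_ ?_ ?_ hM hin
    · rwa [W.riem_comp (ann_mono ha.1.le le_rfl hx), ← hshift x hx] at this
    · refine differentiableOn_id.sub fun w hw => ?_
      have h7 : riem Φ u g w ∉ circ Φ u g '' Metric.sphere 0 1 := by
        rintro ⟨x, hx, e⟩
        have := W.norm_riem_lt_one hu hw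
        rw [← e, W.norm_circ hu (by simpa using hx)] at this
        exact lt_irrefl _ this
      exact (DifferentiableAt.comp (g := CT (circ Φ u g) 1 Φ) w
        (N.CT_differentiableAt N.one_mem hc1 h7) (W.riem_differentiableOn.differentiableAt
          ((W.nice_m.isOpen_inside ⟨h3, h4⟩).mem_nhds hw))).differentiableWithinAt
    · refine Pσ.diff.continuousOn.sub fun x hx => ?_
      have hx' : x ∈ ann a b := ann_mono le_rfl hσ.2.le hx
      exact (DifferentiableAt.comp (g := CT (circ Φ u g) σ Φ) x (W.univ_differentiableAt hσm
        (N.notMem_curve ⟨ha.2.trans hσ.1, hσ.2⟩ hx' hx.2.ne))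
        (N.differentiableAt hx')).continuousAt.continuousWithinAt
    · intro x hx
      rw [W.riem_comp (ann_mono ha.1.le le_rfl hx), ← hshift x hx]

/-- `F` inverts `G`. -/
theorem univ_riem (hσ : σ ∈ Ioo 1 m) {w : ℂ} (hw : w ∈ inside Φ 1) :
    CT (circ Φ u g) σ Φ (riem Φ u g w) = w := by
  obtain ⟨h0, h1, h2, h3, h4, h5, h6⟩ := W.radii
  obtain ⟨a, ha, b, hb, N⟩ := W.exists_niceMap_circ hu
  obtain ⟨τ, hτ⟩ := exists_between hb.1
  have hτm : τ ∈ Ioo 1 m := ⟨hτ.1, hτ.2.trans hb.2⟩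
  rw [W.CT_circ_shift hu hσ hτm (W.norm_riem_lt_one hu hw).le]
  have Pτ : NiceMap a τ Φ := W.nice_m.mono ha.1.le ha.2 (hτ.2.trans hb.2).le hτ.1
  have := Pτ.norm_le_inside (Y := fun w => CT (circ Φ u g) τ Φ (riem Φ u g w) - w)
    (y := fun _ => 0) (M := 0) ?_ continuousOn_const ?_ (by simp) hw
  · exact sub_eq_zero.1 (norm_le_zero_iff.1 this)
  · refine DifferentiableOn.sub (fun w hw => ?_) differentiableOn_id
    exact (DifferentiableAt.comp (g := CT (circ Φ u g) τ Φ) w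
        (W.univ_differentiableAt hτm (W.notMem_curve_circ hu hτm (W.norm_riem_lt_one hu hw).le))
        (W.riem_differentiableOn.differentiableAt
          ((W.nice_m.isOpen_inside ⟨h3, h4⟩).mem_nhds hw))).differentiableWithinAt
  · intro z hz
    rw [W.riem_comp (ann_mono ha.1.le le_rfl hz),
      W.univ_comp_circ hu ha hb N hτ (ann_mono le_rfl hτ.1.le hz), sub_self]

theorem univ_deriv_riem (hσ : σ ∈ Ioo 1 m) {w : ℂ} (hw : w ∈ inside Φ 1) :
    deriv (CT (circ Φ u g) σ Φ) (riem Φ u g w) * deriv (riem Φ u g) w = 1 := by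
  obtain ⟨h0, h1, h2, h3, h4, h5, h6⟩ := W.radii
  have hn := (W.nice_m.isOpen_inside ⟨h3, h4⟩).mem_nhds hw
  have e := HasDerivAt.comp (h₂ := CT (circ Φ u g) σ Φ) w
    (W.univ_differentiableAt hσ
      (W.notMem_curve_circ hu hσ (W.norm_riem_lt_one hu hw).le)).hasDerivAt
    (W.riem_differentiableOn.differentiableAt hn).hasDerivAt
  refine e.unique ((hasDerivAt_id w).congr_of_eventuallyEq ?_)
  filter_upwards [hn] with x hx
  exact W.univ_riem hu hσ hx

/-- `G` maps the inside of the curve onto the unit disk: its image is open, and relatively closed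
because `F` maps boundary points of the image in the disk neither to the inside nor to the
curve. -/
theorem ball_subset_riem : Metric.ball (0 : ℂ) 1 ⊆ riem Φ u g '' inside Φ 1 := by
  obtain ⟨h0, h1, h2, h3, h4, h5, h6⟩ := W.radii
  obtain ⟨σ, hσ⟩ := exists_between h4
  have hop : IsOpen (inside Φ 1) := W.nice_m.isOpen_inside ⟨h3, h4⟩
  refine (convex_ball (0 : ℂ) 1).isPreconnected.subset_of_closure_inter_subset ?_ ?_ ?_
  · rw [isOpen_iff_mem_nhds]
    rintro _ ⟨w, hw, rfl⟩
    have hs := (W.riem_differentiableOn.analyticAt (hop.mem_nhds hw)).hasStrictDerivAt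
    have hd : deriv (riem Φ u g) w ≠ 0 := right_ne_zero_of_mul
      (by rw [W.univ_deriv_riem hu hσ hw]; exact one_ne_zero)
    rw [← hs.map_nhds_eq hd]
    exact image_mem_map (hop.mem_nhds hw)
  · exact ⟨0, by simp, 0, W.nice_m.zero_mem_inside ⟨h3, h4⟩, by simp [riem]⟩
  · rintro b ⟨hbc, hb⟩
    rw [mem_ball_zero_iff] at hb
    have hFb : ContinuousAt (CT (circ Φ u g) σ Φ) b :=
      (W.univ_differentiableAt hσ (W.notMem_curve_circ hu hσ hb.le)).continuousAt
    have hfreq := mem_closure_iff_frequently.1 hbc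
    have hcl : CT (circ Φ u g) σ Φ b ∈ closure (inside Φ 1) := by
      refine mem_closure_iff_frequently.2 (hFb.tendsto.frequently (hfreq.mono ?_))
      rintro _ ⟨w, hw, rfl⟩
      rwa [W.univ_riem hu hσ hw]
    -- The point `F b` is in the closure of the inside. If it is inside, then `G (F b) = b` by
    -- continuity. If it were `Φ z₀` with `|z₀| = 1`, then points near `F b` would be `Φ z` with `|D
    -- z|` near one, while those of the form `F (G w) = w` have `|D z| = |G w|` near `|b| < 1`.
    rcases W.nice_m.closure_inside ⟨h3, h4⟩ hcl with hin | ⟨z₀, hz₀, hz₀b⟩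
    · refine ⟨_, hin, ?_⟩
      have hc : ContinuousAt (fun x => riem Φ u g (CT (circ Φ u g) σ Φ x) - x) b :=
        (ContinuousAt.comp (g := riem Φ u g)
          (W.riem_differentiableOn.differentiableAt (hop.mem_nhds hin)).continuousAt hFb).sub
          continuousAt_id
      refine sub_eq_zero.1 (isClosed_singleton.mem_of_frequently_of_tendsto (s := {(0 : ℂ)})
        (hfreq.mono ?_) hc.tendsto)
      rintro _ ⟨w, hw, rfl⟩
      simp [W.univ_riem hu hσ hw]
    · exfalso
      rw [mem_sphere_zero_iff_norm] at hz₀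
      have hz₀' : z₀ ∈ ann m⁻¹ m := ⟨by rw [hz₀]; exact h3, by rw [hz₀]; exact h4⟩
      have hV : {z | z ∈ ann m⁻¹ m ∧ (1 + ‖b‖) / 2 < ‖circ Φ u g z‖} ∈ 𝓝 z₀ := by
        have := (W.circ_differentiableOn.continuousOn.norm.isOpen_inter_preimage (isOpen_ann _ _)
          (isOpen_Ioi (a := (1 + ‖b‖) / 2))).mem_nhds (x := z₀)
          ⟨hz₀', by simp only [mem_preimage, W.norm_circ hu hz₀, mem_Ioi]; linarith⟩
        exact this
      have hV' := image_mem_map (f := 𝓝 z₀) (m := Φ) hV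
      rw [W.nice_m.map_nhds hz₀', hz₀b] at hV'
      have hsmall : ∀ᶠ x in 𝓝 b, ‖x‖ < (1 + ‖b‖) / 2 :=
        (isOpen_lt continuous_norm continuous_const).mem_nhds
          (show ‖b‖ < (1 + ‖b‖) / 2 by linarith)
      obtain ⟨_, ⟨w, hw, rfl⟩, ⟨z, ⟨hz1, hz2⟩, hzw⟩, hlt⟩ :=
        (hfreq.and_eventually ((hFb.eventually hV').and hsmall)).exists
      rw [W.univ_riem hu hσ hw] at hzw
      subst hzw
      have hz3 : ‖z‖ < 1 := by
        by_contra hcon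
        rcases (not_lt.1 hcon).eq_or_lt with h7 | h7
        · exact hw.1 ⟨z, by simpa using h7.symm, rfl⟩
        · exact NiceMap.notMem_outside_of_inside hw
            (W.nice_m.map_mem_outside ⟨h3, h4⟩ ⟨h7, hz1.2⟩)
      rw [W.riem_comp ⟨hz1.1, hz3⟩] at hlt
      exact absurd hz2 (not_lt.2 hlt.le)

theorem univ_injOn (hσ : σ ∈ Ioo 1 m) : InjOn (CT (circ Φ u g) σ Φ) (Metric.ball 0 1) := by
  intro b hb b' hb' h
  obtain ⟨w, hw, rfl⟩ := W.ball_subset_riem hu hb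
  obtain ⟨w', hw', rfl⟩ := W.ball_subset_riem hu hb'
  rw [W.univ_riem hu hσ hw, W.univ_riem hu hσ hw'] at h
  rw [h]

theorem univ_zero (hσ : σ ∈ Ioo 1 m) : CT (circ Φ u g) σ Φ 0 = 0 := by
  obtain ⟨h0, h1, h2, h3, h4, h5, h6⟩ := W.radii
  have := W.univ_riem hu hσ (W.nice_m.zero_mem_inside ⟨h3, h4⟩)
  simpa [riem] using this

/-- The derivative of `F` at the origin is the inverse of `G'(0) = exp (Re H(0))`, by the choice of
the rotation. -/
theorem univ_deriv_zero (hσ : σ ∈ Ioo 1 m) :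
    ∃ r : ℝ, 0 < r ∧ deriv (CT (circ Φ u g) σ Φ) 0 = r := by
  obtain ⟨h0, h1, h2, h3, h4, h5, h6⟩ := W.radii
  have hz := W.nice_m.zero_mem_inside ⟨h3, h4⟩
  have e := W.univ_deriv_riem hu hσ hz
  have hd : deriv (riem Φ u g) 0 = Real.exp (CT Φ 1 (sol u g) 0).re := by
    have h1 : HasDerivAt (CT Φ 1 (sol u g)) _ 0 := (W.differentiableOn_CT_sol.differentiableAt
      ((W.nice_m.isOpen_inside ⟨h3, h4⟩).mem_nhds hz)).hasDerivAt
    have h2 : HasDerivAt (riem Φ u g) _ 0 :=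
      (hasDerivAt_id (0 : ℂ)).mul (h1.sub_const (rot Φ u g * Complex.I)).cexp
    rw [h2.deriv]
    simp only [id, zero_mul, one_mul, add_zero]
    rw [Complex.ofReal_exp]
    congr 1
    apply Complex.ext <;> simp [rot]
  have h00 : riem Φ u g 0 = 0 := by simp [riem]
  rw [hd, h00] at e
  refine ⟨(Real.exp (CT Φ 1 (sol u g) 0).re)⁻¹, by positivity, ?_⟩
  rw [Complex.ofReal_inv]
  exact eq_inv_of_mul_eq_one_left e

end

end WeldingSolution

/-! ### Existence of the decomposition, from a solution of the boundary value problem -/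

/-- A holomorphic function on a neighbourhood of the closed unit disk whose only zero there is a
simple zero at the origin has winding number one along the unit circle: it is `z k(z)` with `k` free
of zeros in the disk. -/
theorem wind_eq_one_of_simple_zero {F : ℂ → ℂ} {U : Set ℂ} (hU : IsOpen U)
    (hUd : Metric.closedBall 0 1 ⊆ U) (hF : DifferentiableOn ℂ F U) (h0 : F 0 = 0)
    (hd : deriv F 0 ≠ 0) (hne : ∀ z, ‖z‖ ≤ 1 → z ≠ 0 → F z ≠ 0) :
    CT F 1 (fun _ => 1) 0 = 1 := by
  have h0U : (0 : ℂ) ∈ U := hUd (by simp)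
  set k := dslope F 0 with hk
  have hkd : DifferentiableOn ℂ k U := (Complex.differentiableOn_dslope (hU.mem_nhds h0U)).2 hF
  have hk0 : ∀ z, ‖z‖ ≤ 1 → k z ≠ 0 := by
    intro z hz
    rcases eq_or_ne z 0 with rfl | h
    · rwa [hk, dslope_same]
    · rw [hk, dslope_of_ne _ h, slope_def_field, h0, sub_zero, sub_zero]
      exact div_ne_zero (hne z hz h) h
  have hmem : ∀ z : ℂ, ‖z‖ ≤ 1 → U ∈ 𝓝 z := fun z hz => hU.mem_nhds (hUd (by simpa using hz))
  have hFk : F = fun z => z * k z := by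
    funext z
    rcases eq_or_ne z 0 with rfl | h
    · simp [h0]
    · rw [hk, dslope_of_ne _ h, slope_def_field, h0, sub_zero, sub_zero]; field_simp
  have hq : ∀ z, ‖z‖ ≤ 1 → DifferentiableAt ℂ (fun z => deriv k z / k z) z := fun z hz =>
    ((hkd.deriv hU).differentiableAt (hmem z hz)).div (hkd.differentiableAt (hmem z hz)) (hk0 z hz)
  have e : CT F 1 (fun _ => 1) 0 = cint 1 (fun z => 1 / (z - 0) + deriv k z / k z) := by
    refine cint_congr zero_le_one fun z hz => ?_
    have hz0 : z ≠ 0 := norm_pos_iff.1 (by rw [hz]; exact one_pos)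
    have e1 : HasDerivAt F (1 * k z + z * deriv k z) z := by
      rw [hFk]
      exact (hasDerivAt_id z).mul (hkd.differentiableAt (hmem z hz.le)).hasDerivAt
    have h7 := hk0 z hz.le
    rw [e1.deriv, congrFun hFk z]
    field_simp
    ring
  have hS : ∀ z ∈ Metric.sphere (0 : ℂ) 1, ‖z‖ = 1 := fun z hz => by simpa using hz
  rw [e, cint_add zero_le_one, cint_eq_zero_of_disk zero_le_one hq, add_zero]
  · have := cint_cauchy_disk (σ := 1) (f := fun _ => 1) (z := 0)
      (fun z _ => differentiableAt_const _) (by simp)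
    simpa using this
  · refine continuousOn_const.div (continuousOn_id.sub continuousOn_const) fun z hz => ?_
    have : z ≠ 0 := norm_pos_iff.1 (by rw [hS z hz]; exact one_pos)
    simpa using this
  · exact fun z hz => (hq z (hS z hz).le).continuousAt.continuousWithinAt

namespace WeldingSolution

variable {m ρ R : ℝ} {Φ u g : ℂ → ℂ}

section
variable (W : WeldingSolution m ρ R Φ u g)
  (hu : ∀ z, ‖z‖ = 1 → (u z).re = -Real.log ‖Φ z‖)
include W hu

/-- The restriction of `D` to the circle, as a bijection. -/
def circEquiv : Circle ≃ Circle :=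
  Equiv.ofBijective
    (fun z => ⟨circ Φ u g z, mem_sphere_zero_iff_norm.2 (W.norm_circ hu (Circle.norm_coe z))⟩)
    ⟨fun z z' h => Subtype.ext ((W.circ_bijective hu).1 z.2 z'.2 (congrArg Subtype.val h)),
      fun w => by
        obtain ⟨z, hz, h⟩ := (W.circ_bijective hu).2 w (Circle.norm_coe w)
        exact ⟨⟨z, mem_sphere_zero_iff_norm.2 hz⟩, Subtype.ext h⟩⟩

theorem circEquiv_coe (z : Circle) : (W.circEquiv hu z : ℂ) = circ Φ u g z := rfl

/-- The inverse of `D` on the circle is the difference of two Cauchy integrals, along image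
curves of `D` outside and inside the unit circle. -/
theorem isRealAnalytic_circEquiv_symm :
    IsRealAnalytic fun z => ((W.circEquiv hu).symm z : ℂ) := by
  obtain ⟨h0, h1, h2, h3, h4, h5, h6⟩ := W.radii
  obtain ⟨a, ha, b, hb, N⟩ := W.exists_niceMap_circ hu
  obtain ⟨s, hs⟩ := exists_between ha.2
  obtain ⟨t, ht⟩ := exists_between hb.1
  set D := circ Φ u g with hD
  have hdm : ∀ τ ∈ Ioo a b, ∀ w, w ∉ D '' Metric.sphere 0 τ →
      DifferentiableAt ℂ (CT D τ fun z => z) w := fun τ hτ w hw =>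
    N.CT_differentiableAt hτ continuousOn_id hw
  have hs' : s ∈ Ioo a b := ⟨hs.1, hs.2.trans (hb.1)⟩
  have ht' : t ∈ Ioo a b := ⟨ha.2.trans ht.1, ht.2⟩
  have key := isRealAnalytic_restrict (F := fun w => CT D t (fun z => z) w - CT D s (fun z => z) w)
    (U := (D '' Metric.sphere 0 t)ᶜ ∩ (D '' Metric.sphere 0 s)ᶜ)
    ((N.isClosed_curve ht').isOpen_compl.inter (N.isClosed_curve hs').isOpen_compl) ?_ ?_
  · convert key using 2 with q
    obtain ⟨z, rfl⟩ := (W.circEquiv hu).surjective q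
    rw [Equiv.symm_apply_apply, W.circEquiv_coe hu]
    have hz := Circle.norm_coe z
    exact (CT_jump (f := fun z => z) N.pos.le N.diff N.inj differentiableOn_id hs.1 ht.2
      (N.deriv_ne z ⟨by rw [hz]; exact ha.2, by rw [hz]; exact hb.1⟩)
      (by rw [hz]; exact hs.2) (by rw [hz]; exact ht.1)).symm
  · intro z hz
    refine ⟨W.notMem_curve_circ hu ⟨ht.1, ht.2.trans hb.2⟩ hz.le, ?_⟩
    rintro ⟨x, hx, rfl⟩
    rw [mem_sphere_zero_iff_norm] at hx
    exact (W.norm_circ_lt_one hu ⟨hx ▸ ha.1.trans hs.1, hx ▸ hs.2⟩).ne hz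
  · exact fun w hw => ((hdm t ht' w hw.1).sub (hdm s hs' w hw.2)).differentiableWithinAt

/-- The circle diffeomorphism given by `D`. -/
def circDiff : DiffAn where
  toEquiv := W.circEquiv hu
  analytic := isRealAnalytic_restrict (isOpen_ann m⁻¹ m)
    (fun z hz => by
      obtain ⟨h0, h1, h2, h3, h4, h5, h6⟩ := W.radii
      exact ⟨by rw [hz]; exact h3, by rw [hz]; exact h4⟩) W.circ_differentiableOn
  analytic_symm := W.isRealAnalytic_circEquiv_symm hu
  orientation := by
    obtain ⟨h0, h1, h2, h3, h4, h5, h6⟩ := W.radii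
    refine (windingNumber_restrict (F := circ Φ u g) fun z hz => ?_).trans W.circ_wind
    exact W.circ_differentiableOn.differentiableAt ((isOpen_ann _ _).mem_nhds
      ⟨by rw [hz]; exact h3, by rw [hz]; exact h4⟩)

/-- A complex deformation `φ`, the restriction of `Φ`, is decomposed as `F ∘ D`. -/
theorem exists_isDecomposition (φ : DefC) (hφ : ∀ z : Circle, φ.1 z = Φ z) :
    ∃ (d : DiffAn) (v : UnivN), IsDecomposition φ d v ∧
      (∀ z : Circle, d.toOCircle z = circ Φ u g z) ∧
      ∀ σ ∈ Ioo 1 m, ∀ z : Circle, v.toOCircle z = CT (circ Φ u g) σ Φ z := by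
  obtain ⟨h0, h1, h2, h3, h4, h5, h6⟩ := W.radii
  obtain ⟨a, ha, b, hb, N⟩ := W.exists_niceMap_circ hu
  obtain ⟨σ, hσ⟩ := exists_between hb.1
  have hσm : σ ∈ Ioo 1 m := ⟨hσ.1, hσ.2.trans hb.2⟩
  set F := CT (circ Φ u g) σ Φ with hFdef
  set U := (circ Φ u g '' Metric.sphere 0 σ)ᶜ with hUdef
  have hU : IsOpen U := W.isOpen_compl_curve_circ ⟨h3.trans hσm.1, hσm.2⟩
  have hFU : DifferentiableOn ℂ F U := fun w hw =>
    (W.univ_differentiableAt hσm hw).differentiableWithinAt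
  have hU1 : ∀ z : ℂ, ‖z‖ ≤ 1 → z ∈ U := fun z hz => W.notMem_curve_circ hu hσm hz
  have hS : ∀ z : Circle, (z : ℂ) ∈ ann a σ := fun z =>
    ⟨by rw [Circle.norm_coe]; exact ha.2, by rw [Circle.norm_coe]; exact hσ.1⟩
  have hcomp : ∀ z : Circle, F (W.circEquiv hu z) = φ.1 z := fun z => by
    rw [W.circEquiv_coe hu, hφ]
    exact W.univ_comp_circ hu ha hb N hσ (hS z)
  have hcomp' : ∀ w : Circle, F w = φ.1 ((W.circEquiv hu).symm w) := fun w => by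
    rw [← hcomp, Equiv.apply_symm_apply]
  have hF0 : F 0 = 0 := W.univ_zero hu hσm
  obtain ⟨r, hr, hr'⟩ := W.univ_deriv_zero hu hσm
  have hd0 : deriv F 0 ≠ 0 := by
    rw [hr']; exact_mod_cast hr.ne'
  have hinj : InjOn F (Metric.ball 0 1) := W.univ_injOn hu hσm
  have hFne : ∀ z, ‖z‖ ≤ 1 → z ≠ 0 → F z ≠ 0 := by
    intro z hz hz0 h
    rcases hz.eq_or_lt with h7 | h7
    · have := hcomp' ⟨z, mem_sphere_zero_iff_norm.2 h7⟩
      exact φ.2.ne_zero _ (this.symm.trans h)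
    · exact hz0 (hinj (by simpa using h7) (by simp) (h.trans hF0.symm))
  -- The derivative of `F` does not vanish on the circle, by the chain rule for `F ∘ D = Φ`.
  have hdF : ∀ w : Circle, deriv F w ≠ 0 := by
    intro w
    obtain ⟨z, rfl⟩ := (W.circEquiv hu).surjective w
    have hz : (z : ℂ) ∈ ann m⁻¹ m := ann_mono ha.1.le hσm.2.le (hS z)
    have e1 := HasDerivAt.comp (h₂ := F) (z : ℂ)
      (hFU.differentiableAt (hU.mem_nhds (hU1 _ (W.norm_circ hu (Circle.norm_coe z)).le))).hasDerivAt
      (W.circ_differentiableOn.differentiableAt ((isOpen_ann _ _).mem_nhds hz)).hasDerivAt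
    have e2 : HasDerivAt (F ∘ circ Φ u g) (deriv Φ z) z := by
      refine (W.nice_m.differentiableAt hz).hasDerivAt.congr_of_eventuallyEq ?_
      filter_upwards [(isOpen_ann a σ).mem_nhds (hS z)] with x hx
      exact W.univ_comp_circ hu ha hb N hσ hx
    intro h
    rw [W.circEquiv_coe hu] at h
    have e3 := e1.unique e2
    rw [h, zero_mul] at e3
    exact W.nice_m.deriv_ne z hz e3.symm
  have hdef : IsComplexDeformation ⟨fun z => F z, isRealAnalytic_restrict hU
      (fun z hz => hU1 z hz.le) hFU⟩ :=
    { injective := fun w w' h => (W.circEquiv hu).symm.injective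
        (φ.2.injective ((hcomp' w).symm.trans (h.trans (hcomp' w'))))
      immersion := fun θ => by
        have := angDeriv_restrict (F := F) (θ := θ)
          (hFU.differentiableAt (hU.mem_nhds (hU1 _ (Circle.norm_coe _).le)))
        change angDeriv (fun z => F z) θ ≠ 0
        rw [this]
        exact mul_ne_zero (hdF _) (mul_ne_zero (Circle.coe_ne_zero _) Complex.I_ne_zero)
      ne_zero := fun z => hFne z (Circle.norm_coe z).le (Circle.coe_ne_zero z)
      winding := (windingNumber_restrict fun z hz =>
        hFU.differentiableAt (hU.mem_nhds (hU1 _ hz.le))).trans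
        (wind_eq_one_of_simple_zero hU (fun z hz => hU1 z (by simpa using hz)) hFU hF0 hd0 hFne) }
  refine ⟨W.circDiff hu, ⟨⟨_, hdef⟩, F, ?_, hinj, hF0, ⟨r, hr, hr'⟩, fun z => rfl⟩,
    fun z => (hcomp z).symm, fun z => rfl, fun τ hτ z => ?_⟩
  · intro z hz
    exact hFU.analyticAt (hU.mem_nhds (hU1 z (by simpa using hz)))
  · exact W.CT_circ_shift hu hσm hτ (Circle.norm_coe z).le

end

end WeldingSolution

/-! ### Uniqueness of the decomposition -/

section InjectiveHolomorphic

variable {F : ℂ → ℂ} {U : Set ℂ}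

/-- An injective function is not locally constant. -/
theorem not_eventually_eq_of_injOn (hU : IsOpen U) (hinj : InjOn F U) {z : ℂ} (hz : z ∈ U) :
    ¬∀ᶠ x in 𝓝 z, F x = F z := by
  intro h
  have h1 : ∀ᶠ x in 𝓝[≠] z, F x = F z ∧ x ∈ U ∧ x ≠ z := by
    filter_upwards [nhdsWithin_le_nhds h, nhdsWithin_le_nhds (hU.mem_nhds hz),
      self_mem_nhdsWithin] with x h1 h2 h3 using ⟨h1, h2, h3⟩
  obtain ⟨x, h1, h2, h3⟩ := h1.exists
  exact h3 (hinj h2 hz h1)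

theorem map_nhds_of_injOn (hU : IsOpen U) (hF : DifferentiableOn ℂ F U) (hinj : InjOn F U) {z : ℂ}
    (hz : z ∈ U) : map F (𝓝 z) = 𝓝 (F z) := by
  have ha := hF.analyticAt (hU.mem_nhds hz)
  refine le_antisymm ha.continuousAt ?_
  exact ha.eventually_constant_or_nhds_le_map_nhds.resolve_left
    (not_eventually_eq_of_injOn hU hinj hz)

theorem isOpen_image_of_injOn (hU : IsOpen U) (hF : DifferentiableOn ℂ F U) (hinj : InjOn F U) :
    IsOpen (F '' U) := by
  rw [isOpen_iff_mem_nhds]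
  rintro _ ⟨z, hz, rfl⟩
  rw [← map_nhds_of_injOn hU hF hinj hz]
  exact image_mem_map (hU.mem_nhds hz)

/-- The inverse of an injective holomorphic function is holomorphic. It is continuous by the open
mapping theorem, so the isolated zeros of the derivative give removable singularities. -/
theorem differentiableAt_invFunOn (hU : IsOpen U) (hF : DifferentiableOn ℂ F U) (hinj : InjOn F U)
    {z : ℂ} (hz : z ∈ U) : DifferentiableAt ℂ (Function.invFunOn F U) (F z) := by
  set E := Function.invFunOn F U with hE
  have hEF : ∀ x ∈ U, E (F x) = x := fun x hx => hinj.leftInvOn_invFunOn hx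
  have hopen := isOpen_image_of_injOn hU hF hinj
  have hcont : ∀ x ∈ U, Tendsto E (𝓝 (F x)) (𝓝 x) := by
    intro x hx
    rw [← map_nhds_of_injOn hU hF hinj hx, tendsto_map'_iff]
    refine tendsto_id.congr' ?_
    filter_upwards [hU.mem_nhds hx] with y hy using (hEF y hy).symm
  have hgood : ∀ x ∈ U, deriv F x ≠ 0 → DifferentiableAt ℂ E (F x) := by
    intro x hx hd
    have hFx : HasDerivAt F (deriv F x) (E (F x)) := by
      rw [hEF x hx]; exact (hF.differentiableAt (hU.mem_nhds hx)).hasDerivAt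
    refine (HasDerivAt.of_local_left_inverse ?_ hFx hd ?_).differentiableAt
    · rw [ContinuousAt, hEF x hx]; exact hcont x hx
    · filter_upwards [hopen.mem_nhds (mem_image_of_mem F hx)]
      rintro _ ⟨y, hy, rfl⟩
      rw [hEF y hy]
  have hda : AnalyticAt ℂ (deriv F) z := (hF.analyticAt (hU.mem_nhds hz)).deriv
  -- If `F'` vanished near `z`, then `F` would be constant there. So the zeros of `F'` are isolated.
  rcases hda.eventually_eq_zero_or_eventually_ne_zero with h0 | h0
  · exfalso
    obtain ⟨r, hr, hball⟩ := Metric.eventually_nhds_iff_ball.1 (h0.and (hU.mem_nhds hz))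
    refine not_eventually_eq_of_injOn hU hinj hz ?_
    filter_upwards [Metric.ball_mem_nhds z hr] with x hx
    exact Metric.isOpen_ball.is_const_of_deriv_eq_zero (convex_ball z r).isPreconnected
      (hF.mono fun y hy => (hball y hy).2) (fun y hy => (hball y hy).1) hx
      (Metric.mem_ball_self hr)
  · refine (Complex.analyticAt_of_differentiable_on_punctured_nhds_of_continuousAt ?_
      ?_).differentiableAt
    · have ht : Tendsto E (𝓝[≠] (F z)) (𝓝[≠] z) := by
        refine tendsto_nhdsWithin_of_tendsto_nhds_of_eventually_within _
          ((hcont z hz).mono_left nhdsWithin_le_nhds) ?_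
        filter_upwards [self_mem_nhdsWithin,
          nhdsWithin_le_nhds (hopen.mem_nhds (mem_image_of_mem F hz))]
        rintro _ hne ⟨y, hy, rfl⟩
        rw [hEF y hy]
        rintro rfl
        exact hne rfl
      filter_upwards [ht.eventually h0,
        nhdsWithin_le_nhds (hopen.mem_nhds (mem_image_of_mem F hz))]
      rintro _ hne ⟨y, hy, rfl⟩
      rw [hEF y hy] at hne
      exact hgood y hy hne
    · rw [ContinuousAt, hEF z hz]; exact hcont z hz

end InjectiveHolomorphic

/-- The normalized univalent functions on the closed unit disk. -/
structure NormalizedUnivalent (F : ℂ → ℂ) : Prop where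
  analytic : AnalyticOnNhd ℂ F (Metric.closedBall 0 1)
  injOn : InjOn F (Metric.ball 0 1)
  map_zero : F 0 = 0
  deriv_pos : ∃ r : ℝ, 0 < r ∧ deriv F 0 = r

namespace NormalizedUnivalent

variable {F F₁ F₂ : ℂ → ℂ}

theorem differentiableOn (h : NormalizedUnivalent F) : DifferentiableOn ℂ F (Metric.ball 0 1) :=
  fun _ hz => (h.analytic _ (Metric.ball_subset_closedBall hz)).differentiableAt.differentiableWithinAt

/-- Boundary values are not attained inside the disk. -/
theorem disjoint_sphere (h : NormalizedUnivalent F) {z : ℂ} (hz : z ∈ Metric.sphere (0 : ℂ) 1) :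
    F z ∉ F '' Metric.ball 0 1 := by
  rintro ⟨b, hb, hbz⟩
  have hzb : z ≠ b := by
    rintro rfl
    simp at hb hz
    linarith
  obtain ⟨V, W, hV, hW, hzV, hbW, hVW⟩ := t2_separation hzb
  have h1 : F '' (W ∩ Metric.ball 0 1) ∈ 𝓝 (F z) := by
    rw [← hbz, ← map_nhds_of_injOn Metric.isOpen_ball h.differentiableOn h.injOn hb]
    exact image_mem_map ((hW.inter Metric.isOpen_ball).mem_nhds ⟨hbW, hb⟩)
  have hc := (h.analytic z (Metric.sphere_subset_closedBall hz)).continuousAt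
  have hcl : z ∈ closure (Metric.ball (0 : ℂ) 1) := by
    rw [closure_ball _ one_ne_zero]; exact Metric.sphere_subset_closedBall hz
  obtain ⟨x, hx, ⟨y, ⟨hy1, hy2⟩, hyx⟩, hxV⟩ := ((mem_closure_iff_frequently.1 hcl).and_eventually
    ((hc.eventually h1).and (hV.mem_nhds hzV))).exists
  have := h.injOn hy2 hx hyx
  subst this
  exact disjoint_left.1 hVW hxV hy1

/-- The image of the disk is the component of `0` in the complement of the boundary values. -/
theorem image_ball_subset (h₁ : NormalizedUnivalent F₁) (h₂ : NormalizedUnivalent F₂)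
    (hS : F₁ '' Metric.sphere 0 1 = F₂ '' Metric.sphere 0 1) :
    F₂ '' Metric.ball 0 1 ⊆ F₁ '' Metric.ball 0 1 := by
  refine ((convex_ball (0 : ℂ) 1).isPreconnected.image F₂
    h₂.differentiableOn.continuousOn).subset_of_closure_inter_subset
    (isOpen_image_of_injOn Metric.isOpen_ball h₁.differentiableOn h₁.injOn) ?_ ?_
  · exact ⟨0, ⟨0, by simp, h₂.map_zero⟩, ⟨0, by simp, h₁.map_zero⟩⟩
  · rintro w ⟨hw, b, hb, rfl⟩
    have hcl : closure (F₁ '' Metric.ball 0 1) ⊆ F₁ '' Metric.closedBall 0 1 :=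
      closure_minimal (image_mono Metric.ball_subset_closedBall)
        ((isCompact_closedBall (0 : ℂ) 1).image_of_continuousOn
          h₁.analytic.continuousOn).isClosed
    obtain ⟨z, hz, hzb⟩ := hcl hw
    rcases (mem_closedBall_zero_iff.1 hz).eq_or_lt with h7 | h7
    · have : F₂ b ∈ F₁ '' Metric.sphere 0 1 := ⟨z, by simpa using h7, hzb⟩
      rw [hS] at this
      obtain ⟨x, hx, hxb⟩ := this
      exact absurd ⟨b, hb, hxb.symm⟩ (h₂.disjoint_sphere hx)
    · exact ⟨z, by simpa using h7, hzb⟩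

/-- The transition function `F₁⁻¹ ∘ F₂` between two normalized univalent functions with the same
boundary curve, and its derivative at the origin. -/
theorem transition (h₁ : NormalizedUnivalent F₁) (h₂ : NormalizedUnivalent F₂)
    (hS : F₁ '' Metric.sphere 0 1 = F₂ '' Metric.sphere 0 1) :
    ∃ h : ℂ → ℂ, DifferentiableOn ℂ h (Metric.ball 0 1) ∧
      MapsTo h (Metric.ball 0 1) (Metric.ball 0 1) ∧ h 0 = 0 ∧
      (∀ z ∈ Metric.ball (0 : ℂ) 1, F₁ (h z) = F₂ z) ∧ deriv F₁ 0 * deriv h 0 = deriv F₂ 0 := by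
  set E := Function.invFunOn F₁ (Metric.ball 0 1) with hE
  have hsub := h₁.image_ball_subset h₂ hS
  have h0 : E (F₂ 0) = 0 := by
    have h7 : E (F₁ 0) = 0 := h₁.injOn.leftInvOn_invFunOn (Metric.mem_ball_self one_pos)
    rw [h₂.map_zero]
    rwa [h₁.map_zero] at h7
  have hEd : ∀ z ∈ Metric.ball (0 : ℂ) 1, DifferentiableAt ℂ (E ∘ F₂) z := by
    intro z hz
    obtain ⟨b, hb, hbz⟩ := hsub ⟨z, hz, rfl⟩
    refine DifferentiableAt.comp z ?_
      (h₂.differentiableOn.differentiableAt (Metric.isOpen_ball.mem_nhds hz))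
    rw [← hbz]
    exact differentiableAt_invFunOn Metric.isOpen_ball h₁.differentiableOn h₁.injOn hb
  have hFE : ∀ z ∈ Metric.ball (0 : ℂ) 1, F₁ ((E ∘ F₂) z) = F₂ z := fun z hz =>
    Function.invFunOn_eq (hsub ⟨z, hz, rfl⟩)
  refine ⟨E ∘ F₂, fun z hz => (hEd z hz).differentiableWithinAt,
    fun z hz => Function.invFunOn_mem (hsub ⟨z, hz, rfl⟩), h0, hFE, ?_⟩
  have hm : (0 : ℂ) ∈ Metric.ball (0 : ℂ) 1 := by simp
  have e1 : HasDerivAt F₁ (deriv F₁ 0) ((E ∘ F₂) 0) := by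
    rw [Function.comp_apply, h0]
    exact (h₁.differentiableOn.differentiableAt (Metric.isOpen_ball.mem_nhds hm)).hasDerivAt
  have e2 := HasDerivAt.comp (h₂ := F₁) (0 : ℂ) e1 (hEd 0 hm).hasDerivAt
  refine (e2.congr_of_eventuallyEq ?_).deriv.symm
  filter_upwards [Metric.isOpen_ball.mem_nhds hm] with z hz using (hFE z hz).symm

/-- The Schwarz lemma for the transition function. -/
theorem deriv_le (h₁ : NormalizedUnivalent F₁) (h₂ : NormalizedUnivalent F₂)
    (hS : F₁ '' Metric.sphere 0 1 = F₂ '' Metric.sphere 0 1) :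
    ‖deriv F₂ 0‖ ≤ ‖deriv F₁ 0‖ := by
  obtain ⟨h, hd, hm, h0, -, hder⟩ := h₁.transition h₂ hS
  have := Complex.norm_deriv_le_one_of_mapsTo_ball hd
    (by rw [h0]; exact fun z hz => Metric.ball_subset_closedBall (hm hz)) one_pos
  rw [← hder, norm_mul]
  exact mul_le_of_le_one_right (norm_nonneg _) this

/-- A normalized univalent function is determined by its boundary curve, by the Schwarz lemma. -/
theorem eqOn (h₁ : NormalizedUnivalent F₁) (h₂ : NormalizedUnivalent F₂)
    (hS : F₁ '' Metric.sphere 0 1 = F₂ '' Metric.sphere 0 1) :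
    EqOn F₁ F₂ (Metric.closedBall 0 1) := by
  obtain ⟨h, hd, hm, h0, hF, hder⟩ := h₁.transition h₂ hS
  obtain ⟨r₁, hr₁, e₁⟩ := h₁.deriv_pos
  obtain ⟨r₂, hr₂, e₂⟩ := h₂.deriv_pos
  have l1 := h₁.deriv_le h₂ hS
  have l2 := h₂.deriv_le h₁ hS.symm
  rw [e₁, e₂] at l1 l2 hder
  simp only [Complex.norm_real, Real.norm_eq_abs, abs_of_pos hr₁, abs_of_pos hr₂] at l1 l2
  have hr : r₁ = r₂ := le_antisymm l2 l1
  have hh : deriv h 0 = 1 := by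
    rw [← hr] at hder
    have : (r₁ : ℂ) ≠ 0 := by exact_mod_cast hr₁.ne'
    exact mul_left_cancel₀ this (hder.trans (mul_one _).symm)
  -- By symmetry both derivatives at the origin agree, so the transition function is the identity by
  -- the case of equality in the Schwarz lemma.
  have haff := Complex.affine_of_mapsTo_ball_of_norm_dslope_eq_div hd (R₂ := 1)
    (by rw [h0]; exact fun z hz => Metric.ball_subset_closedBall (hm hz))
    (z₀ := 0) (by simp) (by rw [dslope_same, hh]; simp)
  have hball : EqOn F₁ F₂ (Metric.ball 0 1) := by
    intro z hz
    have := haff hz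
    simp only [h0, dslope_same, hh, sub_zero, smul_eq_mul, mul_one, zero_add] at this
    rw [← hF z hz, this]
  rw [← closure_ball (0 : ℂ) one_ne_zero]
  refine hball.of_subset_closure ?_ ?_ subset_closure subset_rfl
  · rw [closure_ball (0 : ℂ) one_ne_zero]; exact h₁.analytic.continuousOn
  · rw [closure_ball (0 : ℂ) one_ne_zero]; exact h₂.analytic.continuousOn

end NormalizedUnivalent

theorem UnivN.exists_normalizedUnivalent (v : UnivN) :
    ∃ F, NormalizedUnivalent F ∧ ∀ z : Circle, F z = v.toOCircle z := by
  obtain ⟨F, h1, h2, h3, h4, h5⟩ := v.2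
  exact ⟨F, ⟨h1, h2, h3, h4⟩, h5⟩

theorem OCircle.ext {f g : OCircle} (h : ∀ z, f z = g z) : f = g := Subtype.ext (funext h)

theorem UnivN.toOCircle_injective : Function.Injective UnivN.toOCircle := fun _ _ h =>
  Subtype.ext (Subtype.ext h)

theorem DiffAn.toOCircle_injective : Function.Injective DiffAn.toOCircle := by
  intro d d' h
  have : d.toEquiv = d'.toEquiv := by
    ext z
    exact congrArg (fun f : OCircle => f z) h
  cases d; cases d'; simp_all

/-- The boundary curve of the univalent factor is the image of `φ`. -/
theorem IsDecomposition.image_sphere {φ : DefC} {d : DiffAn} {v : UnivN}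
    (h : IsDecomposition φ d v) {F : ℂ → ℂ} (hF : ∀ z : Circle, F z = v.toOCircle z) :
    F '' Metric.sphere 0 1 = range φ.1 := by
  ext w
  constructor
  · rintro ⟨z, hz, rfl⟩
    have e : d.toEquiv (d.toEquiv.symm ⟨z, hz⟩) = ⟨z, hz⟩ := Equiv.apply_symm_apply _ _
    exact ⟨d.toEquiv.symm ⟨z, hz⟩,
      (h _).trans ((congrArg (fun w => v.toOCircle w) e).trans (hF ⟨z, hz⟩).symm)⟩
  · rintro ⟨z, rfl⟩
    exact ⟨d.toEquiv z, (d.toEquiv z).2, by rw [hF, ← h]⟩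

/-- The univalent factor is determined by its boundary curve, and the other factor by the
injectivity of the univalent one. -/
theorem IsDecomposition.unique {φ : DefC} {d d' : DiffAn} {v v' : UnivN}
    (h : IsDecomposition φ d v) (h' : IsDecomposition φ d' v') : d = d' ∧ v = v' := by
  obtain ⟨F, hF, hFv⟩ := v.exists_normalizedUnivalent
  obtain ⟨F', hF', hFv'⟩ := v'.exists_normalizedUnivalent
  have hv : v = v' := by
    refine UnivN.toOCircle_injective (OCircle.ext fun z => ?_)
    rw [← hFv, ← hFv']
    exact hF.eqOn hF' ((h.image_sphere hFv).trans (h'.image_sphere hFv').symm)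
      (Metric.sphere_subset_closedBall z.2)
  refine ⟨DiffAn.toOCircle_injective (OCircle.ext fun z => ?_), hv⟩
  subst hv
  exact congrArg Subtype.val (v.1.2.injective ((h z).symm.trans (h' z)))

/-! ### Integral operators on continuous functions on the circle -/

/-- The mean value of a continuous function on the circle. -/
def circleMean : C(Circle, ℂ) →L[ℂ] ℂ :=
  LinearMap.mkContinuous
    { toFun := fun f => (2 * Real.pi : ℂ)⁻¹ * ∫ θ in (0 : ℝ)..2 * Real.pi, f (Circle.exp θ)
      map_add' := fun f g => by
        have hf : Continuous fun θ : ℝ => f (Circle.exp θ) := f.continuous.comp Circle.exp.continuous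
        have hg : Continuous fun θ : ℝ => g (Circle.exp θ) := g.continuous.comp Circle.exp.continuous
        rw [← mul_add, ← intervalIntegral.integral_add (hf.intervalIntegrable _ _)
          (hg.intervalIntegrable _ _)]
        rfl
      map_smul' := fun c f => by
        simp only [ContinuousMap.coe_smul, Pi.smul_apply, smul_eq_mul, RingHom.id_apply]
        rw [intervalIntegral.integral_const_mul]
        ring } 1 fun f => by
    have hpi := Real.pi_pos
    have h := intervalIntegral.norm_integral_le_of_norm_le_const (a := 0) (b := 2 * Real.pi)
      (f := fun θ : ℝ => f (Circle.exp θ)) (C := ‖f‖) fun θ _ => f.norm_coe_le_norm _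
    rw [sub_zero, abs_of_pos (by positivity)] at h
    change ‖(2 * Real.pi : ℂ)⁻¹ * ∫ θ in (0 : ℝ)..2 * Real.pi, f (Circle.exp θ)‖ ≤ 1 * ‖f‖
    have h2 : ‖(2 * Real.pi : ℂ)‖ = 2 * Real.pi := by simp [abs_of_pos hpi]
    rw [norm_mul, norm_inv, h2, one_mul, inv_mul_le_iff₀ (by positivity)]
    linarith

theorem circleMean_apply (f : C(Circle, ℂ)) :
    circleMean f = (2 * Real.pi : ℂ)⁻¹ * ∫ θ in (0 : ℝ)..2 * Real.pi, f (Circle.exp θ) := rfl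

theorem norm_circleMean_le (f : C(Circle, ℂ)) : ‖circleMean f‖ ≤ ‖f‖ := by
  simpa using circleMean.le_of_opNorm_le (LinearMap.mkContinuous_norm_le _ zero_le_one _) f

theorem circleMap_eq_mul_exp (σ θ : ℝ) : circleMap 0 σ θ = σ * (Circle.exp θ : ℂ) := by
  simp [circleMap, Circle.coe_exp]

/-- Contour integrals over circles around the origin as mean values. -/
theorem cint_eq_circleMean {σ : ℝ} {F : ℂ → ℂ} (h : C(Circle, ℂ))
    (hF : ∀ ζ : Circle, h ζ = σ * ζ * F (σ * ζ)) : cint σ F = circleMean h := by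
  rw [cint_eq_average, circleMean_apply]
  simp only [hF, circleMap_eq_mul_exp]

/-- Complex bilinear operations on `C^k` curves with real parameter give `C^k` curves. -/
theorem contDiffAt_bilinear {E F G : Type*} [NormedAddCommGroup E] [NormedSpace ℂ E]
    [NormedAddCommGroup F] [NormedSpace ℂ F] [NormedAddCommGroup G] [NormedSpace ℂ G]
    (B : E →L[ℂ] F →L[ℂ] G) {k : ℕ} {t₀ : ℝ} {e : ℝ → E} {f : ℝ → F}
    (he : ContDiffAt ℝ k e t₀) (hf : ContDiffAt ℝ k f t₀) :
    ContDiffAt ℝ k (fun t => B (e t) (f t)) t₀ :=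
  (B.bilinearRestrictScalars ℝ).isBoundedBilinearMap.contDiff.contDiffAt.comp t₀ (he.prodMk hf)

section KernelOperator

variable {X : Type*} [TopologicalSpace X] [CompactSpace X]

/-- The integral operator with kernel `κ`: `(K f)(x)` is the mean value of `ζ ↦ κ (x, ζ) f ζ`. -/
def kernelOp : C(X × Circle, ℂ) →L[ℂ] C(Circle, ℂ) →L[ℂ] C(X, ℂ) :=
  LinearMap.mkContinuous₂
    (LinearMap.mk₂ ℂ (fun κ f => (⟨fun x => circleMean (κ.curry x * f),
        circleMean.continuous.comp (κ.curry.continuous.mul continuous_const)⟩ : C(X, ℂ)))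
      (fun κ κ' f => by
        ext x
        have : (κ + κ').curry x = κ.curry x + κ'.curry x := rfl
        simp only [ContinuousMap.coe_mk, ContinuousMap.add_apply, this, add_mul, map_add])
      (fun c κ f => by
        ext x
        have : (c • κ).curry x = c • κ.curry x := rfl
        simp only [ContinuousMap.coe_mk, ContinuousMap.smul_apply, this, smul_mul_assoc, map_smul])
      (fun κ f f' => by
        ext x
        simp only [ContinuousMap.coe_mk, ContinuousMap.add_apply, mul_add, map_add])
      (fun c κ f => by
        ext x
        simp only [ContinuousMap.coe_mk, ContinuousMap.smul_apply, mul_smul_comm, map_smul])) 1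
    fun κ f => by
      rw [one_mul]
      refine (ContinuousMap.norm_le _ (by positivity)).2 fun x => ?_
      refine (norm_circleMean_le _).trans ((norm_mul_le _ _).trans ?_)
      gcongr
      exact (ContinuousMap.norm_le _ (norm_nonneg _)).2 fun ζ => κ.norm_coe_le_norm (x, ζ)

theorem kernelOp_apply (κ : C(X × Circle, ℂ)) (f : C(Circle, ℂ)) (x : X) :
    kernelOp κ f x = circleMean (κ.curry x * f) := rfl

/-- Values of an integral operator as contour integrals. -/
theorem kernelOp_eq_cint {σ : ℝ} {F : ℂ → ℂ} (κ : C(X × Circle, ℂ)) (f : C(Circle, ℂ)) (x : X)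
    (hF : ∀ ζ : Circle, κ (x, ζ) * f ζ = σ * ζ * F (σ * ζ)) : kernelOp κ f x = cint σ F :=
  (cint_eq_circleMean _ hF).symm

theorem contDiffAt_kernelOp {k : ℕ} {t₀ : ℝ} {κ : ℝ → C(X × Circle, ℂ)} {f : ℝ → C(Circle, ℂ)}
    (hκ : ContDiffAt ℝ k κ t₀) (hf : ContDiffAt ℝ k f t₀) :
    ContDiffAt ℝ k (fun t => kernelOp (κ t) (f t)) t₀ :=
  contDiffAt_bilinear kernelOp hκ hf

end KernelOperator

/-- An integral operator whose kernel is a product is of rank one. -/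
theorem isCompactOperator_kernelOp_mul (a b : C(Circle, ℂ)) :
    IsCompactOperator (kernelOp (a.comp ContinuousMap.fst * b.comp ContinuousMap.snd :
      C(Circle × Circle, ℂ))) := by
  have e : (kernelOp (a.comp ContinuousMap.fst * b.comp ContinuousMap.snd : C(Circle × Circle, ℂ)) :
      C(Circle, ℂ) → C(Circle, ℂ)) =
      (ContinuousLinearMap.toSpanSingleton ℂ a) ∘
        (id : ℂ → ℂ) ∘ (circleMean ∘L ContinuousLinearMap.mul ℂ C(Circle, ℂ) b) := by
    funext f
    ext x
    have h : (a.comp ContinuousMap.fst * b.comp ContinuousMap.snd : C(Circle × Circle, ℂ)).curry x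
        = a x • b := rfl
    rw [kernelOp_apply, h, smul_mul_assoc, map_smul]
    simp [mul_comm]
  rw [e]
  have hid : IsCompactOperator (id : ℂ → ℂ) :=
    ⟨Metric.closedBall 0 1, isCompact_closedBall 0 1, by
      simpa using Metric.closedBall_mem_nhds (0 : ℂ) one_pos⟩
  exact (hid.comp_clm _).clm_comp _

/-- The coordinate function on the circle. -/
def circleCoe : C(Circle, ℂ) := ⟨fun z => z, continuous_subtype_val⟩

@[simp] theorem circleCoe_apply (z : Circle) : circleCoe z = z := rfl

/-- The integral operator with kernel the limit of a geometric series in `ζ / z` is compact. -/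
theorem isCompactOperator_kernelOp_geometric {q : ℝ} (hq0 : 0 ≤ q) (hq : q < 1)
    (κ : C(Circle × Circle, ℂ)) (hκ : ∀ z ζ : Circle, κ (z, ζ) = (1 - q * ((z⁻¹ : Circle) : ℂ) * ζ)⁻¹) :
    IsCompactOperator (kernelOp κ) := by
  set s : ℕ → C(Circle × Circle, ℂ) := fun n =>
    ((q : ℂ) ^ n • (star circleCoe) ^ n).comp ContinuousMap.fst *
      (circleCoe ^ n).comp ContinuousMap.snd with hs
  have hsa : ∀ n (p : Circle × Circle), s n p = (q * ((p.1⁻¹ : Circle) : ℂ) * p.2) ^ n := by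
    intro n p
    simp only [hs, mul_pow, Circle.coe_inv_eq_conj]
    simp [mul_assoc]
  have hsn : ∀ n, ‖s n‖ ≤ q ^ n := fun n =>
    (ContinuousMap.norm_le _ (by positivity)).2 fun p => by
      rw [hsa, norm_pow, norm_mul, norm_mul, Circle.norm_coe, Circle.norm_coe]
      simp [abs_of_nonneg hq0]
  have hsum : Summable s :=
    Summable.of_norm_bounded (summable_geometric_of_lt_one hq0 hq) hsn
  have hκs : HasSum s κ := by
    have h1 : ∑' n, s n = κ := by
      ext p
      have h2 := (hsum.hasSum.mapL (ContinuousMap.evalCLM ℂ p)).tsum_eq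
      simp only [ContinuousMap.evalCLM_apply, hsa] at h2
      rw [← h2, tsum_geometric_of_norm_lt_one, ← hκ]
      rw [norm_mul, norm_mul, Circle.norm_coe, Circle.norm_coe]
      simpa [abs_of_nonneg hq0] using hq
    exact h1 ▸ hsum.hasSum
  have hlim := (hκs.mapL (kernelOp (X := Circle))).tendsto_sum_nat
  refine isCompactOperator_of_tendsto hlim (Eventually.of_forall fun n => ?_)
  induction n with
  | zero => simpa using isCompactOperator_zero
  | succ n ih =>
    rw [Finset.sum_range_succ]
    exact ih.add (isCompactOperator_kernelOp_mul _ _)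

/-! ### Real-analytic functions on the circle as restrictions of holomorphic functions -/

/-- A real-analytic function on the circle extends holomorphically near each point: its power series
in the angle also converges at complex angles. -/
theorem OCircle.exists_local_extension (f : OCircle) (z₀ : Circle) :
    ∃ r > 0, ∃ F : ℂ → ℂ, DifferentiableOn ℂ F (Metric.ball z₀ r) ∧
      ∀ z : Circle, (z : ℂ) ∈ Metric.ball (z₀ : ℂ) r → F z = f z := by
  set θ₀ := Complex.arg z₀
  have hθ₀ : Circle.exp θ₀ = z₀ := Circle.exp_arg z₀
  obtain ⟨p, hp⟩ := f.2 θ₀ (mem_univ _)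
  obtain ⟨ε, hε, hsum⟩ := Metric.eventually_nhds_iff.1 (hasFPowerSeriesAt_iff.1 hp)
  set s := ε / 2 with hs
  have hs0 : 0 < s := by positivity
  have hs1 := (hsum (y := s) (by simp [abs_of_pos hs0]; linarith)).summable.tendsto_atTop_zero
  obtain ⟨C, hC⟩ := hs1.norm.bddAbove_range
  have hC' : ∀ n, s ^ n * ‖p.coeff n‖ ≤ C := by
    intro n
    have := hC ⟨n, rfl⟩
    simpa [norm_smul, abs_of_pos hs0] using this
  -- The power series of `θ ↦ f (e^{i θ})` at `θ₀`, with complex argument.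
  set H : ℂ → ℂ := fun w => ∑' n, w ^ n * p.coeff n with hH
  have hHd : DifferentiableOn ℂ H (Metric.ball 0 (s / 2)) := by
    refine Complex.differentiableOn_tsum_of_summable_norm (u := fun n => C * (1 / 2) ^ n)
      (summable_geometric_two.mul_left C) (fun n => by fun_prop) Metric.isOpen_ball
      fun n w hw => ?_
    have hw' : ‖w‖ ≤ s * (1 / 2) := by
      have := mem_ball_zero_iff.1 hw
      linarith
    rw [norm_mul, norm_pow]
    calc ‖w‖ ^ n * ‖p.coeff n‖ ≤ (s * (1 / 2)) ^ n * ‖p.coeff n‖ := by gcongr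
      _ = (s ^ n * ‖p.coeff n‖) * (1 / 2) ^ n := by rw [mul_pow]; ring
      _ ≤ C * (1 / 2) ^ n := by gcongr; exact hC' n
  have hHr : ∀ x : ℝ, |x| < s / 2 → H x = f (Circle.exp (θ₀ + x)) := by
    intro x hx
    have := (hsum (y := x) (by simp; linarith)).tsum_eq
    rw [← this, hH]
    simp [Complex.real_smul]
  have hz₀ : (z₀ : ℂ) ≠ 0 := Circle.coe_ne_zero z₀
  have hdiv : ContinuousAt (fun z : ℂ => z / z₀) z₀ := by fun_prop (disch := assumption)
  have h1 : ∀ᶠ z : ℂ in 𝓝 (z₀ : ℂ), z / (z₀ : ℂ) ∈ Complex.slitPlane :=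
    hdiv.eventually_mem (Complex.isOpen_slitPlane.mem_nhds (by rw [div_self hz₀]; simp))
  have h2 : ∀ᶠ z : ℂ in 𝓝 (z₀ : ℂ), ‖Complex.log (z / z₀)‖ < s / 2 := by
    have hc : ContinuousAt (fun z : ℂ => ‖Complex.log (z / z₀)‖) z₀ :=
      (hdiv.clog (by rw [div_self hz₀]; simp)).norm
    refine hc.eventually_lt continuousAt_const ?_
    simp; positivity
  obtain ⟨r, hr, hball⟩ := Metric.eventually_nhds_iff_ball.1 (h1.and h2)
  -- The angle from `z₀` to `z` is `-i log (z / z₀)`.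
  refine ⟨r, hr, fun z => H (-Complex.I * Complex.log (z / z₀)), ?_, ?_⟩
  · refine hHd.comp ?_ fun z hz => ?_
    · intro z hz
      have : z / z₀ ∈ Complex.slitPlane := (hball z hz).1
      exact (((differentiableAt_id.div_const _).clog this).const_mul _).differentiableWithinAt
    · simpa using (hball z hz).2
  · intro z hz
    set x := Complex.arg ((z : ℂ) / z₀) with hx
    have hn : ‖(z : ℂ) / z₀‖ = 1 := by
      rw [norm_div, Circle.norm_coe, Circle.norm_coe, div_one]
    have hlog : Complex.log ((z : ℂ) / z₀) = x * Complex.I := by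
      rw [Complex.log, hn]; simp [hx]
    have h3 := (hball z hz).2
    rw [hlog] at h3
    have h4 : -Complex.I * (x * Complex.I) = (x : ℂ) := by
      linear_combination (-(x : ℂ)) * Complex.I_mul_I
    simp only [hlog, h4]
    rw [hHr x (by simpa using h3), Circle.exp_add, hθ₀]
    have h5 : Circle.exp x = z / z₀ := by
      rw [hx, ← Circle.coe_div]; exact Circle.exp_arg _
    rw [h5, mul_div_cancel]

/-- A real-analytic function on the circle extends to an annulus. The local extensions fit together:
for two balls around points of the circle whose thirds overlap, the third of the smaller ball is
contained in the larger one, and there the extensions agree by the identity theorem. -/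
theorem OCircle.exists_extension (f : OCircle) :
    ∃ m, ∃ F : ℂ → ℂ, DifferentiableOn ℂ F (annulus m) ∧ ∀ z : Circle, F z = f z := by
  choose r hr F hF hFf using f.exists_local_extension
  have agree : ∀ z₀ z₁ : Circle, ∀ z, r z₁ ≤ r z₀ → z ∈ Metric.ball (z₀ : ℂ) (r z₀ / 3) →
      z ∈ Metric.ball (z₁ : ℂ) (r z₁ / 3) → F z₀ z = F z₁ z := by
    intro z₀ z₁ z hle h0 h1
    have hr1 := hr z₁
    have hsub1 : Metric.ball (z₁ : ℂ) (r z₁ / 3) ⊆ Metric.ball z₁ (r z₁) :=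
      Metric.ball_subset_ball (by linarith)
    have hsub0 : Metric.ball (z₁ : ℂ) (r z₁ / 3) ⊆ Metric.ball z₀ (r z₀) := by
      intro x hx
      rw [Metric.mem_ball] at *
      have e1 := dist_triangle x z₁ z₀
      have e2 := dist_triangle (z₁ : ℂ) z z₀
      rw [dist_comm (z₁ : ℂ) z] at e2
      linarith
    refine ((hF z₀).mono hsub0 |>.analyticOnNhd
      Metric.isOpen_ball).eqOn_of_preconnected_of_frequently_eq
      ((hF z₁).mono hsub1 |>.analyticOnNhd Metric.isOpen_ball)
      (convex_ball _ _).isPreconnected (Metric.mem_ball_self (by linarith))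
      (frequently_punctured_of_circle (Circle.norm_coe z₁) ?_) h1
    filter_upwards [Metric.ball_mem_nhds (z₁ : ℂ) (by linarith : 0 < r z₁ / 3)] with x hx hx1
    have e0 := hFf z₀ ⟨x, mem_sphere_zero_iff_norm.2 hx1⟩ (hsub0 hx)
    have e1 := hFf z₁ ⟨x, mem_sphere_zero_iff_norm.2 hx1⟩ (hsub1 hx)
    exact e0.trans e1.symm
  have agree' : ∀ z₀ z₁ : Circle, ∀ z, z ∈ Metric.ball (z₀ : ℂ) (r z₀ / 3) →
      z ∈ Metric.ball (z₁ : ℂ) (r z₁ / 3) → F z₀ z = F z₁ z := fun z₀ z₁ z h0 h1 =>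
    (le_total (r z₁) (r z₀)).elim (fun h => agree z₀ z₁ z h h0 h1)
      (fun h => (agree z₁ z₀ z h h1 h0).symm)
  classical
  -- The extension is given at `z` by any local extension with `z` in the third of its ball.
  set G : ℂ → ℂ := fun z => if h : ∃ z₀ : Circle, z ∈ Metric.ball (z₀ : ℂ) (r z₀ / 3) then
    F h.choose z else 0 with hG
  have hGF : ∀ z₁ : Circle, ∀ z ∈ Metric.ball (z₁ : ℂ) (r z₁ / 3), G z = F z₁ z := by
    intro z₁ z hz
    have h : ∃ z₀ : Circle, z ∈ Metric.ball (z₀ : ℂ) (r z₀ / 3) := ⟨z₁, hz⟩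
    simp only [hG, dif_pos h]
    exact agree' _ _ _ h.choose_spec hz
  have hU : IsOpen (⋃ z₀ : Circle, Metric.ball (z₀ : ℂ) (r z₀ / 3)) :=
    isOpen_iUnion fun _ => Metric.isOpen_ball
  obtain ⟨δ, hδ, h⟩ := exists_ann_subset_of_isOpen hU one_pos fun z hz =>
    mem_iUnion.2 ⟨⟨z, hz⟩, Metric.mem_ball_self (by linarith [hr ⟨z, hz⟩])⟩
  obtain ⟨m, hm⟩ := exists_nat_one_div_lt hδ
  refine ⟨m, G, fun z hz => ?_, fun z => ?_⟩
  · obtain ⟨z₁, hz₁⟩ := mem_iUnion.1 (h z (abs_lt.2 ⟨by linarith [hz.1], by linarith [hz.2]⟩))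
    have hn := Metric.isOpen_ball.mem_nhds hz₁
    refine ((((hF z₁).mono (Metric.ball_subset_ball (by linarith [hr z₁]))).differentiableAt
      hn).congr_of_eventuallyEq ?_).differentiableWithinAt
    filter_upwards [hn] with x hx using hGF z₁ x hx
  · rw [hGF z z (Metric.mem_ball_self (by linarith [hr z]))]
    exact hFf z z (Metric.mem_ball_self (hr z))

/-- A holomorphic function on an annulus, as an element of `OAnnulus m`. -/
def OAnnulus.of (m : ℕ) (F : ℂ → ℂ) (hF : DifferentiableOn ℂ F (annulus m)) : OAnnulus m :=
  ⟨⟨fun z => F z, hF.continuousOn.domRestrict⟩, F, hF, fun _ => rfl⟩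

theorem exists_restrictCircle (f : OCircle) : ∃ m, ∃ F : OAnnulus m, restrictCircle m F = f := by
  obtain ⟨m, F, hF, h⟩ := f.exists_extension
  exact ⟨m, OAnnulus.of m F hF, OCircle.ext h⟩

/-! ### The inductive limit topology -/

theorem continuous_restrictCircle (m : ℕ) : Continuous (restrictCircle m) :=
  continuous_sInf_rng.2 fun _ ht => ht.1 m

/-- The universal property of the inductive limit topology, for maps to a normed space. -/
theorem continuous_of_comp_restrictCircle {E : Type*} [NormedAddCommGroup E] [NormedSpace ℂ E]
    (L : OCircle →ₗ[ℂ] E) (h : ∀ m, Continuous fun f : OAnnulus m => L (restrictCircle m f)) :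
    Continuous L := by
  refine continuous_iff_le_induced.2 (sInf_le ⟨fun m => ?_, ?_, ?_, ?_⟩)
  · let _ : TopologicalSpace OCircle := TopologicalSpace.induced L inferInstance
    exact continuous_induced_rng.2 (h m)
  · exact topologicalAddGroup_induced L
  · exact continuousSMul_induced L
  · exact LocallyConvexSpace.induced (L.restrictScalars ℝ)

/-! ### Fourier coefficients and bounded sets -/

/-- A power of the coordinate function on the circle. -/
def circlePow (j : ℤ) : C(Circle, ℂ) :=
  ⟨fun z => ((z ^ j : Circle) : ℂ), continuous_subtype_val.comp (continuous_zpow j)⟩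

theorem circlePow_apply (j : ℤ) (z : Circle) : circlePow j z = (z : ℂ) ^ j := by
  simp [circlePow]

theorem norm_circlePow_le (j : ℤ) : ‖circlePow j‖ ≤ 1 :=
  (ContinuousMap.norm_le _ zero_le_one).2 fun z => (Circle.norm_coe (z ^ j)).le

theorem OCircle.continuous (f : OCircle) : Continuous f := by
  obtain ⟨m, F, hF⟩ := exists_restrictCircle f
  rw [← hF]
  exact F.1.continuous.comp (continuous_subtype_val.subtype_mk _)

/-- Real-analytic functions on the circle as continuous functions. -/
def OCircle.toC : OCircle →ₗ[ℂ] C(Circle, ℂ) where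
  toFun f := ⟨f, f.continuous⟩
  map_add' _ _ := rfl
  map_smul' _ _ := rfl

theorem OCircle.toC_apply (f : OCircle) (z : Circle) : OCircle.toC f z = f z := rfl

/-- The Fourier coefficients of a real-analytic function on the circle. -/
def OCircle.coeff (j : ℤ) : OCircle →ₗ[ℂ] ℂ :=
  (circleMean ∘L ContinuousLinearMap.mul ℂ C(Circle, ℂ) (circlePow (-j))).toLinearMap ∘ₗ OCircle.toC

theorem OCircle.coeff_apply (j : ℤ) (f : OCircle) :
    OCircle.coeff j f = circleMean (circlePow (-j) * OCircle.toC f) := rfl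

/-- Cauchy's estimate: the Fourier coefficients of a holomorphic function on an annulus are
determined by its values on any circle around the origin. -/
theorem OCircle.norm_coeff_le {a b ρ M : ℝ} (ha : 0 ≤ a) (ha1 : a < 1) (hb : 1 < b)
    (hρ : ρ ∈ Ioo a b) {F : ℂ → ℂ} (hF : DifferentiableOn ℂ F (ann a b)) {f : OCircle}
    (hf : ∀ z : Circle, F z = f z) (hM : ∀ z, ‖z‖ = ρ → ‖F z‖ ≤ M) (j : ℤ) :
    ‖OCircle.coeff j f‖ ≤ M * ρ ^ (-j) := by
  have hρ0 : 0 < ρ := ha.trans_lt hρ.1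
  have e1 : OCircle.coeff j f = cint 1 fun z => F z * z ^ (-j - 1) := by
    rw [OCircle.coeff_apply]
    refine (cint_eq_circleMean _ fun ζ => ?_).symm
    have h0 := Circle.coe_ne_zero ζ
    rw [ContinuousMap.mul_apply, circlePow_apply, OCircle.toC_apply, ← hf, zpow_sub_one₀ (by simp)]
    simp only [Complex.ofReal_one, one_mul]
    field_simp
  have hd : DifferentiableOn ℂ (fun z => F z * z ^ (-j - 1)) (ann a b) := fun z hz =>
    ((hF z hz).mul (differentiableAt_zpow.2
      (Or.inl (norm_pos_iff.1 (ha.trans_lt hz.1)))).differentiableWithinAt)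
  rw [e1, cint_shift ha ⟨ha1, hb⟩ hρ hd]
  have h2 := norm_cint_le hρ0.le (f := fun z => F z * z ^ (-j - 1)) (C := M * ρ ^ (-j - 1))
    fun z hz => by
      rw [norm_mul, norm_zpow, hz]
      gcongr
      exact hM z hz
  refine h2.trans (le_of_eq ?_)
  rw [zpow_sub_one₀ hρ0.ne']
  field_simp

theorem zpow_le_pow_natAbs {ρ q : ℝ} (hρ : 0 < ρ) (h1 : ρ ≤ q) (h2 : ρ⁻¹ ≤ q) (j : ℤ) :
    ρ ^ j ≤ q ^ j.natAbs := by
  rcases Int.natAbs_eq j with h | h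
  · conv_lhs => rw [h, zpow_natCast]
    gcongr
  · conv_lhs => rw [h, zpow_neg, zpow_natCast, ← inv_pow]
    gcongr

/-- The coefficient estimate for a function on an annulus, from two circles. -/
theorem OCircle.norm_coeff_restrictCircle_le (m : ℕ) : ∃ ρ : ℝ, 1 < ρ ∧
    ∃ h₁ : ∀ ζ : Circle, (ρ : ℂ) * ζ ∈ annulus m, ∃ h₂ : ∀ ζ : Circle, (ρ : ℂ)⁻¹ * ζ ∈ annulus m,
    ∀ (F : OAnnulus m) (M : ℝ), (∀ ζ : Circle, ‖F.1 ⟨_, h₁ ζ⟩‖ ≤ M) →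
      (∀ ζ : Circle, ‖F.1 ⟨_, h₂ ζ⟩‖ ≤ M) →
      ∀ j, ‖OCircle.coeff j (restrictCircle m F)‖ ≤ M * ρ⁻¹ ^ j.natAbs := by
  have hpos : (0 : ℝ) < 1 / ((m : ℝ) + 1) := by positivity
  set ε : ℝ := 1 / ((m : ℝ) + 1) with hε
  have hε1 : ε ≤ 1 := by
    rw [hε, div_le_one (by positivity)]
    linarith [Nat.cast_nonneg (α := ℝ) m]
  obtain ⟨ρ, hρ1, hρ2⟩ := exists_between (lt_add_of_pos_right (1 : ℝ) hpos)
  have hρ0 : 0 < ρ := by linarith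
  have hinv : 1 - ε < ρ⁻¹ := by
    have : (1 - ε) * ρ < 1 := by nlinarith
    rwa [← lt_div_iff₀ hρ0, one_div] at this
  have hinv1 : ρ⁻¹ < 1 := inv_lt_one_of_one_lt₀ hρ1
  have h₁ : ∀ ζ : Circle, (ρ : ℂ) * ζ ∈ annulus m := fun ζ => by
    simp only [annulus, mem_ofPred_eq, norm_mul, Circle.norm_coe, Complex.norm_real, mul_one,
      Real.norm_eq_abs, abs_of_pos hρ0]
    exact ⟨by linarith, hρ2⟩
  have h₂ : ∀ ζ : Circle, (ρ : ℂ)⁻¹ * ζ ∈ annulus m := fun ζ => by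
    simp only [annulus, mem_ofPred_eq, norm_mul, Circle.norm_coe, norm_inv, Complex.norm_real,
      mul_one, Real.norm_eq_abs, abs_of_pos hρ0]
    exact ⟨hinv, by linarith⟩
  refine ⟨ρ, hρ1, h₁, h₂, fun F M hM1 hM2 j => ?_⟩
  obtain ⟨G, hG, hFG⟩ := F.2
  have hGd : DifferentiableOn ℂ G (ann (1 - ε) (1 + ε)) := hG
  have key : ∀ σ : ℝ, σ ∈ Ioo (1 - ε) (1 + ε) → 0 < σ →
      (∀ ζ : Circle, ‖G (σ * ζ)‖ ≤ M) →
      ‖OCircle.coeff j (restrictCircle m F)‖ ≤ M * σ ^ (-j) := by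
    intro σ hσ hσ0 hM
    refine OCircle.norm_coeff_le (by linarith) (by linarith) (by linarith) hσ hGd
      (fun z => (hFG ⟨z, circle_mem_annulus m z⟩).symm) (fun z hz => ?_) j
    have hz1 : ‖z / σ‖ = 1 := by
      rw [norm_div, hz, Complex.norm_real, Real.norm_eq_abs, abs_of_pos hσ0, div_self hσ0.ne']
    have := hM ⟨z / σ, mem_sphere_zero_iff_norm.2 hz1⟩
    have hσc : (σ : ℂ) ≠ 0 := by exact_mod_cast hσ0.ne'
    rwa [mul_div_cancel₀ _ hσc] at this
  rcases Int.natAbs_eq j with h | h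
  · refine (key ρ ⟨by linarith, hρ2⟩ hρ0 fun ζ => ?_).trans (le_of_eq ?_)
    · rw [← hFG ⟨_, h₁ ζ⟩]; exact hM1 ζ
    · conv_lhs => rw [h, zpow_neg, zpow_natCast, ← inv_pow]
  · refine (key ρ⁻¹ ⟨hinv, by linarith⟩ (by positivity) fun ζ => ?_).trans (le_of_eq ?_)
    · rw [Complex.ofReal_inv, ← hFG ⟨_, h₂ ζ⟩]; exact hM2 ζ
    · conv_lhs => rw [h, neg_neg, zpow_natCast]

/-- The Fourier coefficients of a real-analytic function decay exponentially. -/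
theorem OCircle.exists_coeff_decay (f : OCircle) :
    ∃ r : ℝ, 1 < r ∧ ∃ C, ∀ j, ‖OCircle.coeff j f‖ ≤ C * r⁻¹ ^ j.natAbs := by
  obtain ⟨m, F, rfl⟩ := exists_restrictCircle f
  obtain ⟨ρ, hρ, h₁, h₂, h⟩ := OCircle.norm_coeff_restrictCircle_le m
  have hc : ∀ σ : ℂ, ∀ hσ : ∀ ζ : Circle, σ * ζ ∈ annulus m,
      Continuous fun ζ : Circle => F.1 ⟨_, hσ ζ⟩ := fun σ hσ =>
    F.1.continuous.comp ((continuous_const.mul continuous_subtype_val).subtype_mk _)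
  set f₁ : C(Circle, ℂ) := ⟨_, hc _ h₁⟩
  set f₂ : C(Circle, ℂ) := ⟨_, hc _ h₂⟩
  exact ⟨ρ, hρ, _, h F (max ‖f₁‖ ‖f₂‖) (fun ζ => (f₁.norm_coe_le_norm ζ).trans (le_max_left _ _))
    (fun ζ => (f₂.norm_coe_le_norm ζ).trans (le_max_right _ _))⟩

/-- Weights of subexponential growth. -/
def Subexponential (w : ℤ → ℝ) : Prop :=
  ∀ r : ℝ, 1 < r → ∃ C, ∀ j, |w j| ≤ C * r ^ j.natAbs

/-- Subexponential weights are bounded, linearly in the constant, on sequences with a fixed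
exponential rate of decay. -/
theorem Subexponential.exists_bound {w : ℤ → ℝ} (hw : Subexponential w) {r : ℝ} (hr : 1 < r) :
    ∃ C, ∀ (a : ℤ → ℂ) (M : ℝ), (∀ j, ‖a j‖ ≤ M * r⁻¹ ^ j.natAbs) →
      ∀ j, ‖(w j : ℂ) * a j‖ ≤ C * M := by
  obtain ⟨C, hC⟩ := hw r hr
  refine ⟨C, fun a M ha j => ?_⟩
  rw [norm_mul, Complex.norm_real, Real.norm_eq_abs]
  have hr0 : 0 < r := by linarith
  calc |w j| * ‖a j‖ ≤ (C * r ^ j.natAbs) * (M * r⁻¹ ^ j.natAbs) :=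
        mul_le_mul (hC j) (ha j) (norm_nonneg _) ((abs_nonneg _).trans (hC j))
    _ = C * M * (r * r⁻¹) ^ j.natAbs := by rw [mul_pow]; ring
    _ = C * M := by rw [mul_inv_cancel₀ hr0.ne', one_pow, mul_one]

theorem Subexponential.exists_coeff_bound {w : ℤ → ℝ} (hw : Subexponential w) (f : OCircle) :
    ∃ C, ∀ j, ‖(w j : ℂ) * OCircle.coeff j f‖ ≤ C := by
  obtain ⟨r, hr, M, hM⟩ := f.exists_coeff_decay
  obtain ⟨C, hC⟩ := hw.exists_bound hr
  exact ⟨_, hC _ M hM⟩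

/-- The sequence of weighted Fourier coefficients, as a bounded function on `ℤ`. -/
def weightedCoeff (w : ℤ → ℝ) (hw : Subexponential w) :
    OCircle →ₗ[ℂ] BoundedContinuousFunction ℤ ℂ where
  toFun f := BoundedContinuousFunction.ofNormedAddCommGroupDiscrete
    (fun j => (w j : ℂ) * OCircle.coeff j f) _ (hw.exists_coeff_bound f).choose_spec
  map_add' f g := by
    ext j
    simp [mul_add]
  map_smul' c f := by
    ext j
    simp [mul_left_comm]

theorem weightedCoeff_apply {w : ℤ → ℝ} (hw : Subexponential w) (f : OCircle) (j : ℤ) :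
    weightedCoeff w hw f j = (w j : ℂ) * OCircle.coeff j f := rfl

/-- The weighted Fourier coefficients are continuous for the inductive limit topology: on each
annulus they are bounded by the supremum norms on two circles. -/
theorem continuous_weightedCoeff {w : ℤ → ℝ} (hw : Subexponential w) :
    Continuous (weightedCoeff w hw) := by
  refine continuous_of_comp_restrictCircle _ fun m => ?_
  obtain ⟨ρ, hρ, h₁, h₂, h⟩ := OCircle.norm_coeff_restrictCircle_le m
  obtain ⟨C, hC⟩ := hw.exists_bound hρ
  -- The values of a function on the two circles of radius `ρ` and `ρ⁻¹`.
  have hc : ∀ σ : ℂ, ∀ hσ : ∀ ζ : Circle, σ * ζ ∈ annulus m,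
      Continuous fun ζ : Circle => (⟨_, hσ ζ⟩ : annulus m) := fun σ hσ =>
    (continuous_const.mul continuous_subtype_val).subtype_mk _
  let v (σ : ℂ) (hσ : ∀ ζ : Circle, σ * ζ ∈ annulus m) (F : OAnnulus m) : C(Circle, ℂ) :=
    F.1.comp ⟨_, hc σ hσ⟩
  have hv : ∀ σ hσ, Continuous (v σ hσ) := fun σ hσ =>
    (ContinuousMap.continuous_precomp _).comp continuous_subtype_val
  let L : OAnnulus m →+ BoundedContinuousFunction ℤ ℂ :=
    { toFun := fun F => weightedCoeff w hw (restrictCircle m F)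
      map_zero' := by
        have : restrictCircle m 0 = 0 := rfl
        rw [this, map_zero]
      map_add' := fun F G => by
        have : restrictCircle m (F + G) = restrictCircle m F + restrictCircle m G := rfl
        rw [this, map_add] }
  have hL : ∀ F, ‖L F‖ ≤ |C| * max ‖v _ h₁ F‖ ‖v _ h₂ F‖ := by
    intro F
    have hM : 0 ≤ max ‖v _ h₁ F‖ ‖v _ h₂ F‖ := le_max_of_le_left (norm_nonneg _)
    refine (BoundedContinuousFunction.norm_le (by positivity)).2 fun j => ?_
    refine (hC (fun j => OCircle.coeff j (restrictCircle m F)) _ (h F _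
      (fun ζ => ((v _ h₁ F).norm_coe_le_norm ζ).trans (le_max_left _ _))
      (fun ζ => ((v _ h₂ F).norm_coe_le_norm ζ).trans (le_max_right _ _))) j).trans ?_
    gcongr
    exact le_abs_self C
  refine continuous_of_continuousAt_zero L ?_
  rw [ContinuousAt, map_zero]
  refine squeeze_zero_norm hL ?_
  have ht : Continuous fun F => |C| * max ‖v _ h₁ F‖ ‖v _ h₂ F‖ :=
    continuous_const.mul ((hv _ h₁).norm.max (hv _ h₂).norm)
  have := ht.tendsto 0
  have e : ∀ σ hσ, v σ hσ 0 = 0 := fun _ _ => rfl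
  simpa [e] using this

theorem subexponential_one : Subexponential fun _ => 1 := fun r hr =>
  ⟨1, fun j => by simpa using one_le_pow₀ hr.le⟩

theorem OCircle.continuous_coeff (j : ℤ) : Continuous (OCircle.coeff j) := by
  have h := (continuous_weightedCoeff subexponential_one)
  have h2 : Continuous fun f => weightedCoeff _ subexponential_one f j :=
    (BoundedContinuousFunction.evalCLM ℂ j).continuous.comp h
  simpa [weightedCoeff_apply] using h2

/-- If all subexponential weights give bounded families, then the family decays exponentially,
uniformly: otherwise there are indices `j n`, with `|j n| ≥ n`, at which the
weight `(1 + 1 / (n + 1)) ^ |j n|` gives values larger than `n`. -/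
theorem exists_uniform_decay {ι : Type*} (a : ι → ℤ → ℂ)
    (h : ∀ w, Subexponential w → ∃ C, ∀ i j, ‖(w j : ℂ) * a i j‖ ≤ C) :
    ∃ r : ℝ, 1 < r ∧ ∃ C, 0 ≤ C ∧ ∀ i j, ‖a i j‖ ≤ C * r⁻¹ ^ j.natAbs := by
  by_contra hcon
  push Not at hcon
  obtain ⟨C₁, hC₁⟩ := h _ subexponential_one
  simp only [Complex.ofReal_one, one_mul] at hC₁
  set r : ℕ → ℝ := fun n => 1 + 1 / ((n : ℝ) + 1) with hr
  have hr1 : ∀ n, 1 < r n := fun n => by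
    have : (0 : ℝ) < 1 / ((n : ℝ) + 1) := by positivity
    simp only [hr]; linarith
  have hanti : ∀ n k, n ≤ k → r k ≤ r n := fun n k hnk => by
    simp only [hr]
    have : (n : ℝ) ≤ k := by exact_mod_cast hnk
    gcongr
  have hex : ∀ n : ℕ, ∃ j : ℤ, n ≤ j.natAbs ∧ ∃ i, (n : ℝ) < r n ^ j.natAbs * ‖a i j‖ := by
    intro n
    have hrn := hr1 n
    have hrn0 : 0 < r n := by linarith
    obtain ⟨i, j, hij⟩ := hcon (r n) hrn (max n (|C₁| * r n ^ n))
      (le_max_of_le_left (Nat.cast_nonneg n))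
    have hij' : max (n : ℝ) (|C₁| * r n ^ n) < r n ^ j.natAbs * ‖a i j‖ := by
      rw [inv_pow, ← div_eq_mul_inv, div_lt_iff₀ (by positivity)] at hij
      linarith
    refine ⟨j, ?_, i, (le_max_left _ _).trans_lt hij'⟩
    by_contra hlt
    push Not at hlt
    have h1 := (le_max_right _ _).trans_lt hij'
    have h2 : r n ^ j.natAbs * ‖a i j‖ ≤ r n ^ n * |C₁| :=
      mul_le_mul (pow_le_pow_right₀ hrn.le hlt.le) ((hC₁ i j).trans (le_abs_self _))
        (norm_nonneg _) (by positivity)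
    linarith
  choose j hj i hi using hex
  classical
  -- As `j` need not be injective, the weight at `l` uses the first index `n` with `j n = l`. This
  -- is the largest of the candidates, because `r` is decreasing.
  set w : ℤ → ℝ := fun l => if h : ∃ n, j n = l then r (Nat.find h) ^ l.natAbs else 1 with hw
  have hwsub : Subexponential w := by
    intro s hs
    obtain ⟨n₀, hn₀⟩ := exists_nat_one_div_lt (sub_pos.2 hs)
    have hs' : ∀ n, n₀ ≤ n → r n ≤ s := fun n hn => (hanti _ _ hn).trans (by
      simp only [hr]; linarith)
    -- The finitely many indices below `n₀`, where `r n` may exceed `s`, are absorbed in the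
    -- constant.
    refine ⟨max 1 (r 0 ^ ∑ n ∈ Finset.range n₀, (j n).natAbs), fun l => ?_⟩
    have hsl : 1 ≤ s ^ l.natAbs := one_le_pow₀ hs.le
    by_cases hl : ∃ n, j n = l
    · simp only [hw, dif_pos hl]
      have hpos : 0 < r (Nat.find hl) := by linarith [hr1 (Nat.find hl)]
      rw [abs_of_pos (by positivity)]
      rcases le_or_gt n₀ (Nat.find hl) with hle | hlt
      · calc r (Nat.find hl) ^ l.natAbs ≤ 1 * s ^ l.natAbs := by
              rw [one_mul]
              exact pow_le_pow_left₀ hpos.le (hs' _ hle) _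
          _ ≤ _ := by gcongr; exact le_max_left _ _
      · have h1 : l.natAbs ≤ ∑ n ∈ Finset.range n₀, (j n).natAbs := by
          conv_lhs => rw [← Nat.find_spec hl]
          exact Finset.single_le_sum (f := fun n => (j n).natAbs) (fun _ _ => Nat.zero_le _)
            (Finset.mem_range.2 hlt)
        calc r (Nat.find hl) ^ l.natAbs ≤ r 0 ^ l.natAbs :=
              pow_le_pow_left₀ hpos.le (hanti _ _ (Nat.zero_le _)) _
          _ ≤ r 0 ^ ∑ n ∈ Finset.range n₀, (j n).natAbs := pow_le_pow_right₀ (hr1 0).le h1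
          _ ≤ max 1 (r 0 ^ ∑ n ∈ Finset.range n₀, (j n).natAbs) * 1 := by
              rw [mul_one]; exact le_max_right _ _
          _ ≤ _ := by gcongr
    · simp only [hw, dif_neg hl, abs_one]
      exact one_le_mul_of_one_le_of_one_le (le_max_left _ _) hsl
  -- For `n > C` the weight contradicts the choice of `j n`.
  obtain ⟨C, hC⟩ := h w hwsub
  obtain ⟨n, hn⟩ := exists_nat_gt C
  have h1 := hC (i n) (j n)
  have hl : ∃ k, j k = j n := ⟨n, rfl⟩
  have h2 : r n ^ (j n).natAbs ≤ w (j n) := by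
    simp only [hw, dif_pos hl]
    have := hr1 n
    exact pow_le_pow_left₀ (by linarith) (hanti _ _ (Nat.find_min' hl rfl)) _
  have h3 : r n ^ (j n).natAbs * ‖a (i n) (j n)‖ ≤ ‖(w (j n) : ℂ) * a (i n) (j n)‖ := by
    rw [norm_mul, Complex.norm_real]
    gcongr
    exact h2.trans (le_abs_self _)
  linarith [hi n]

/-! ### Differentiable families of holomorphic functions -/

/-- The restriction of `f` to the circle of radius `ρ`, as a function on the unit circle (zero if it
is not continuous). -/
def onC (ρ : ℝ) (f : ℂ → ℂ) : C(Circle, ℂ) :=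
  open scoped Classical in
  if h : Continuous fun z : Circle => f (ρ * z) then ⟨_, h⟩ else 0

theorem onC_apply {ρ : ℝ} (hρ : 0 < ρ) {f : ℂ → ℂ} (hf : ContinuousOn f (Metric.sphere 0 ρ))
    (z : Circle) : onC ρ f z = f (ρ * z) := by
  have h : Continuous fun z : Circle => f (ρ * z) :=
    hf.comp_continuous (by fun_prop) fun z => by
      rw [mem_sphere_zero_iff_norm, norm_mul, Circle.norm_coe, Complex.norm_real,
        Real.norm_eq_abs, abs_of_pos hρ, mul_one]
  rw [onC, dif_pos h]
  rfl

theorem onC_eq {ρ : ℝ} {f : ℂ → ℂ} (h : C(Circle, ℂ)) (hf : ∀ z : Circle, f (ρ * z) = h z) :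
    onC ρ f = h := by
  have h' : Continuous fun z : Circle => f (ρ * z) := by
    simp only [hf]; exact h.continuous
  rw [onC, dif_pos h']
  ext z
  exact hf z

/-- A family `Γ t` of functions which, for `t` near `t₀`, are holomorphic in the annulus
`a < |z| < b`, and which depends `C^k` on `t` near `t₀`, uniformly on circles. -/
structure HolFam (k : ℕ) (t₀ a b : ℝ) (Γ : ℝ → ℂ → ℂ) : Prop where
  diff : ∀ᶠ t in 𝓝 t₀, DifferentiableOn ℂ (Γ t) (ann a b)
  smooth : ∀ ρ ∈ Ioo a b, ContDiffAt ℝ k (fun t => onC ρ (Γ t)) t₀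

/-- A function is `C^k` if it starts a sequence of functions each of which is the derivative of the
preceding one, up to order `k + 1`. -/
theorem contDiffOn_of_hasDerivAt_seq {E : Type*} [NormedAddCommGroup E] [NormedSpace ℝ E]
    {I : Set ℝ} (hI : IsOpen I) (k : ℕ) : ∀ {S : ℕ → ℝ → E},
    (∀ i ≤ k, ∀ t ∈ I, HasDerivAt (S i) (S (i + 1) t) t) → ContDiffOn ℝ k (S 0) I := by
  induction k with
  | zero =>
    intro S h
    rw [Nat.cast_zero, contDiffOn_zero]
    exact fun t ht => (h 0 le_rfl t ht).continuousAt.continuousWithinAt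
  | succ k ih =>
    intro S h
    have h1 : ContDiffOn ℝ k (S 1) I := ih (S := fun i => S (i + 1))
      fun i hi t ht => h (i + 1) (by omega) t ht
    have h2 := (contDiffOn_succ_iff_deriv_of_isOpen (n := k) (f := S 0) hI).2
      ⟨fun t ht => (h 0 (Nat.zero_le _) t ht).differentiableAt.differentiableWithinAt,
        by simp, h1.congr fun t ht => (h 0 (Nat.zero_le _) t ht).deriv⟩
    exact_mod_cast h2

/-- Continuous linear maps to normed spaces differentiate smooth curves in `𝒪(S¹)`. -/
theorem hasDerivAt_of_tendsto_slope {E : Type*} [NormedAddCommGroup E] [NormedSpace ℂ E]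
    {L : OCircle →ₗ[ℂ] E} (hL : Continuous L) {c : ℝ → OCircle} {c' : OCircle} {t : ℝ}
    (h : Tendsto (slope c t) (𝓝[≠] t) (𝓝 c')) : HasDerivAt (fun s => L (c s)) (L c') t := by
  rw [hasDerivAt_iff_tendsto_slope]
  refine ((hL.tendsto _).comp h).congr fun s => ?_
  simp only [slope_def_module, Function.comp]
  rw [LinearMap.map_smul_of_tower, map_sub]

theorem summable_pow_natAbs {q : ℝ} (hq0 : 0 ≤ q) (hq : q < 1) :
    Summable fun j : ℤ => q ^ j.natAbs := by
  refine Summable.of_nat_of_neg ?_ ?_ <;> simpa using summable_geometric_of_lt_one hq0 hq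

/-- A real-analytic function on the circle is the sum of its Fourier series. -/
theorem OCircle.hasSum_coeff (f : OCircle) (z : Circle) :
    HasSum (fun j : ℤ => OCircle.coeff j f * (z : ℂ) ^ j) (f z) := by
  have hT : Fact (0 < 2 * Real.pi) := ⟨Real.two_pi_pos⟩
  set F : C(AddCircle (2 * Real.pi), ℂ) := (OCircle.toC f).comp
    ⟨AddCircle.toCircle, AddCircle.continuous_toCircle⟩ with hF
  have htoC : ∀ x : ℝ, AddCircle.toCircle (x : AddCircle (2 * Real.pi)) = Circle.exp x := by
    intro x
    rw [AddCircle.toCircle_apply_mk]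
    congr 1
    have := Real.pi_ne_zero
    field_simp
  have hco : ∀ j, fourierCoeff F j = OCircle.coeff j f := by
    intro j
    rw [fourierCoeff_eq_intervalIntegral F j 0, OCircle.coeff_apply, circleMean_apply, zero_add,
      Complex.real_smul]
    congr 1
    · push_cast; simp
    · refine intervalIntegral.integral_congr fun x _ => ?_
      simp only [fourier_apply, AddCircle.toCircle_zsmul, htoC, hF, ContinuousMap.comp_apply,
        ContinuousMap.coe_mk, smul_eq_mul, ContinuousMap.mul_apply]
      rfl
  obtain ⟨r, hr, C, hC⟩ := f.exists_coeff_decay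
  have hs : Summable (fourierCoeff F) := by
    refine Summable.of_norm_bounded ((summable_pow_natAbs (q := r⁻¹) (by positivity)
      (inv_lt_one_of_one_lt₀ hr)).mul_left C) fun j => ?_
    rw [hco]; exact hC j
  have h := has_pointwise_sum_fourier_series_of_summable hs
    ((Complex.arg z : ℝ) : AddCircle (2 * Real.pi))
  have hz : Circle.exp (Complex.arg z) = z := Circle.exp_arg z
  have e : F ((Complex.arg z : ℝ) : AddCircle (2 * Real.pi)) = f z := by
    simp only [hF, ContinuousMap.comp_apply, ContinuousMap.coe_mk, htoC, hz]
    rfl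
  rw [e] at h
  refine h.congr_fun fun j => ?_
  simp only [hco, fourier_apply, AddCircle.toCircle_zsmul, htoC, hz, smul_eq_mul, Circle.coe_zpow]

/-- A smooth curve in `𝒪(S¹)` is locally, to any finite order, a differentiable family of holomorphic
functions on a fixed annulus. The family is the sum of the Fourier series, which by the uniform decay
of the coefficients may be differentiated term by term in the parameter. -/
theorem IsSmoothCurve.exists_holFam {c : ℝ → OCircle} (hc : IsSmoothCurve c) (t₀ : ℝ) (k : ℕ) :
    ∃ R : ℝ, 1 < R ∧ ∃ Γ, HolFam k t₀ R⁻¹ R Γ ∧ ∀ᶠ t in 𝓝 t₀, ∀ z : Circle, Γ t z = c t z := by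
  obtain ⟨g, rfl, hg⟩ := hc
  set I := Icc (t₀ - 1) (t₀ + 1) with hI
  -- Uniform exponential decay of the Fourier coefficients of all derivatives up to order `k + 1`.
  have hbound : ∀ w, Subexponential w → ∃ C, ∀ (p : I × Fin (k + 2)) (j : ℤ),
      ‖(w j : ℂ) * OCircle.coeff j (g p.2 p.1)‖ ≤ C := by
    intro w hw
    have hc : ∀ i, Continuous fun t => weightedCoeff w hw (g i t) := fun i =>
      continuous_iff_continuousAt.2 fun t =>
        (hasDerivAt_of_tendsto_slope (continuous_weightedCoeff hw) (hg i t)).continuousAt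
    choose C hC using fun i =>
      isCompact_Icc.exists_bound_of_continuousOn (s := I) (hc i).continuousOn
    refine ⟨∑ i ∈ Finset.range (k + 2), |C i|, fun p j => ?_⟩
    have h1 := (weightedCoeff w hw (g p.2 p.1)).norm_coe_le_norm j
    rw [weightedCoeff_apply] at h1
    refine h1.trans ((hC p.2 p.1 p.1.2).trans ((le_abs_self _).trans ?_))
    exact Finset.single_le_sum (f := fun i => |C i|) (s := Finset.range (k + 2))
      (fun _ _ => abs_nonneg _) (Finset.mem_range.2 p.2.2)
  obtain ⟨R, hR, C, hC0, hC⟩ := exists_uniform_decay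
    (fun (p : I × Fin (k + 2)) j => OCircle.coeff j (g p.2 p.1)) hbound
  have hC' : ∀ i ≤ k + 1, ∀ t ∈ I, ∀ j, ‖OCircle.coeff j (g i t)‖ ≤ C * R⁻¹ ^ j.natAbs :=
    fun i hi t ht j => hC (⟨t, ht⟩, ⟨i, by omega⟩) j
  have hR0 : 0 < R := by linarith
  have hIo : ∀ᶠ t in 𝓝 t₀, t ∈ Ioo (t₀ - 1) (t₀ + 1) := Ioo_mem_nhds (by linarith) (by linarith)
  refine ⟨R, hR, fun t z => ∑' j : ℤ, OCircle.coeff j (g 0 t) * z ^ j, ⟨?_, ?_⟩,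
    Eventually.of_forall fun t z => ((g 0 t).hasSum_coeff z).tsum_eq⟩
  -- On the smaller annulus `s⁻¹ < |z| < s` the series converges uniformly.
  · filter_upwards [hIo] with t ht z hz
    have hz0 : 0 < ‖z‖ := (inv_pos.2 hR0).trans hz.1
    obtain ⟨s, hs1, hs2⟩ := exists_between (max_lt hz.2
      ((inv_lt_comm₀ hR0 hz0).1 hz.1) : max ‖z‖ ‖z‖⁻¹ < R)
    have hs0 : 0 < s := hz0.trans_le ((le_max_left _ _).trans hs1.le)
    have hzs : z ∈ ann s⁻¹ s := ⟨(inv_lt_comm₀ hs0 hz0).2 ((le_max_right _ _).trans_lt hs1),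
      (le_max_left _ _).trans_lt hs1⟩
    refine (DifferentiableOn.differentiableAt ?_
      ((isOpen_ann s⁻¹ s).mem_nhds hzs)).differentiableWithinAt
    refine Complex.differentiableOn_tsum_of_summable_norm (u := fun j : ℤ => C * (R⁻¹ * s) ^ j.natAbs)
      ((summable_pow_natAbs (by positivity) ?_).mul_left C) (fun j x hx => ?_) (isOpen_ann _ _)
      (fun j x hx => ?_)
    · rw [inv_mul_lt_iff₀ hR0]; linarith
    · have hx0 : x ≠ 0 := norm_pos_iff.1 ((inv_pos.2 hs0).trans hx.1)
      exact ((differentiableAt_zpow.2 (Or.inl hx0)).const_mul _).differentiableWithinAt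
    · have hx0 : 0 < ‖x‖ := (inv_pos.2 hs0).trans hx.1
      rw [norm_mul, norm_zpow, mul_pow, ← mul_assoc]
      exact mul_le_mul (hC' 0 (Nat.zero_le _) t (Ioo_subset_Icc_self ht) j)
        (zpow_le_pow_natAbs hx0 hx.2.le ((inv_lt_comm₀ hs0 hx0).1 hx.1).le j) (by positivity)
        (by positivity)
  · intro ρ hρ
    have hρ0 : 0 < ρ := (inv_pos.2 hR0).trans hρ.1
    set q := R⁻¹ * max ρ ρ⁻¹ with hq
    have hq0 : 0 ≤ q := by positivity
    have hq1 : q < 1 := by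
      rw [hq, inv_mul_lt_iff₀ hR0, mul_one]
      exact max_lt hρ.2 ((inv_lt_comm₀ hR0 hρ0).1 hρ.1)
    -- The series of the `i`-th derivatives, restricted to the circle of radius `ρ`.
    set S : ℕ → ℝ → C(Circle, ℂ) := fun i t =>
      ∑' j : ℤ, (OCircle.coeff j (g i t) * (ρ : ℂ) ^ j) • circlePow j with hS
    have hterm : ∀ i ≤ k + 1, ∀ t ∈ I, ∀ j : ℤ,
        ‖(OCircle.coeff j (g i t) * (ρ : ℂ) ^ j) • circlePow j‖ ≤ C * q ^ j.natAbs := by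
      intro i hi t ht j
      rw [norm_smul, norm_mul, norm_zpow, Complex.norm_real, Real.norm_eq_abs, abs_of_pos hρ0, hq,
        mul_pow, ← mul_assoc]
      calc _ ≤ (C * R⁻¹ ^ j.natAbs * (max ρ ρ⁻¹) ^ j.natAbs) * 1 := by
            gcongr
            · exact hC' i hi t ht j
            · exact zpow_le_pow_natAbs hρ0 (le_max_left _ _) (le_max_right _ _) j
            · exact norm_circlePow_le j
        _ = _ := mul_one _
    have hsum : Summable fun j : ℤ => C * q ^ j.natAbs := (summable_pow_natAbs hq0 hq1).mul_left C
    have hSd : ∀ i ≤ k, ∀ t ∈ Ioo (t₀ - 1) (t₀ + 1), HasDerivAt (S i) (S (i + 1) t) t := by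
      intro i hi t ht
      refine hasDerivAt_tsum_of_isPreconnected hsum isOpen_Ioo isPreconnected_Ioo
        (g := fun j s => (OCircle.coeff j (g i s) * (ρ : ℂ) ^ j) • circlePow j)
        (fun j s _ => ?_) (fun j s hs => hterm (i + 1) (by omega) s (Ioo_subset_Icc_self hs) j) ht
        (Summable.of_norm_bounded hsum fun j => hterm i (by omega) t (Ioo_subset_Icc_self ht) j) ht
      exact ((hasDerivAt_of_tendsto_slope (OCircle.continuous_coeff j) (hg i s)).mul_const
        _).smul_const _
    have hS0 : ContDiffAt ℝ k (S 0) t₀ := (contDiffOn_of_hasDerivAt_seq isOpen_Ioo k hSd).contDiffAt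
      (isOpen_Ioo.mem_nhds ⟨by linarith, by linarith⟩)
    refine hS0.congr_of_eventuallyEq ?_
    filter_upwards [hIo] with t ht
    refine onC_eq _ fun z => ?_
    have h1 : Summable fun j : ℤ => (OCircle.coeff j (g 0 t) * (ρ : ℂ) ^ j) • circlePow j :=
      Summable.of_norm_bounded hsum fun j =>
        hterm 0 (Nat.zero_le _) t (Ioo_subset_Icc_self ht) j
    have h2 := (h1.hasSum.mapL (ContinuousMap.evalCLM ℂ z)).tsum_eq
    rw [ContinuousMap.evalCLM_apply] at h2
    rw [hS, ← h2]
    refine tsum_congr fun j => ?_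
    simp [circlePow_apply, mul_zpow, mul_assoc]

/-! ### Cauchy's formula as an integral operator -/

/-- The function on the circle of radius `ρ` given by a continuous function on the unit circle
(zero off that circle). -/
def extC (ρ : ℝ) (f : C(Circle, ℂ)) (z : ℂ) : ℂ :=
  open scoped Classical in
  if h : ‖z / ρ‖ = 1 then f ⟨z / ρ, mem_sphere_zero_iff_norm.2 h⟩ else 0

theorem extC_apply {ρ : ℝ} (hρ : 0 < ρ) (f : C(Circle, ℂ)) (z : Circle) :
    extC ρ f (ρ * z) = f z := by
  have hρ' : (ρ : ℂ) ≠ 0 := by exact_mod_cast hρ.ne'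
  have e : (ρ : ℂ) * z / ρ = z := mul_div_cancel_left₀ _ hρ'
  have h : ‖(ρ : ℂ) * z / ρ‖ = 1 := by rw [e]; exact Circle.norm_coe z
  rw [extC, dif_pos h]
  congr 1
  exact Subtype.ext e

theorem exists_circle_mul {ρ : ℝ} (hρ : 0 < ρ) {z : ℂ} (hz : ‖z‖ = ρ) : ∃ w : Circle, z = ρ * w := by
  have hρ' : (ρ : ℂ) ≠ 0 := by exact_mod_cast hρ.ne'
  have h : ‖z / ρ‖ = 1 := by
    rw [norm_div, hz, Complex.norm_real, Real.norm_eq_abs, abs_of_pos hρ, div_self hρ.ne']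
  exact ⟨⟨z / ρ, mem_sphere_zero_iff_norm.2 h⟩, (mul_div_cancel₀ z hρ').symm⟩

theorem norm_mul_circle {ρ : ℝ} (hρ : 0 < ρ) (z : Circle) : ‖(ρ : ℂ) * z‖ = ρ := by
  rw [norm_mul, Circle.norm_coe, Complex.norm_real, Real.norm_eq_abs, abs_of_pos hρ, mul_one]

theorem continuousOn_extC {ρ : ℝ} (hρ : 0 < ρ) (f : C(Circle, ℂ)) :
    ContinuousOn (extC ρ f) (Metric.sphere 0 ρ) := by
  rw [continuousOn_iff_continuous_domRestrict]
  have h : ∀ z : Metric.sphere (0 : ℂ) ρ, ‖(z : ℂ) / ρ‖ = 1 := fun z => by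
    have hz : ‖(z : ℂ)‖ = ρ := mem_sphere_zero_iff_norm.1 z.2
    rw [norm_div, hz, Complex.norm_real, Real.norm_eq_abs, abs_of_pos hρ, div_self hρ.ne']
  have e : (Metric.sphere (0 : ℂ) ρ).domRestrict (extC ρ f) = fun z : Metric.sphere (0 : ℂ) ρ =>
      f ⟨(z : ℂ) / ρ, mem_sphere_zero_iff_norm.2 (h z)⟩ := by
    funext z
    exact dif_pos (h z)
  rw [e]
  exact f.continuous.comp ((continuous_subtype_val.div_const _).subtype_mk _)

section CauchyKernel

variable {X : Type*} [TopologicalSpace X]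

/-- The Cauchy kernel `ζ / (ζ - p x)` on the circle of radius `σ`. -/
def cauchyKer (σ : ℝ) (p : C(X, ℂ)) (h : ∀ x (ζ : Circle), (σ : ℂ) * ζ - p x ≠ 0) :
    C(X × Circle, ℂ) :=
  ⟨fun q => (σ : ℂ) * q.2 / ((σ : ℂ) * q.2 - p q.1),
    Continuous.div (by fun_prop) (by fun_prop) fun q => h q.1 q.2⟩

theorem mul_circle_sub_ne {σ : ℝ} (hσ : 0 < σ) {w : ℂ} (h : ‖w‖ ≠ σ) (ζ : Circle) :
    (σ : ℂ) * ζ - w ≠ 0 := fun e => h (by rw [← sub_eq_zero.1 e, norm_mul_circle hσ])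

variable [CompactSpace X]

theorem kernelOp_cauchyKer {σ : ℝ} {p : C(X, ℂ)} {h} {f : ℂ → ℂ} {F : C(Circle, ℂ)}
    (hf : ∀ ζ : Circle, f (σ * ζ) = F ζ) (x : X) :
    kernelOp (cauchyKer σ p h) F x = cint σ fun ζ => f ζ / (ζ - p x) := by
  refine kernelOp_eq_cint _ _ _ fun ζ => ?_
  rw [hf, cauchyKer, ContinuousMap.coe_mk]
  ring

end CauchyKernel

/-- A closed annulus around the unit circle. -/
def closedAnn (s : ℝ) : Set ℂ := {z | s⁻¹ ≤ ‖z‖ ∧ ‖z‖ ≤ s}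

instance (s : ℝ) : CompactSpace (closedAnn s) := by
  refine isCompact_iff_compactSpace.1 (Metric.isCompact_of_isClosed_isBounded ?_ ?_)
  · exact (isClosed_le continuous_const continuous_norm).inter
      (isClosed_le continuous_norm continuous_const)
  · exact Metric.isBounded_closedBall.subset
      (fun z hz => by simpa using hz.2 : closedAnn s ⊆ Metric.closedBall 0 s)

/-- The inclusion of a closed annulus. -/
def closedAnnIncl (s : ℝ) : C(closedAnn s, ℂ) := ⟨Subtype.val, continuous_subtype_val⟩

section CauchyOp

variable {s τ : ℝ} (hs : 1 < s) (hτ : s < τ)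
include hs hτ

theorem closedAnn_ne_outer (z : closedAnn s) (ζ : Circle) : (τ : ℂ) * ζ - closedAnnIncl s z ≠ 0 :=
  mul_circle_sub_ne (by linarith) (z.2.2.trans_lt hτ).ne ζ

theorem closedAnn_ne_inner (z : closedAnn s) (ζ : Circle) :
    ((τ⁻¹ : ℝ) : ℂ) * ζ - closedAnnIncl s z ≠ 0 :=
  mul_circle_sub_ne (inv_pos.2 (by linarith))
    ((inv_strictAnti₀ (by linarith) hτ).trans_le z.2.1).ne' ζ

/-- Cauchy's formula: the values on a closed annulus of a holomorphic function, from its values on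
the circles of radius `τ` and `τ⁻¹`. -/
def cauchyOp : C(Circle, ℂ) × C(Circle, ℂ) →L[ℂ] C(closedAnn s, ℂ) :=
  (kernelOp (cauchyKer τ (closedAnnIncl s) (closedAnn_ne_outer hs hτ))) ∘L
      ContinuousLinearMap.fst ℂ _ _ -
    (kernelOp (cauchyKer τ⁻¹ (closedAnnIncl s) (closedAnn_ne_inner hs hτ))) ∘L
      ContinuousLinearMap.snd ℂ _ _

theorem cauchyOp_eq_cint (f : C(Circle, ℂ) × C(Circle, ℂ)) (z : closedAnn s) :
    cauchyOp hs hτ f z = cint τ (fun ζ => extC τ f.1 ζ / (ζ - z)) -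
      cint τ⁻¹ (fun ζ => extC τ⁻¹ f.2 ζ / (ζ - z)) := by
  have hτ0 : 0 < τ := by linarith
  have h1 := kernelOp_cauchyKer (h := closedAnn_ne_outer hs hτ) (extC_apply hτ0 f.1) z
  have h2 := kernelOp_cauchyKer (h := closedAnn_ne_inner hs hτ)
    (extC_apply (inv_pos.2 hτ0) f.2) z
  exact congrArg₂ (· - ·) h1 h2

/-- Cauchy's formula for holomorphic functions on a larger annulus. -/
theorem cauchyOp_onC {R : ℝ} (hR : τ < R) {f : ℂ → ℂ} (hf : DifferentiableOn ℂ f (ann R⁻¹ R))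
    (z : closedAnn s) : cauchyOp hs hτ (onC τ f, onC τ⁻¹ f) z = f z := by
  have hτ0 : 0 < τ := by linarith
  have hR0 : 0 < R := by linarith
  have h1 : R⁻¹ < τ⁻¹ := inv_strictAnti₀ hτ0 hR
  have h2 : τ⁻¹ < s⁻¹ := inv_strictAnti₀ (by linarith) hτ
  have h3 : s⁻¹ < 1 := inv_lt_one_of_one_lt₀ hs
  rw [cauchyOp_eq_cint, ← cint_cauchy_annulus (inv_pos.2 hR0).le h1 hR hf (z := z)
    (h2.trans_le z.2.1) (z.2.2.trans_lt hτ)]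
  congr 1
  · refine cint_congr hτ0.le fun ζ hζ => ?_
    obtain ⟨w, rfl⟩ := exists_circle_mul hτ0 hζ
    rw [extC_apply hτ0, onC_apply hτ0
      (hf.continuousOn.mono (sphere_subset_ann (by linarith) hR))]
  · refine cint_congr (inv_pos.2 hτ0).le fun ζ hζ => ?_
    obtain ⟨w, rfl⟩ := exists_circle_mul (inv_pos.2 hτ0) hζ
    rw [extC_apply (inv_pos.2 hτ0), onC_apply (inv_pos.2 hτ0)
      (hf.continuousOn.mono (sphere_subset_ann h1 (by linarith)))]

/-- The Cauchy integrals along two circles, as a holomorphic function on a thin annulus. -/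
def cauchyAnnulus {m : ℕ} (hm : annulus m ⊆ closedAnn s) (f : C(Circle, ℂ) × C(Circle, ℂ)) :
    OAnnulus m :=
  ⟨(cauchyOp hs hτ f).comp ⟨inclusion hm, continuous_inclusion hm⟩,
    fun z => cint τ (fun ζ => extC τ f.1 ζ / (ζ - z)) -
      cint τ⁻¹ (fun ζ => extC τ⁻¹ f.2 ζ / (ζ - z)), by
    have hτ0 : 0 < τ := by linarith
    intro z hz
    have hz' := hm hz
    refine ((differentiableAt_cauchy hτ0 (continuousOn_extC hτ0 _)
      (hz'.2.trans_lt hτ).ne).sub (differentiableAt_cauchy (inv_pos.2 hτ0)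
      (continuousOn_extC (inv_pos.2 hτ0) _) ?_)).differentiableWithinAt
    exact ((inv_strictAnti₀ (by linarith) hτ).trans_le hz'.1).ne',
    fun z => cauchyOp_eq_cint hs hτ f (inclusion hm z)⟩

theorem continuous_cauchyAnnulus {m : ℕ} (hm : annulus m ⊆ closedAnn s) :
    Continuous (cauchyAnnulus hs hτ hm) :=
  ((ContinuousMap.continuous_precomp _).comp (cauchyOp hs hτ).continuous).subtype_mk _

/-- The map from pairs of continuous functions on the circle to `𝒪(S¹)` given by the Cauchy
integrals along the circles of radius `τ` and `τ⁻¹`. -/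
def cauchyO {m : ℕ} (hm : annulus m ⊆ closedAnn s) :
    C(Circle, ℂ) × C(Circle, ℂ) →ₗ[ℝ] OCircle where
  toFun f := restrictCircle m (cauchyAnnulus hs hτ hm f)
  map_add' f g := OCircle.ext fun z => by
    have := congrFun (congrArg DFunLike.coe ((cauchyOp hs hτ).map_add f g))
      (inclusion hm ⟨z, circle_mem_annulus m z⟩)
    exact this
  map_smul' c f := OCircle.ext fun z => by
    have := congrFun (congrArg DFunLike.coe ((cauchyOp hs hτ).map_smul (c : ℂ) f))
      (inclusion hm ⟨z, circle_mem_annulus m z⟩)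
    exact this

end CauchyOp

theorem exists_annulus_subset_closedAnn {s : ℝ} (hs : 1 < s) : ∃ m, annulus m ⊆ closedAnn s := by
  have hs0 : 0 < s := by linarith
  have h1 : 0 < min (s - 1) (1 - s⁻¹) :=
    lt_min (by linarith) (by linarith [inv_lt_one_of_one_lt₀ hs])
  obtain ⟨m, hm⟩ := exists_nat_one_div_lt h1
  refine ⟨m, fun z hz => ⟨?_, ?_⟩⟩
  · linarith [hz.1, hm.le.trans (min_le_right _ _)]
  · linarith [hz.2, hm.le.trans (min_le_left _ _)]

/-! ### Smooth curves in `𝒪(S¹)` from differentiable families -/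

/-- Evaluation at a point of the circle. -/
def OCircle.eval (z : Circle) : OCircle →ₗ[ℂ] ℂ where
  toFun f := f z
  map_add' _ _ := rfl
  map_smul' _ _ := rfl

theorem OCircle.continuous_eval (z : Circle) : Continuous (OCircle.eval z) :=
  continuous_of_comp_restrictCircle _ fun m =>
    (continuous_eval_const (F := C(annulus m, ℂ)) (⟨z, circle_mem_annulus m z⟩ : annulus m)).comp
      continuous_subtype_val

theorem iteratedDeriv_clm_comp {E F : Type*} [NormedAddCommGroup E] [NormedSpace ℝ E]
    [NormedAddCommGroup F] [NormedSpace ℝ F] (L : E →L[ℝ] F) {A : ℝ → E} {k n : ℕ} {t : ℝ}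
    (hA : ContDiffAt ℝ n A t) (hk : k ≤ n) :
    iteratedDeriv k (fun s => L (A s)) t = L (iteratedDeriv k A t) := by
  have := L.iteratedFDeriv_comp_left hA (i := k) (by exact_mod_cast hk)
  rw [iteratedDeriv_eq_iteratedFDeriv, iteratedDeriv_eq_iteratedFDeriv]
  exact congrArg (fun M => M fun _ => (1 : ℝ)) this

/-- A curve in `𝒪(S¹)` which locally, and to any finite order, comes from differentiable curves
in a normed space is smooth. Its derivatives are the pointwise ones, which therefore do not depend on
the order up to which the local representation holds. -/
theorem isSmoothCurve_of_locally {E : Type*} [NormedAddCommGroup E] [NormedSpace ℝ E]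
    {c : ℝ → OCircle}
    (h : ∀ (t₀ : ℝ) (k : ℕ), ∃ (J : E →ₗ[ℝ] OCircle) (A : ℝ → E), Continuous J ∧
      ContDiffAt ℝ k A t₀ ∧ ∀ᶠ t in 𝓝 t₀, c t = J (A t)) : IsSmoothCurve c := by
  have key : ∀ (J : E →ₗ[ℝ] OCircle) (A : ℝ → E) (t₀ : ℝ) (k n : ℕ), Continuous J →
      ContDiffAt ℝ n A t₀ → k ≤ n → (∀ᶠ t in 𝓝 t₀, c t = J (A t)) → ∀ z : Circle,
      iteratedDeriv k (fun t => c t z) t₀ = J (iteratedDeriv k A t₀) z := by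
    intro J A t₀ k n hJ hA hkn hc z
    let L : E →L[ℝ] ℂ := ⟨((OCircle.eval z).restrictScalars ℝ) ∘ₗ J, (OCircle.continuous_eval z).comp hJ⟩
    rw [← show L (iteratedDeriv k A t₀) = J (iteratedDeriv k A t₀) z from rfl,
      ← iteratedDeriv_clm_comp L hA hkn]
    refine Filter.EventuallyEq.iteratedDeriv_eq k ?_
    filter_upwards [hc] with t ht
    rw [ht]
    rfl
  have han : ∀ k t, IsRealAnalytic fun z => iteratedDeriv k (fun s => c s z) t := by
    intro k t
    obtain ⟨J, A, hJ, hA, hc⟩ := h t k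
    have : (fun z => iteratedDeriv k (fun s => c s z) t) = J (iteratedDeriv k A t) :=
      funext (key J A t k k hJ hA le_rfl hc)
    rw [this]
    exact (J (iteratedDeriv k A t)).2
  obtain ⟨D, hD⟩ : ∃ D : ℕ → ℝ → OCircle, ∀ k t (z : Circle),
      D k t z = iteratedDeriv k (fun s => c s z) t :=
    ⟨fun k t => ⟨fun z => iteratedDeriv k (fun s => c s z) t, han k t⟩, fun _ _ _ => rfl⟩
  refine ⟨D, ?_, fun k t => ?_⟩
  · funext t
    exact OCircle.ext fun z => (hD 0 t z).trans (congrFun iteratedDeriv_zero t)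
  · obtain ⟨J, A, hJ, hA, hc⟩ := h t (k + 1)
    have h1 : ∀ᶠ s in 𝓝 t, D k s = J (iteratedDeriv k A s) := by
      filter_upwards [hA.eventually (by simp), hc.eventually_nhds] with s hs1 hs2
      exact OCircle.ext fun z => (hD k s z).trans (key J A s k (k + 1) hJ hs1 (Nat.le_succ k) hs2 z)
    have h2 : D (k + 1) t = J (iteratedDeriv (k + 1) A t) :=
      OCircle.ext fun z => (hD _ t z).trans (key J A t (k + 1) (k + 1) hJ hA le_rfl hc z)
    have hd : HasDerivAt (iteratedDeriv k A) (iteratedDeriv (k + 1) A t) t := by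
      have : DifferentiableAt ℝ (iteratedDeriv k A) t := by
        rw [iteratedDeriv_eq_equiv_comp, LinearIsometryEquiv.comp_differentiableAt_iff]
        exact hA.differentiableAt_iteratedFDeriv (by exact_mod_cast Nat.lt_succ_self k)
      rw [iteratedDeriv_succ]
      exact this.hasDerivAt
    rw [h2]
    refine ((hJ.tendsto _).comp (hasDerivAt_iff_tendsto_slope.1 hd)).congr' ?_
    filter_upwards [nhdsWithin_le_nhds h1] with s hs
    simp only [Function.comp, slope_def_module]
    rw [hs, h1.self_of_nhds, map_smul, map_sub]

/-- A curve which locally, to any finite order, comes from a differentiable family on an annulus is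
smooth: by Cauchy's formula it is the image of a `C^k` curve under the continuous linear map
`cauchyO`. -/
theorem isSmoothCurve_of_holFam {c : ℝ → OCircle}
    (h : ∀ (t₀ : ℝ) (k : ℕ), ∃ R : ℝ, 1 < R ∧ ∃ Γ, HolFam k t₀ R⁻¹ R Γ ∧
      ∀ᶠ t in 𝓝 t₀, ∀ z : Circle, c t z = Γ t z) : IsSmoothCurve c := by
  refine isSmoothCurve_of_locally (E := C(Circle, ℂ) × C(Circle, ℂ)) fun t₀ k => ?_
  obtain ⟨R, hR, Γ, hΓ, hc⟩ := h t₀ k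
  obtain ⟨τ, hτ1, hτR⟩ := exists_between hR
  obtain ⟨s, hs1, hsτ⟩ := exists_between hτ1
  obtain ⟨m, hm⟩ := exists_annulus_subset_closedAnn hs1
  have hτ0 : 0 < τ := by linarith
  have h1 : R⁻¹ < τ⁻¹ := inv_strictAnti₀ hτ0 hτR
  have h2 : τ⁻¹ < 1 := inv_lt_one_of_one_lt₀ hτ1
  refine ⟨cauchyO hs1 hsτ hm, fun t => (onC τ (Γ t), onC τ⁻¹ (Γ t)),
    (continuous_restrictCircle m).comp (continuous_cauchyAnnulus hs1 hsτ hm),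
    (hΓ.smooth τ ⟨by linarith, hτR⟩).prodMk (hΓ.smooth τ⁻¹ ⟨h1, by linarith⟩), ?_⟩
  filter_upwards [hc, hΓ.diff] with t ht hd
  refine OCircle.ext fun z => ?_
  rw [ht z]
  exact (cauchyOp_onC hs1 hsτ hτR hd (inclusion hm ⟨z, circle_mem_annulus m z⟩)).symm

/-! ### Differentiable families of continuous functions -/

section Inverse

variable {X : Type*} [TopologicalSpace X] [CompactSpace X]

theorem exp_continuousMap_apply (f : C(X, ℂ)) (x : X) :
    NormedSpace.exp f x = Complex.exp (f x) := by
  rw [Complex.exp_eq_exp_ℂ]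
  exact NormedSpace.map_exp (ContinuousMap.evalAlgHom ℂ ℂ x) (continuous_eval_const (F := C(X, ℂ)) x) f

theorem contDiff_exp_continuousMap {k : ℕ∞ω} : ContDiff ℝ k (NormedSpace.exp : C(X, ℂ) → C(X, ℂ)) :=
  contDiff_iff_contDiffAt.2 fun x => (NormedSpace.exp_analytic (𝕂 := ℝ) x).contDiffAt

omit [CompactSpace X] in
theorem ringInverse_apply {f : C(X, ℂ)} (hf : ∀ x, f x ≠ 0) (x : X) :
    Ring.inverse f x = (f x)⁻¹ := by
  have h := congrArg (fun g : C(X, ℂ) => g x)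
    (Ring.mul_inverse_cancel f (ContinuousMap.isUnit_iff_forall_ne_zero f |>.2 hf))
  exact eq_inv_of_mul_eq_one_right h

end Inverse

/-- A family of complex functions on `X` which, near `t₀`, is a `C^k` curve in `C(X, ℂ)`. -/
def SmoothFam {X : Type*} [TopologicalSpace X] [CompactSpace X] (k : ℕ) (t₀ : ℝ) (G : ℝ → X → ℂ) :
    Prop :=
  ∃ F : ℝ → C(X, ℂ), ContDiffAt ℝ k F t₀ ∧ ∀ᶠ t in 𝓝 t₀, ∀ x, F t x = G t x

namespace SmoothFam

variable {X Y : Type*} [TopologicalSpace X] [CompactSpace X] [TopologicalSpace Y] [CompactSpace Y]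
  {k : ℕ} {t₀ : ℝ} {G H : ℝ → X → ℂ}

theorem congr (hG : SmoothFam k t₀ G) (h : ∀ᶠ t in 𝓝 t₀, ∀ x, H t x = G t x) :
    SmoothFam k t₀ H := by
  obtain ⟨F, hF, hFG⟩ := hG
  refine ⟨F, hF, ?_⟩
  filter_upwards [hFG, h] with t h1 h2 x
  rw [h1, h2]

theorem of_continuous {g : X → ℂ} (hg : Continuous g) : SmoothFam k t₀ fun _ => g :=
  ⟨fun _ => ⟨g, hg⟩, contDiffAt_const, Eventually.of_forall fun _ _ => rfl⟩

theorem add (hG : SmoothFam k t₀ G) (hH : SmoothFam k t₀ H) :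
    SmoothFam k t₀ fun t x => G t x + H t x := by
  obtain ⟨A, hA, hAG⟩ := hG
  obtain ⟨B, hB, hBH⟩ := hH
  refine ⟨_, hA.add hB, ?_⟩
  filter_upwards [hAG, hBH] with t h1 h2 x
  rw [← h1, ← h2]; rfl

theorem sub (hG : SmoothFam k t₀ G) (hH : SmoothFam k t₀ H) :
    SmoothFam k t₀ fun t x => G t x - H t x := by
  obtain ⟨A, hA, hAG⟩ := hG
  obtain ⟨B, hB, hBH⟩ := hH
  refine ⟨_, hA.sub hB, ?_⟩
  filter_upwards [hAG, hBH] with t h1 h2 x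
  rw [← h1, ← h2]; rfl

theorem mul (hG : SmoothFam k t₀ G) (hH : SmoothFam k t₀ H) :
    SmoothFam k t₀ fun t x => G t x * H t x := by
  obtain ⟨A, hA, hAG⟩ := hG
  obtain ⟨B, hB, hBH⟩ := hH
  refine ⟨_, hA.mul hB, ?_⟩
  filter_upwards [hAG, hBH] with t h1 h2 x
  rw [← h1, ← h2]; rfl

theorem star (hG : SmoothFam k t₀ G) : SmoothFam k t₀ fun t x => (starRingEnd ℂ) (G t x) := by
  obtain ⟨A, hA, hAG⟩ := hG
  refine ⟨_, (starL' ℝ : C(X, ℂ) ≃L[ℝ] C(X, ℂ)).contDiff.contDiffAt.comp t₀ hA, ?_⟩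
  filter_upwards [hAG] with t h1 x
  rw [← h1]; rfl

theorem comp (hG : SmoothFam k t₀ G) {p : Y → X} (hp : Continuous p) :
    SmoothFam k t₀ fun t y => G t (p y) := by
  obtain ⟨A, hA, hAG⟩ := hG
  refine ⟨_, (ContinuousMap.compCLM ℝ ℂ (⟨p, hp⟩ : C(Y, X))).contDiff.contDiffAt.comp t₀ hA, ?_⟩
  filter_upwards [hAG] with t h1 y
  rw [← h1]; rfl

theorem exp (hG : SmoothFam k t₀ G) : SmoothFam k t₀ fun t x => Complex.exp (G t x) := by
  obtain ⟨A, hA, hAG⟩ := hG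
  refine ⟨_, contDiff_exp_continuousMap.contDiffAt.comp t₀ hA, ?_⟩
  filter_upwards [hAG] with t h1 x
  rw [← h1]; exact exp_continuousMap_apply _ _

/-- An open condition satisfied by all the values for `t = t₀` remains so nearby. -/
theorem eventually_forall_mem (hG : SmoothFam k t₀ G) {U : Set ℂ} (hU : IsOpen U)
    (h0 : ∀ x, G t₀ x ∈ U) : ∀ᶠ t in 𝓝 t₀, ∀ x, G t x ∈ U := by
  obtain ⟨A, hA, hAG⟩ := hG
  have h1 : {f : C(X, ℂ) | MapsTo f univ U} ∈ 𝓝 (A t₀) :=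
    (ContinuousMap.isOpen_setOfPred_mapsTo isCompact_univ hU).mem_nhds fun x _ => by
      rw [hAG.self_of_nhds]; exact h0 x
  filter_upwards [hAG, hA.continuousAt h1] with t h2 h3 x
  rw [← h2]
  exact h3 (mem_univ x)

theorem eventually_ne_zero (hG : SmoothFam k t₀ G) (h0 : ∀ x, G t₀ x ≠ 0) :
    ∀ᶠ t in 𝓝 t₀, ∀ x, G t x ≠ 0 :=
  hG.eventually_forall_mem isOpen_compl_singleton h0

theorem inv (hG : SmoothFam k t₀ G) (h0 : ∀ x, G t₀ x ≠ 0) : SmoothFam k t₀ fun t x => (G t x)⁻¹ := by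
  have hne := hG.eventually_ne_zero h0
  obtain ⟨A, hA, hAG⟩ := hG
  obtain ⟨u, hu⟩ := (ContinuousMap.isUnit_iff_forall_ne_zero (A t₀)).2 fun x => by
    rw [hAG.self_of_nhds]; exact h0 x
  have hi : ContDiffAt ℝ k Ring.inverse (A t₀) := hu ▸ contDiffAt_ringInverse ℝ u
  refine ⟨fun t => Ring.inverse (A t), hi.comp t₀ hA, ?_⟩
  filter_upwards [hAG, hne] with t h1 h2 x
  rw [← h1, ringInverse_apply fun x => by rw [h1]; exact h2 x]

theorem div (hG : SmoothFam k t₀ G) (hH : SmoothFam k t₀ H) (h0 : ∀ x, H t₀ x ≠ 0) :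
    SmoothFam k t₀ fun t x => G t x / H t x := by
  simpa only [div_eq_mul_inv] using hG.mul (hH.inv h0)

/-- The logarithm of a family is differentiable, since the exponential function of the Banach algebra
`C(X, ℂ)` has a differentiable local inverse. -/
theorem log (hG : SmoothFam k t₀ G) (h0 : ∀ x, 0 < (G t₀ x).re) :
    SmoothFam k t₀ fun t x => Complex.log (G t x) := by
  obtain ⟨A, hA, hAG⟩ := hG
  have h0' : ∀ x, 0 < (A t₀ x).re := fun x => by rw [hAG.self_of_nhds]; exact h0 x
  have hslit : ∀ x, A t₀ x ∈ Complex.slitPlane := fun x => Or.inl (h0' x)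
  set L : C(X, ℂ) := ⟨fun x => Complex.log (A t₀ x), (A t₀).continuous.clog hslit⟩ with hL
  have hexp : NormedSpace.exp L = A t₀ := by
    ext x
    rw [exp_continuousMap_apply]
    exact Complex.exp_log (Complex.slitPlane_ne_zero (hslit x))
  obtain ⟨u, hu⟩ := (ContinuousMap.isUnit_iff_forall_ne_zero (NormedSpace.exp L)).2 fun x => by
    rw [exp_continuousMap_apply]; exact Complex.exp_ne_zero _
  let e : C(X, ℂ) ≃L[ℝ] C(X, ℂ) := ContinuousLinearEquiv.smulLeft u
  have hs : HasStrictFDerivAt (NormedSpace.exp : C(X, ℂ) → C(X, ℂ)) (e : C(X, ℂ) →L[ℝ] C(X, ℂ)) L := by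
    have he : (e : C(X, ℂ) →L[ℝ] C(X, ℂ)) = NormedSpace.exp L • (1 : C(X, ℂ) →L[ℝ] C(X, ℂ)) := by
      ext1 f
      change (u : C(X, ℂ)) * f = _
      rw [hu]
      rfl
    rw [he]
    exact hasStrictFDerivAt_exp (𝕂 := ℝ) (x := L)
  set P := hs.toOpenPartialHomeomorph NormedSpace.exp with hP
  have hLs : L ∈ P.source := hs.mem_toOpenPartialHomeomorph_source
  have hAt : A t₀ ∈ P.target := hexp ▸ P.map_source hLs
  have hPL : P.symm (A t₀) = L := by rw [← hexp]; exact P.left_inv hLs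
  have hsymm : ContDiffAt ℝ k P.symm (A t₀) := by
    refine P.contDiffAt_symm hAt (f₀' := e) ?_ ?_
    · rw [hPL]; exact hs.hasFDerivAt
    · exact contDiff_exp_continuousMap.contDiffAt
  have hc : ContDiffAt ℝ k (fun t => P.symm (A t)) t₀ := hsymm.comp t₀ hA
  refine ⟨_, hc, ?_⟩
  -- The imaginary part of the continuous local inverse stays in `(-π, π)`, so it is the logarithm.
  have him : ∀ᶠ t in 𝓝 t₀, ∀ x, P.symm (A t) x ∈ {w : ℂ | -Real.pi < w.im ∧ w.im < Real.pi} := by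
    refine eventually_forall_mem ⟨_, hc, Eventually.of_forall fun _ _ => rfl⟩
      ((isOpen_lt continuous_const Complex.continuous_im).inter
        (isOpen_lt Complex.continuous_im continuous_const)) fun x => ?_
    rw [hPL]
    have h1 := abs_lt.1 ((Complex.abs_arg_lt_pi_div_two_iff.2 (Or.inl (h0' x))))
    have hpi := Real.pi_pos
    change -Real.pi < (Complex.log (A t₀ x)).im ∧ (Complex.log (A t₀ x)).im < Real.pi
    rw [Complex.log_im]
    constructor <;> linarith
  filter_upwards [hAG, him, hA.continuousAt (P.open_target.mem_nhds hAt)] with t h1 h2 h3 x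
  have h4 : NormedSpace.exp (P.symm (A t)) = A t := P.right_inv h3
  have h5 : Complex.exp (P.symm (A t) x) = G t x := by
    rw [← exp_continuousMap_apply, h4, h1]
  rw [← h5, Complex.log_exp (h2 x).1 (h2 x).2.le]

/-- Contour integrals of a differentiable family of integrands. -/
theorem cint {σ : ℝ} {F : ℝ → X → ℂ → ℂ}
    (hF : SmoothFam (X := X × Circle) k t₀ fun t q => F t q.1 (σ * q.2)) :
    SmoothFam k t₀ fun t x => CDef.cint σ (F t x) := by
  obtain ⟨A, hA, hAF⟩ := (of_continuous (X := X × Circle) (g := fun q => (σ : ℂ) * q.2)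
    (by fun_prop)).mul hF
  refine ⟨_, contDiffAt_kernelOp hA (contDiffAt_const (c := 1)), ?_⟩
  filter_upwards [hAF] with t h1 x
  refine kernelOp_eq_cint _ _ _ fun ζ => ?_
  rw [h1, ContinuousMap.one_apply, mul_one]

/-- Cauchy integrals along a moving curve, with moving density and at moving points. -/
theorem CT {σ : ℝ} {Φ f : ℝ → ℂ → ℂ} {p : ℝ → X → ℂ}
    (hΦ : SmoothFam (X := Circle) k t₀ fun t ζ => Φ t (σ * ζ))
    (hΦ' : SmoothFam (X := Circle) k t₀ fun t ζ => deriv (Φ t) (σ * ζ))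
    (hf : SmoothFam (X := Circle) k t₀ fun t ζ => f t (σ * ζ)) (hp : SmoothFam k t₀ p)
    (h0 : ∀ x (ζ : Circle), Φ t₀ (σ * ζ) ≠ p t₀ x) :
    SmoothFam k t₀ fun t x => CDef.CT (Φ t) σ (f t) (p t x) :=
  cint ((((hf.comp continuous_snd).mul (hΦ'.comp continuous_snd)).div
    ((hΦ.comp continuous_snd).sub (hp.comp continuous_fst))
      fun q => sub_ne_zero.2 (h0 q.1 q.2)))

end SmoothFam

/-! ### Calculus of differentiable families of holomorphic functions -/

namespace HolFam

variable {k : ℕ} {t₀ a b R s : ℝ} {Γ Δ : ℝ → ℂ → ℂ}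

theorem smoothFam (h : HolFam k t₀ a b Γ) (ha : 0 ≤ a) {ρ : ℝ} (hρ : ρ ∈ Ioo a b) :
    SmoothFam (X := Circle) k t₀ fun t z => Γ t (ρ * z) := by
  refine ⟨_, h.smooth ρ hρ, ?_⟩
  filter_upwards [h.diff] with t ht z
  exact onC_apply (ha.trans_lt hρ.1) (ht.continuousOn.mono (sphere_subset_ann hρ.1 hρ.2)) z

theorem of_smoothFam (hd : ∀ᶠ t in 𝓝 t₀, DifferentiableOn ℂ (Γ t) (ann a b))
    (hs : ∀ ρ ∈ Ioo a b, SmoothFam (X := Circle) k t₀ fun t z => Γ t (ρ * z)) :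
    HolFam k t₀ a b Γ := by
  refine ⟨hd, fun ρ hρ => ?_⟩
  obtain ⟨F, hF, hFG⟩ := hs ρ hρ
  refine hF.congr_of_eventuallyEq ?_
  filter_upwards [hFG] with t ht
  exact onC_eq _ fun z => (ht z).symm

theorem mono (h : HolFam k t₀ a b Γ) {a' b' : ℝ} (ha : a ≤ a') (hb : b' ≤ b) :
    HolFam k t₀ a' b' Γ :=
  ⟨h.diff.mono fun _ ht => ht.mono (ann_mono ha hb),
    fun ρ hρ => h.smooth ρ ⟨ha.trans_lt hρ.1, hρ.2.trans_le hb⟩⟩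

theorem const {f : ℂ → ℂ} (ha : 0 ≤ a) (hf : DifferentiableOn ℂ f (ann a b)) :
    HolFam k t₀ a b fun _ => f :=
  of_smoothFam (Eventually.of_forall fun _ => hf) fun ρ hρ => SmoothFam.of_continuous <|
    hf.continuousOn.comp_continuous (by fun_prop) fun z => by
      rw [mem_ann, norm_mul_circle (ha.trans_lt hρ.1)]; exact hρ

theorem add (ha : 0 ≤ a) (h : HolFam k t₀ a b Γ) (h' : HolFam k t₀ a b Δ) :
    HolFam k t₀ a b fun t z => Γ t z + Δ t z :=
  of_smoothFam (h.diff.and h'.diff |>.mono fun _ ht => ht.1.add ht.2) fun _ hρ =>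
    (h.smoothFam ha hρ).add (h'.smoothFam ha hρ)

theorem sub (ha : 0 ≤ a) (h : HolFam k t₀ a b Γ) (h' : HolFam k t₀ a b Δ) :
    HolFam k t₀ a b fun t z => Γ t z - Δ t z :=
  of_smoothFam (h.diff.and h'.diff |>.mono fun _ ht => ht.1.sub ht.2) fun _ hρ =>
    (h.smoothFam ha hρ).sub (h'.smoothFam ha hρ)

theorem mul (ha : 0 ≤ a) (h : HolFam k t₀ a b Γ) (h' : HolFam k t₀ a b Δ) :
    HolFam k t₀ a b fun t z => Γ t z * Δ t z :=
  of_smoothFam (h.diff.and h'.diff |>.mono fun _ ht => ht.1.mul ht.2) fun _ hρ =>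
    (h.smoothFam ha hρ).mul (h'.smoothFam ha hρ)

theorem exp (ha : 0 ≤ a) (h : HolFam k t₀ a b Γ) : HolFam k t₀ a b fun t z => Complex.exp (Γ t z) :=
  of_smoothFam (h.diff.mono fun _ ht => ht.cexp) fun _ hρ => (h.smoothFam ha hρ).exp

theorem circleConj (ha : 0 < a) (hb : 0 < b) (h : HolFam k t₀ a b Γ) :
    HolFam k t₀ b⁻¹ a⁻¹ fun t => circleConj (Γ t) := by
  refine of_smoothFam (h.diff.mono fun t ht z hz => ?_) fun ρ hρ => ?_
  · have hz0 : z ≠ 0 := norm_pos_iff.1 ((inv_pos.2 hb).trans hz.1)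
    exact (differentiableAt_circleConj hz0 (ht.differentiableAt
      ((isOpen_ann a b).mem_nhds (conj_inv_mem_ann ha hb hz)))).differentiableWithinAt
  · have hρ0 : 0 < ρ := (inv_pos.2 hb).trans hρ.1
    have h1 : ρ⁻¹ ∈ Ioo a b :=
      ⟨(lt_inv_comm₀ hρ0 ha).1 hρ.2, (inv_lt_comm₀ hb hρ0).1 hρ.1⟩
    refine (h.smoothFam ha.le h1).star.congr (Eventually.of_forall fun t z => ?_)
    have e : (starRingEnd ℂ (ρ * z))⁻¹ = ((ρ⁻¹ : ℝ) : ℂ) * z := by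
      rw [map_mul, Complex.conj_ofReal, mul_inv, ← Circle.coe_inv_eq_conj, Circle.coe_inv, inv_inv]
      push_cast; rfl
    simp only [CDef.circleConj, e]

section ClosedAnnulus

variable (h : HolFam k t₀ R⁻¹ R Γ) (hs : 1 < s) (hsR : s < R)
include h hs hsR

/-- By Cauchy's formula, the family is also differentiable uniformly on closed annuli. -/
theorem smoothFam_closedAnn : SmoothFam (X := closedAnn s) k t₀ fun t z => Γ t z := by
  obtain ⟨τ, hsτ, hτR⟩ := exists_between hsR
  have hτ0 : 0 < τ := by linarith
  have h1 : R⁻¹ < τ⁻¹ := inv_strictAnti₀ hτ0 hτR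
  have h2 : τ⁻¹ < 1 := inv_lt_one_of_one_lt₀ (by linarith)
  refine ⟨_, ((cauchyOp hs hsτ).restrictScalars ℝ).contDiff.contDiffAt.comp t₀
    ((h.smooth τ ⟨by linarith, hτR⟩).prodMk (h.smooth τ⁻¹ ⟨h1, by linarith⟩)), ?_⟩
  filter_upwards [h.diff] with t ht z
  exact cauchyOp_onC hs hsτ hτR ht z

/-- The divided differences depend differentiably on the parameter, uniformly in both arguments, by
Cauchy's formula for `dslope (Γ t) z`. This includes the diagonal, where they are the derivatives.
-/
theorem smoothFam_dslope : SmoothFam (X := closedAnn s × closedAnn s) k t₀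
    fun t q => dslope (Γ t) q.1 q.2 := by
  obtain ⟨τ, hsτ, hτR⟩ := exists_between hsR
  have hs0 : 0 < s := by linarith
  have hτ0 : 0 < τ := by linarith
  have hR0 : 0 < R := by linarith
  have h1 : R⁻¹ < τ⁻¹ := inv_strictAnti₀ hτ0 hτR
  have h2 : τ⁻¹ < s⁻¹ := inv_strictAnti₀ hs0 hsτ
  have h3 : s⁻¹ < 1 := inv_lt_one_of_one_lt₀ hs
  have hz := h.smoothFam_closedAnn hs hsR
  have hout : ∀ (z : closedAnn s) (ζ : Circle), (τ : ℂ) * ζ - z ≠ 0 := closedAnn_ne_outer hs hsτ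
  have hin : ∀ (z : closedAnn s) (ζ : Circle), ((τ⁻¹ : ℝ) : ℂ) * ζ - z ≠ 0 :=
    closedAnn_ne_inner hs hsτ
  -- The integrand of Cauchy's formula for `dslope (Γ t) q.1` at the point `q.2`.
  have key : ∀ ρ ∈ Ioo R⁻¹ R, (∀ (z : closedAnn s) (ζ : Circle), (ρ : ℂ) * ζ - z ≠ 0) →
      SmoothFam (X := closedAnn s × closedAnn s) k t₀ fun t q =>
        cint ρ fun ζ => (Γ t ζ - Γ t q.1) / ((ζ - q.1) * (ζ - q.2)) := by
    intro ρ hρ hne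
    refine SmoothFam.cint ((((h.smoothFam (inv_pos.2 hR0).le hρ).comp continuous_snd).sub
      (hz.comp (continuous_fst.comp continuous_fst))).div
        (SmoothFam.of_continuous (X := (closedAnn s × closedAnn s) × Circle)
          (g := fun q => ((ρ : ℂ) * q.2 - q.1.1) * ((ρ : ℂ) * q.2 - q.1.2)) (by fun_prop)) ?_)
    exact fun q => mul_ne_zero (hne _ _) (hne _ _)
  refine ((key τ ⟨by linarith, hτR⟩ hout).sub (key τ⁻¹ ⟨h1, by linarith⟩ hin)).congr ?_
  filter_upwards [h.diff] with t ht q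
  have hq : (q.1 : ℂ) ∈ ann R⁻¹ R := ⟨(h1.trans h2).trans_le q.1.2.1, q.1.2.2.trans_lt hsR⟩
  have hd : DifferentiableOn ℂ (dslope (Γ t) q.1) (ann R⁻¹ R) :=
    (Complex.differentiableOn_dslope ((isOpen_ann _ _).mem_nhds hq)).2 ht
  have hsl : ∀ ζ : ℂ, ζ - q.1 ≠ 0 → dslope (Γ t) q.1 ζ / (ζ - q.2) =
      (Γ t ζ - Γ t q.1) / ((ζ - q.1) * (ζ - q.2)) := by
    intro ζ hζ
    rw [dslope_of_ne _ (sub_ne_zero.1 hζ), slope_def_field, div_div]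
  rw [← cint_cauchy_annulus (inv_pos.2 hR0).le h1 hτR hd (z := q.2)
    (h2.trans_le q.2.2.1) (q.2.2.2.trans_lt hsτ)]
  congr 1
  · refine cint_congr hτ0.le fun ζ hζ => hsl ζ ?_
    obtain ⟨w, rfl⟩ := exists_circle_mul hτ0 hζ
    exact hout _ _
  · refine cint_congr (inv_pos.2 hτ0).le fun ζ hζ => hsl ζ ?_
    obtain ⟨w, rfl⟩ := exists_circle_mul (inv_pos.2 hτ0) hζ
    exact hin _ _

end ClosedAnnulus

/-- The derivative is the restriction of the divided differences to the diagonal. -/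
theorem deriv (h : HolFam k t₀ R⁻¹ R Γ) (hR : 1 < R) :
    HolFam k t₀ R⁻¹ R fun t => deriv (Γ t) := by
  refine of_smoothFam (h.diff.mono fun t ht => ht.deriv (isOpen_ann _ _)) fun ρ hρ => ?_
  have hρ0 : 0 < ρ := (inv_pos.2 (by linarith)).trans hρ.1
  have hρR : ρ⁻¹ < R := (inv_lt_comm₀ (by linarith) hρ0).1 hρ.1
  obtain ⟨s, hs, hsR⟩ := exists_between (max_lt hR (max_lt hρ.2 hρR))
  have hs1 : 1 < s := (le_max_left _ _).trans_lt hs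
  have hsρ : ρ < s := ((le_max_left _ _).trans (le_max_right _ _)).trans_lt hs
  have hsρ' : s⁻¹ < ρ :=
    (inv_lt_comm₀ hρ0 (by linarith)).1 (((le_max_right _ _).trans (le_max_right _ _)).trans_lt hs)
  have hmem : ∀ z : Circle, (ρ : ℂ) * z ∈ closedAnn s := fun z => by
    change s⁻¹ ≤ ‖(ρ : ℂ) * z‖ ∧ ‖(ρ : ℂ) * z‖ ≤ s
    rw [norm_mul_circle hρ0]
    exact ⟨hsρ'.le, hsρ.le⟩
  have hp : Continuous fun z : Circle => (⟨ρ * z, hmem z⟩ : closedAnn s) := by fun_prop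
  refine ((h.smoothFam_dslope hs1 hsR).comp (hp.prodMk hp)).congr
    (Eventually.of_forall fun t z => ?_)
  exact (dslope_same _ _).symm

/-- Embeddings of annuli are stable under small perturbations: injectivity and nonvanishing derivative
together say that the divided differences have no zeros on a product of compact annuli. -/
theorem eventually_niceMap (h : HolFam k t₀ R⁻¹ R Γ) (hn : NiceMap R⁻¹ R (Γ t₀)) (hs : 1 < s)
    (hsR : s < R) (hw : ∀ᶠ t in 𝓝 t₀, CT (Γ t) 1 (fun _ => 1) 0 = 1) :
    ∀ᶠ t in 𝓝 t₀, NiceMap s⁻¹ s (Γ t) := by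
  have hs0 : 0 < s := by linarith
  have hsub : closedAnn s ⊆ ann R⁻¹ R := fun z hz =>
    ⟨(inv_strictAnti₀ hs0 hsR).trans_le hz.1, hz.2.trans_lt hsR⟩
  have hsub' : ann s⁻¹ s ⊆ closedAnn s := fun z hz => ⟨hz.1.le, hz.2.le⟩
  have h1 := (h.smoothFam_closedAnn hs hsR).eventually_ne_zero fun z => hn.ne_zero z (hsub z.2)
  have h2 := (h.smoothFam_dslope hs hsR).eventually_ne_zero fun q => by
    by_cases e : (q.2 : ℂ) = q.1
    · rw [e, dslope_same]
      exact hn.deriv_ne _ (hsub q.1.2)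
    · rw [dslope_of_ne _ e, slope_def_field]
      exact div_ne_zero (sub_ne_zero.2 fun e' => e (hn.inj (hsub q.2.2) (hsub q.1.2) e'))
        (sub_ne_zero.2 e)
  filter_upwards [h1, h2, h.diff, hw] with t ht1 ht2 ht3 ht4
  refine ⟨inv_pos.2 hs0, inv_lt_one_of_one_lt₀ hs, hs, ht3.mono (hsub'.trans hsub), ?_,
    fun z hz => ht1 ⟨z, hsub' hz⟩, fun z hz => ?_, ht4⟩
  · intro z hz w hw e
    by_contra hne
    refine ht2 (⟨z, hsub' hz⟩, ⟨w, hsub' hw⟩) ?_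
    rw [dslope_of_ne _ (Ne.symm hne), slope_def_field, e, sub_self, zero_div]
  · rw [← dslope_same]
    exact ht2 (⟨z, hsub' hz⟩, ⟨z, hsub' hz⟩)

/-- The logarithm of a family with values in the right half plane at `t₀`, on a smaller annulus on
which the values remain there for nearby parameters. -/
theorem log (hs : 1 < s) (hsR : s < R) (h : HolFam k t₀ R⁻¹ R Γ)
    (h0 : ∀ z ∈ ann R⁻¹ R, 0 < (Γ t₀ z).re) :
    HolFam k t₀ s⁻¹ s fun t z => Complex.log (Γ t z) := by
  have hs0 : 0 < s := by linarith
  have hsub : closedAnn s ⊆ ann R⁻¹ R := fun z hz =>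
    ⟨(inv_strictAnti₀ hs0 hsR).trans_le hz.1, hz.2.trans_lt hsR⟩
  have hsub' : ann s⁻¹ s ⊆ closedAnn s := fun z hz => ⟨hz.1.le, hz.2.le⟩
  have h1 := (h.smoothFam_closedAnn hs hsR).eventually_forall_mem
    (isOpen_lt continuous_const Complex.continuous_re) fun z => h0 z (hsub z.2)
  refine of_smoothFam ?_ fun ρ hρ => ?_
  · filter_upwards [h1, h.diff] with t ht1 ht2
    exact (ht2.mono (hsub'.trans hsub)).clog fun z hz => Or.inl (ht1 ⟨z, hsub' hz⟩)
  · have hρ0 : 0 < ρ := (inv_pos.2 hs0).trans hρ.1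
    refine SmoothFam.log (h.smoothFam (inv_pos.2 (by linarith)).le
      ⟨(inv_strictAnti₀ hs0 hsR).trans hρ.1, hρ.2.trans hsR⟩) fun z => h0 _ (hsub (hsub' ?_))
    rw [mem_ann, norm_mul_circle hρ0]
    exact hρ

end HolFam

/-! ### Extensions of families of complex deformations to a fixed annulus -/

theorem circle_of_norm {z : ℂ} (hz : ‖z‖ = 1) : ∃ w : Circle, z = w :=
  ⟨⟨z, mem_sphere_zero_iff_norm.2 hz⟩, rfl⟩

/-- A neighbourhood of the unit circle contains an annulus symmetric under reflection in the circle.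
-/
theorem exists_symm_ann_subset {U : Set ℂ} (hU : IsOpen U) (h : Metric.sphere (0 : ℂ) 1 ⊆ U)
    {B : ℝ} (hB : 1 < B) : ∃ R, 1 < R ∧ R ≤ B ∧ ann R⁻¹ R ⊆ U := by
  obtain ⟨δ, hδ, hsub⟩ := exists_ann_subset_of_isOpen hU one_pos h
  refine ⟨min B (1 + δ), lt_min hB (by linarith), min_le_left _ _, fun z hz => hsub z ?_⟩
  have h2 : ‖z‖ < 1 + δ := hz.2.trans_le (min_le_right _ _)
  have h1 : (1 + δ)⁻¹ < ‖z‖ := (inv_anti₀ (lt_min (by linarith) (by linarith))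
    (min_le_right _ _)).trans_lt hz.1
  have h3 : 1 - δ ≤ (1 + δ)⁻¹ := by
    rw [← one_div, le_div_iff₀ (by linarith)]
    nlinarith
  rw [abs_lt]
  constructor <;> linarith

section Extension

variable {R : ℝ} {F : ℂ → ℂ} {φ : OCircle}

theorem differentiableAt_of_norm_eq_one (hR : 1 < R) (hF : DifferentiableOn ℂ F (ann R⁻¹ R)) {z : ℂ}
    (hz : ‖z‖ = 1) : DifferentiableAt ℂ F z :=
  hF.differentiableAt ((isOpen_ann _ _).mem_nhds
    (by rw [mem_ann, hz]; exact ⟨inv_lt_one_of_one_lt₀ hR, hR⟩))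

theorem IsComplexDeformation.CT_eq_one (hφ : IsComplexDeformation φ) (hR : 1 < R)
    (hF : DifferentiableOn ℂ F (ann R⁻¹ R)) (h : ∀ z : Circle, F z = φ z) :
    CT F 1 (fun _ => 1) 0 = 1 := by
  rw [← windingNumber_restrict fun z hz => differentiableAt_of_norm_eq_one hR hF hz, ← hφ.winding]
  congr 1
  exact funext h

/-- A holomorphic extension of a complex deformation is an embedding of a thinner annulus. -/
theorem IsComplexDeformation.exists_niceMap (hφ : IsComplexDeformation φ) (hR : 1 < R)
    (hF : DifferentiableOn ℂ F (ann R⁻¹ R)) (h : ∀ z : Circle, F z = φ z) :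
    ∃ a' ∈ Ioo R⁻¹ 1, ∃ b' ∈ Ioo 1 R, NiceMap a' b' F := by
  refine CDef.exists_niceMap (inv_pos.2 (by linarith)) (inv_lt_one_of_one_lt₀ hR) hR hF ?_ ?_ ?_
    (hφ.CT_eq_one hR hF h)
  · intro z hz w hw e
    obtain ⟨z, rfl⟩ := circle_of_norm (mem_sphere_zero_iff_norm.1 hz)
    obtain ⟨w, rfl⟩ := circle_of_norm (mem_sphere_zero_iff_norm.1 hw)
    rw [h, h] at e
    rw [hφ.injective e]
  · intro z hz
    obtain ⟨z, rfl⟩ := circle_of_norm hz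
    rw [h]
    exact hφ.ne_zero z
  · intro z hz e
    obtain ⟨z, rfl⟩ := circle_of_norm hz
    have hz' : (Circle.exp (Complex.arg z) : Circle) = z := Circle.exp_arg z
    refine hφ.immersion (Complex.arg z) ?_
    rw [← show (fun z : Circle => F z) = φ from funext h, angDeriv_restrict (by
      rw [hz']; exact differentiableAt_of_norm_eq_one hR hF hz), hz', e, zero_mul]

end Extension

/-- A smooth curve of complex deformations extends locally to a differentiable family of embeddings
of a fixed annulus. The function `-log |Φ|` on the circle is the real part of a holomorphic function
near the circle, namely of `-½ Log (Φ Φ*)`. -/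
theorem exists_extension_family {γ : ℝ → DefC} (hγ : IsSmoothCurve fun t => (γ t).1) (t₀ : ℝ) (k : ℕ) :
    ∃ R : ℝ, 1 < R ∧ ∃ Φ U : ℝ → ℂ → ℂ, HolFam k t₀ R⁻¹ R Φ ∧ HolFam k t₀ R⁻¹ R U ∧
      ∀ᶠ t in 𝓝 t₀, NiceMap R⁻¹ R (Φ t) ∧ (∀ z, ‖z‖ = 1 → (U t z).re = -Real.log ‖Φ t z‖) ∧
        ∀ z : Circle, (γ t).1 z = Φ t z := by
  obtain ⟨R₀, hR₀, Φ, hΦ, hΦγ⟩ := hγ.exists_holFam t₀ k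
  have hR₀0 : 0 < R₀ := by linarith
  obtain ⟨a', ha', b', hb', hn⟩ := (γ t₀).2.exists_niceMap hR₀ hΦ.diff.self_of_nhds
    hΦγ.self_of_nhds
  have hprod : HolFam k t₀ R₀⁻¹ R₀ fun t z => Φ t z * circleConj (Φ t) z :=
    hΦ.mul (inv_pos.2 hR₀0).le (by simpa using hΦ.circleConj (inv_pos.2 hR₀0) hR₀0)
  have hsq : ∀ t z, ‖z‖ = 1 → Φ t z * circleConj (Φ t) z = ((‖Φ t z‖ ^ 2 : ℝ) : ℂ) := by
    intro t z hz
    rw [circleConj_of_norm_eq_one _ hz, Complex.mul_conj, Complex.normSq_eq_norm_sq]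
  -- On the circle `Φ Φ* = |Φ|²` is positive, so its real part is positive on an annulus.
  set V : Set ℂ := ann R₀⁻¹ R₀ ∩
    (fun z => Φ t₀ z * circleConj (Φ t₀) z) ⁻¹' {w | 0 < w.re} with hV
  have hVo : IsOpen V := hprod.diff.self_of_nhds.continuousOn.isOpen_inter_preimage
    (isOpen_ann _ _) (isOpen_lt continuous_const Complex.continuous_re)
  have hVs : Metric.sphere (0 : ℂ) 1 ⊆ V := by
    intro z hz
    have hz1 : ‖z‖ = 1 := by simpa using hz
    refine ⟨sphere_subset_ann (inv_lt_one_of_one_lt₀ hR₀) hR₀ hz, ?_⟩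
    change 0 < (Φ t₀ z * circleConj (Φ t₀) z).re
    rw [hsq _ _ hz1, Complex.ofReal_re]
    have := norm_pos_iff.2 (hn.ne_zero z (sphere_subset_ann ha'.2 hb'.1 hz))
    positivity
  have ha0 : 0 < a' := hn.pos
  obtain ⟨R₁, hR₁, hR₁B, hR₁V⟩ := exists_symm_ann_subset hVo hVs
    (lt_min hR₀ (lt_min hb'.1 ((one_lt_inv₀ ha0).2 ha'.2)))
  have hle0 : R₁ ≤ R₀ := hR₁B.trans (min_le_left _ _)
  have hleb : R₁ ≤ b' := hR₁B.trans ((min_le_right _ _).trans (min_le_left _ _))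
  have hlea : a' ≤ R₁⁻¹ := (le_inv_comm₀ (by linarith) ha0).1
    (hR₁B.trans ((min_le_right _ _).trans (min_le_right _ _)))
  have hinv : R₀⁻¹ ≤ R₁⁻¹ := inv_anti₀ (by linarith) hle0
  have hΦ₁ := hΦ.mono hinv hle0
  have hn₁ : NiceMap R₁⁻¹ R₁ (Φ t₀) := hn.mono hlea (inv_lt_one_of_one_lt₀ hR₁) hleb hR₁
  obtain ⟨R, hR, hRR₁⟩ := exists_between hR₁
  have hR0 : 0 < R := by linarith
  have hsub : R₁⁻¹ ≤ R⁻¹ := inv_anti₀ hR0 hRR₁.le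
  refine ⟨R, hR, Φ, fun t z => -(1 / 2) * Complex.log (Φ t z * circleConj (Φ t) z),
    hΦ₁.mono hsub hRR₁.le, ?_, ?_⟩
  · exact (HolFam.const (inv_pos.2 hR0).le (differentiableOn_const _)).mul (inv_pos.2 hR0).le
      ((hprod.mono hinv hle0).log hR hRR₁ fun z hz => (hR₁V hz).2)
  · have hw : ∀ᶠ t in 𝓝 t₀, CT (Φ t) 1 (fun _ => 1) 0 = 1 := by
      filter_upwards [hΦ.diff, hΦγ] with t h1 h2
      exact (γ t).2.CT_eq_one hR₀ h1 h2
    filter_upwards [hΦ₁.eventually_niceMap hn₁ hR hRR₁ hw, hΦγ] with t h1 h2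
    refine ⟨h1, fun z hz => ?_, fun z => (h2 z).symm⟩
    rw [hsq _ _ hz, ← Complex.ofReal_log (by positivity), Real.log_pow]
    simp

/-! ### Solving the linear equation by the Fredholm alternative -/

/-- Cauchy integrals along the image of one circle, evaluated along the image of another circle, as
integral operators depending smoothly on the parameter. -/
theorem HolFam.exists_transOp {k : ℕ} {t₀ R : ℝ} {Φ : ℝ → ℂ → ℂ} (hR : 1 < R)
    (hΦ : HolFam k t₀ R⁻¹ R Φ) (hn : NiceMap R⁻¹ R (Φ t₀)) {σ r : ℝ} (hσ : σ ∈ Ioo R⁻¹ R)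
    (hr : r ∈ Ioo R⁻¹ R) (hσr : σ ≠ r) :
    ∃ K : ℝ → C(Circle, ℂ) →L[ℂ] C(Circle, ℂ), ContDiffAt ℝ k K t₀ ∧
      ∀ᶠ t in 𝓝 t₀, ∀ (f : C(Circle, ℂ)) (F : ℂ → ℂ), (∀ ζ : Circle, F (σ * ζ) = f ζ) →
        ∀ x : Circle, K t f x = CT (Φ t) σ F (Φ t (r * x)) := by
  have hR0 : 0 ≤ R⁻¹ := inv_nonneg.2 (by linarith)
  have hσ0 : 0 < σ := hR0.trans_lt hσ.1
  have hr0 : 0 < r := hR0.trans_lt hr.1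
  have hne : ∀ q : Circle × Circle, Φ t₀ (σ * q.2) - Φ t₀ (r * q.1) ≠ 0 := by
    intro q e
    have h1 : ∀ {s : ℝ}, s ∈ Ioo R⁻¹ R → ∀ z : Circle, (s : ℂ) * z ∈ ann R⁻¹ R := fun hs z => by
      rw [mem_ann, norm_mul_circle (hR0.trans_lt hs.1)]; exact hs
    have h2 := congrArg norm (hn.inj (h1 hσ q.2) (h1 hr q.1) (sub_eq_zero.1 e))
    rw [norm_mul_circle hσ0, norm_mul_circle hr0] at h2
    exact hσr h2
  obtain ⟨κ, hκ, hκe⟩ := ((SmoothFam.of_continuous (X := Circle × Circle)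
    (g := fun q => (σ : ℂ) * q.2) (by fun_prop)).mul
      (((hΦ.deriv hR).smoothFam hR0 hσ).comp continuous_snd)).div
    (((hΦ.smoothFam hR0 hσ).comp continuous_snd).sub
      ((hΦ.smoothFam hR0 hr).comp continuous_fst)) hne
  have hk : ContDiff ℝ k fun κ : C(Circle × Circle, ℂ) => kernelOp (X := Circle) κ :=
    ContinuousLinearMap.contDiff (𝕜 := ℝ) (E := C(Circle × Circle, ℂ))
      (F := C(Circle, ℂ) →L[ℂ] C(Circle, ℂ)) ((kernelOp (X := Circle)).restrictScalars ℝ)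
  refine ⟨fun t => kernelOp (κ t), hk.contDiffAt.comp t₀ hκ, ?_⟩
  filter_upwards [hκe] with t ht f F hF x
  refine kernelOp_eq_cint _ _ _ fun ζ => ?_
  rw [ht, hF]
  ring

/-- The Cauchy integral along the circle of radius `σ`, evaluated on the larger circle of radius `ρ`,
is a compact operator: with `q = σ / ρ`, its kernel is a product of functions of one variable and
`(1 - q ζ / z)⁻¹`. -/
theorem exists_compact_cauchyOp {σ ρ : ℝ} (hσ : 0 < σ) (hσρ : σ < ρ) :
    ∃ N : C(Circle, ℂ) →L[ℂ] C(Circle, ℂ), IsCompactOperator N ∧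
      ∀ f (x : Circle), N f x = -cint σ fun η => extC σ f η / (η - ρ * x) := by
  have hρ : 0 < ρ := hσ.trans hσρ
  have hρ' : (ρ : ℂ) ≠ 0 := by exact_mod_cast hρ.ne'
  set q : ℝ := σ / ρ with hq
  have hq0 : 0 ≤ q := by positivity
  have hq1 : q < 1 := (div_lt_one hρ).2 hσρ
  have hne : ∀ z ζ : Circle, (1 : ℂ) - q * ((z⁻¹ : Circle) : ℂ) * ζ ≠ 0 := by
    intro z ζ e
    have h1 := congrArg norm (sub_eq_zero.1 e)
    rw [norm_one, norm_mul, norm_mul, Circle.norm_coe, Circle.norm_coe, Complex.norm_real,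
      Real.norm_eq_abs, abs_of_nonneg hq0] at h1
    linarith
  set κ : C(Circle × Circle, ℂ) := ⟨fun p => (1 - q * ((p.1⁻¹ : Circle) : ℂ) * p.2)⁻¹,
    Continuous.inv₀ (by fun_prop) fun p => hne p.1 p.2⟩ with hκ
  have hc := isCompactOperator_kernelOp_geometric hq0 hq1 κ fun _ _ => rfl
  let A : C(Circle, ℂ) →L[ℂ] C(Circle, ℂ) := ContinuousLinearMap.mul ℂ _ circleCoe
  let B : C(Circle, ℂ) →L[ℂ] C(Circle, ℂ) :=
    ContinuousLinearMap.mul ℂ _ ((q : ℂ) • star circleCoe)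
  refine ⟨B ∘L kernelOp κ ∘L A, (hc.comp_clm A).clm_comp B, fun f x => ?_⟩
  have h1 : kernelOp κ (circleCoe * f) x =
      cint σ fun η => extC σ f η / σ * (1 - q * ((x⁻¹ : Circle) : ℂ) * (η / σ))⁻¹ := by
    refine kernelOp_eq_cint _ _ _ fun ζ => ?_
    have hσ' : (σ : ℂ) ≠ 0 := by exact_mod_cast hσ.ne'
    rw [extC_apply hσ, mul_div_cancel_left₀ _ hσ', ContinuousMap.mul_apply, circleCoe_apply, hκ,
      ContinuousMap.coe_mk]
    field_simp
  have h2 : (B ∘L kernelOp κ ∘L A) f x =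
      q * ((x⁻¹ : Circle) : ℂ) * kernelOp κ (circleCoe * f) x := by
    rw [Circle.coe_inv_eq_conj]
    rfl
  rw [h2, h1, ← cint_const_mul, ← neg_one_mul, ← cint_const_mul]
  refine cint_congr hσ.le fun η hη => ?_
  obtain ⟨ζ, rfl⟩ := exists_circle_mul hσ hη
  have hσ' : (σ : ℂ) ≠ 0 := by exact_mod_cast hσ.ne'
  have hx : (x : ℂ) ≠ 0 := Circle.coe_ne_zero x
  have h3 := hne x ζ
  have h4 : (σ : ℂ) * ζ - ρ * x ≠ 0 :=
    mul_circle_sub_ne hσ (by rw [norm_mul_circle hρ]; exact hσρ.ne') ζ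
  have h5 : (1 : ℂ) - q * ((x⁻¹ : Circle) : ℂ) * ζ = -(σ * ζ - ρ * x) / (ρ * x) := by
    rw [hq, Circle.coe_inv]
    push_cast
    field_simp
    ring
  rw [mul_div_cancel_left₀ _ hσ', h5, hq, Circle.coe_inv, inv_div]
  push_cast
  field_simp

section Family

variable {m ρ R : ℝ}

/-- The holomorphic function in `|z| > m⁻¹` given by a density on the circle of radius `m⁻¹`. -/
def outerCauchy (m : ℝ) (w : C(Circle, ℂ)) (z : ℂ) : ℂ :=
  -cint m⁻¹ fun η => extC m⁻¹ w η / (η - z)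

theorem differentiableAt_outerCauchy (hm : 0 < m) (w : C(Circle, ℂ)) {z : ℂ} (hz : m⁻¹ < ‖z‖) :
    DifferentiableAt ℂ (outerCauchy m w) z :=
  (differentiableAt_cauchy (inv_pos.2 hm) (continuousOn_extC (inv_pos.2 hm) w) hz.ne').neg

theorem circleConj_extC (hρ : 0 < ρ) (γ : C(Circle, ℂ)) (ζ : Circle) :
    circleConj (extC ρ γ) ((ρ⁻¹ : ℝ) * ζ) = (starRingEnd ℂ) (γ ζ) := by
  have e : (starRingEnd ℂ ((ρ⁻¹ : ℝ) * ζ))⁻¹ = (ρ : ℂ) * ζ := by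
    rw [map_mul, Complex.conj_ofReal, mul_inv, ← Circle.coe_inv_eq_conj, Circle.coe_inv, inv_inv]
    push_cast; rw [inv_inv]
  rw [circleConj, e, extC_apply hρ]

theorem CT_congr {Φ f g : ℂ → ℂ} {σ : ℝ} (hσ : 0 ≤ σ) (h : ∀ z, ‖z‖ = σ → f z = g z) (w : ℂ) :
    CT Φ σ f w = CT Φ σ g w :=
  cint_congr hσ fun z hz => by rw [h z hz]

/-- The equation for `g` in terms of the values `γ` on the circle of radius `ρ` and the values `w` of
`weldRhs` on the circle of radius `m⁻¹`. -/
theorem weldingSolution_outerCauchy (hm : 1 < m) (hmρ : m < ρ) (hρR : ρ < R) {Φ u : ℂ → ℂ}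
    (hn : NiceMap R⁻¹ R Φ) (hu : DifferentiableOn ℂ u (ann R⁻¹ R)) {γ w : C(Circle, ℂ)}
    (hw : ∀ x : Circle, w x = weldRhs Φ ρ u (extC ρ γ) ((m⁻¹ : ℝ) * x))
    (hγ : ∀ x : Circle, γ x = outerCauchy m w (ρ * x)) :
    WeldingSolution m ρ R Φ u (outerCauchy m w) := by
  have hm0 : 0 < m := by linarith
  have hρ0 : 0 < ρ := by linarith
  have hg : ∀ z, ‖z‖ = ρ → extC ρ γ z = outerCauchy m w z := by
    intro z hz
    obtain ⟨x, rfl⟩ := exists_circle_mul hρ0 hz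
    rw [extC_apply hρ0, hγ]
  refine ⟨hm, hmρ, hρR, hn, hu, fun z hz => ?_, fun z hz => ?_⟩
  · refine (differentiableAt_outerCauchy hm0 w ?_).continuousAt.continuousWithinAt
    rw [mem_sphere_zero_iff_norm.1 hz]
    exact (inv_lt_one_of_one_lt₀ hm).trans (hm.trans hmρ)
  · rw [outerCauchy]
    congr 1
    refine cint_congr (inv_pos.2 hm0).le fun η hη => ?_
    obtain ⟨x, rfl⟩ := exists_circle_mul (inv_pos.2 hm0) hη
    rw [extC_apply (inv_pos.2 hm0), hw]
    congr 1
    unfold weldRhs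
    congr 1
    · exact CT_congr hρ0.le hg _
    · refine CT_congr (inv_pos.2 hρ0).le (fun z hz => ?_) _
      unfold circleConj
      rw [hg _ (by rw [norm_conj_inv, hz, inv_inv])]

/-- The linear equation is solvable, and its solution depends smoothly on the parameter. For the
values `γ` of `g` on the circle of radius `ρ`, it reads `γ = N (V γ + K₂ u)`, where `V γ + K₂ u` are the
values of `weldRhs` on the circle of radius `m⁻¹`, and `N` is compact. Because of the conjugation in
`g*`, the operator `V` is only real-linear. -/
theorem exists_welding_family {k : ℕ} {t₀ : ℝ} {Φ U : ℝ → ℂ → ℂ} (hm : 1 < m) (hmρ : m < ρ)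
    (hρR : ρ < R) (hΦ : HolFam k t₀ R⁻¹ R Φ) (hU : HolFam k t₀ R⁻¹ R U)
    (hn : ∀ᶠ t in 𝓝 t₀, NiceMap R⁻¹ R (Φ t)) :
    ∃ g : ℝ → ℂ → ℂ, (∀ᶠ t in 𝓝 t₀, WeldingSolution m ρ R (Φ t) (U t) (g t)) ∧
      ∀ b, HolFam k t₀ m⁻¹ b g := by
  have hm0 : 0 < m := by linarith
  have hρ0 : 0 < ρ := by linarith
  have hR0 : 0 < R := by linarith
  have hR : 1 < R := by linarith
  have hm1 : m⁻¹ < 1 := inv_lt_one_of_one_lt₀ hm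
  have h1 : R⁻¹ < ρ⁻¹ := inv_strictAnti₀ hρ0 hρR
  have h2 : ρ⁻¹ < m⁻¹ := inv_strictAnti₀ hm0 hmρ
  have hmem : m⁻¹ ∈ Ioo R⁻¹ R := ⟨h1.trans h2, by linarith⟩
  have hρi : ρ⁻¹ ∈ Ioo R⁻¹ R := ⟨h1, by linarith⟩
  obtain ⟨K₁, hK₁, hK₁e⟩ := hΦ.exists_transOp hR hn.self_of_nhds (σ := ρ) (r := m⁻¹)
    ⟨by linarith, hρR⟩ hmem (by linarith)
  obtain ⟨K₂, hK₂, hK₂e⟩ := hΦ.exists_transOp hR hn.self_of_nhds (σ := ρ⁻¹) (r := m⁻¹)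
    hρi hmem h2.ne
  obtain ⟨N, hN, hNe⟩ := exists_compact_cauchyOp (σ := m⁻¹) (ρ := ρ) (inv_pos.2 hm0) (by linarith)
  set S : C(Circle, ℂ) →L[ℝ] C(Circle, ℂ) :=
    ((starL' ℝ : C(Circle, ℂ) ≃L[ℝ] C(Circle, ℂ)) : C(Circle, ℂ) →L[ℝ] C(Circle, ℂ)) with hS
  let rs := ContinuousLinearMap.restrictScalarsL ℂ C(Circle, ℂ) C(Circle, ℂ) ℝ ℝ
  set V : ℝ → C(Circle, ℂ) →L[ℝ] C(Circle, ℂ) := fun t => rs (K₁ t) - rs (K₂ t) ∘L S with hV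
  set T : ℝ → C(Circle, ℂ) →L[ℝ] C(Circle, ℂ) := fun t => 1 - rs N ∘L V t with hT
  have hrs : ∀ {K : ℝ → C(Circle, ℂ) →L[ℂ] C(Circle, ℂ)}, ContDiffAt ℝ k K t₀ →
      ContDiffAt ℝ k (fun t => rs (K t)) t₀ := fun hK =>
    (ContinuousLinearMap.restrictScalarsIsometry ℂ C(Circle, ℂ) C(Circle, ℂ) ℝ ℝ).contDiff.contDiffAt.comp t₀ hK
  have hVs : ContDiffAt ℝ k V t₀ := (hrs hK₁).sub ((hrs hK₂).clm_comp contDiffAt_const)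
  have hTs : ContDiffAt ℝ k T t₀ := contDiffAt_const.sub (contDiffAt_const.clm_comp hVs)
  -- The operators compute `weldRhs`.
  have hrhs : ∀ᶠ t in 𝓝 t₀, ∀ (u : ℂ → ℂ) (û γ : C(Circle, ℂ)),
      (∀ ζ : Circle, u ((ρ⁻¹ : ℝ) * ζ) = û ζ) → ∀ x : Circle, (V t γ + K₂ t û) x =
        weldRhs (Φ t) ρ u (extC ρ γ) ((m⁻¹ : ℝ) * x) := by
    filter_upwards [hK₁e, hK₂e] with t e₁ e₂ u û γ hu x
    have e₃ := e₁ γ (extC ρ γ) (extC_apply hρ0 γ) x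
    have e₄ := e₂ (û - star γ) (fun ζ => u ζ - circleConj (extC ρ γ) ζ) (fun ζ => by
      rw [hu, circleConj_extC hρ0]; rfl) x
    rw [weldRhs, ← e₃, ← e₄, map_sub]
    change K₁ t γ x - K₂ t (star γ) x + K₂ t û x = K₁ t γ x + (K₂ t û x - K₂ t (star γ) x)
    ring
  -- At `t₀` the operator is invertible, as the homogeneous equation has no non-trivial solution.
  have hunit : IsUnit (T t₀) := by
    have hc : IsCompactOperator (rs N ∘L V t₀) := hN.comp_clm (V t₀)
    -- Fredholm alternative: either one is an eigenvalue of `N V`, or `1 - N V` is invertible.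
    rcases hc.hasEigenvalue_or_mem_resolventSet (one_ne_zero (α := ℝ)) with h | h
    · exfalso
      obtain ⟨γ, hγ⟩ := h.exists_hasEigenvector
      have e : N (V t₀ γ) = γ := by
        have := hγ.apply_eq_smul
        rw [one_smul] at this
        exact this
      have W := weldingSolution_outerCauchy hm hmρ hρR hn.self_of_nhds
        (u := fun _ => 0) (differentiableOn_const 0) (γ := γ) (w := V t₀ γ)
        (fun x => by
          rw [← hrhs.self_of_nhds (fun _ => 0) 0 γ (fun _ => rfl) x, map_zero, add_zero])
        (fun x => by rw [outerCauchy, ← hNe, e])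
      refine hγ.2 ?_
      ext x
      have h3 := W.eq_zero (z := ρ * x) (by rw [norm_mul_circle hρ0]; linarith)
      rw [outerCauchy, ← hNe, e] at h3
      exact h3
    · have := spectrum.mem_resolventSet_iff.1 h
      rwa [map_one] at this
  set û : ℝ → C(Circle, ℂ) := fun t => onC ρ⁻¹ (U t) with hû
  have hûs : ContDiffAt ℝ k û t₀ := hU.smooth ρ⁻¹ hρi
  set f : ℝ → C(Circle, ℂ) := fun t => N (K₂ t (û t)) with hf
  have hK₂û : ContDiffAt ℝ k (fun t => K₂ t (û t)) t₀ := (hrs hK₂).clm_apply hûs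
  have hfs : ContDiffAt ℝ k f t₀ := (rs N).contDiff.contDiffAt.comp t₀ hK₂û
  obtain ⟨τ, hτ⟩ := hunit
  -- Inversion of operators is smooth.
  have hi : ContDiffAt ℝ k Ring.inverse (T t₀) := by
    rw [← hτ]
    exact contDiffAt_ringInverse (R := C(Circle, ℂ) →L[ℝ] C(Circle, ℂ)) ℝ τ
  have hinv : ContDiffAt ℝ k (fun t => Ring.inverse (T t)) t₀ := hi.comp t₀ hTs
  set γ : ℝ → C(Circle, ℂ) := fun t => Ring.inverse (T t) (f t) with hγ
  have hγs : ContDiffAt ℝ k γ t₀ := hinv.clm_apply hfs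
  set w : ℝ → C(Circle, ℂ) := fun t => V t (γ t) + K₂ t (û t) with hw
  have hws : ContDiffAt ℝ k w t₀ := (hVs.clm_apply hγs).add hK₂û
  have hTu : ∀ᶠ t in 𝓝 t₀, IsUnit (T t) := by
    have h0 : {A : C(Circle, ℂ) →L[ℝ] C(Circle, ℂ) | IsUnit A} ∈ 𝓝 (T t₀) := by
      rw [← hτ]
      exact Units.nhds (R := C(Circle, ℂ) →L[ℝ] C(Circle, ℂ)) τ
    exact hTs.continuousAt h0
  refine ⟨fun t => outerCauchy m (w t), ?_, fun b => ?_⟩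
  · filter_upwards [hTu, hrhs, hn, hU.diff] with t ht hr hnt hUt
    have e1 : T t (γ t) = f t := by
      have := congrArg (fun A : C(Circle, ℂ) →L[ℝ] C(Circle, ℂ) => A (f t))
        (Ring.mul_inverse_cancel (T t) ht)
      exact this
    have e2 : γ t = N (w t) := by
      have e3 : γ t - N (V t (γ t)) = N (K₂ t (û t)) := e1
      rw [hw, map_add, ← e3]
      abel
    refine weldingSolution_outerCauchy hm hmρ hρR hnt hUt (γ := γ t) ?_ fun x => ?_
    · refine hr (U t) (û t) (γ t) fun ζ => ?_
      exact (onC_apply (inv_pos.2 hρ0) (hUt.continuousOn.mono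
        (sphere_subset_ann hρi.1 hρi.2)) ζ).symm
    · rw [outerCauchy, ← hNe, ← e2]
  · refine HolFam.of_smoothFam (Eventually.of_forall fun t z hz =>
      (differentiableAt_outerCauchy hm0 _ hz.1).differentiableWithinAt) fun r hr => ?_
    have hr0 : 0 < r := (inv_pos.2 hm0).trans hr.1
    have hsw : SmoothFam (X := Circle) k t₀ fun t ζ => extC m⁻¹ (w t) ((m⁻¹ : ℝ) * ζ) :=
      ⟨w, hws, Eventually.of_forall fun t ζ => (extC_apply (inv_pos.2 hm0) _ ζ).symm⟩
    have h3 := SmoothFam.cint (σ := m⁻¹) (X := Circle)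
      (F := fun t x η => extC m⁻¹ (w t) η / (η - r * x))
      ((hsw.comp continuous_snd).div (SmoothFam.of_continuous (X := Circle × Circle)
        (g := fun q => ((m⁻¹ : ℝ) : ℂ) * q.2 - r * q.1) (by fun_prop)) fun q =>
          mul_circle_sub_ne (inv_pos.2 hm0) (by rw [norm_mul_circle hr0]; exact hr.1.ne') _)
    simpa only [outerCauchy, neg_one_mul] using
      (SmoothFam.of_continuous (g := fun _ => (-1 : ℂ)) continuous_const).mul h3

end Family

/-! ### Smooth dependence of the decomposition -/

open WeldingSolution in
/-- The circle maps depend differentiably on the parameter, including their rotation angles, which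
are imaginary parts of Cauchy integrals. -/
theorem HolFam.circ {k : ℕ} {t₀ m : ℝ} (hm : 1 < m) {Φ U g : ℝ → ℂ → ℂ}
    (hΦ : HolFam k t₀ m⁻¹ m Φ) (hU : HolFam k t₀ m⁻¹ m U) (hg : HolFam k t₀ m⁻¹ m g)
    (hn : NiceMap m⁻¹ m (Φ t₀)) : HolFam k t₀ m⁻¹ m fun t => circ (Φ t) (U t) (g t) := by
  have hm0 : 0 < m := by linarith
  have hi : 0 ≤ m⁻¹ := (inv_pos.2 hm0).le
  have h1 : (1 : ℝ) ∈ Ioo m⁻¹ m := ⟨inv_lt_one_of_one_lt₀ hm, hm⟩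
  have hsol : HolFam k t₀ m⁻¹ m fun t => sol (U t) (g t) :=
    hU.add hi (hg.sub hi (by simpa using hg.circleConj (inv_pos.2 hm0) hm0))
  have hc : SmoothFam (X := Circle) k t₀ fun t _ => CT (Φ t) 1 (sol (U t) (g t)) 0 :=
    SmoothFam.CT (p := fun _ _ => 0) (hΦ.smoothFam hi h1) ((hΦ.deriv hm).smoothFam hi h1)
      (hsol.smoothFam hi h1) (SmoothFam.of_continuous continuous_const) fun _ ζ =>
        hn.ne_zero _ (by rw [mem_ann, norm_mul_circle one_pos]; exact h1)
  have hrot : HolFam k t₀ m⁻¹ m fun t _ => (rot (Φ t) (U t) (g t) : ℂ) * Complex.I := by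
    refine HolFam.of_smoothFam (Eventually.of_forall fun _ => differentiableOn_const _) fun _ _ =>
      ((SmoothFam.of_continuous (X := Circle) (g := fun _ => (1 / 2 : ℂ)) continuous_const).mul
        (hc.sub hc.star)).congr (Eventually.of_forall fun t _ => ?_)
    rw [Complex.sub_conj, rot]
    push_cast
    ring
  exact hΦ.mul hi ((hsol.sub hi hrot).exp hi)

open WeldingSolution in
/-- Along a smooth curve of complex deformations, both factors of the decomposition are locally given
by differentiable families of holomorphic functions. -/
theorem exists_decomposition_family {γ : ℝ → DefC} (hγ : IsSmoothCurve fun t => (γ t).1) (t₀ : ℝ)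
    (k : ℕ) : ∃ R : ℝ, 1 < R ∧ ∃ D F : ℝ → ℂ → ℂ, HolFam k t₀ R⁻¹ R D ∧ HolFam k t₀ R⁻¹ R F ∧
      ∀ᶠ t in 𝓝 t₀, ∃ (d : DiffAn) (v : UnivN), IsDecomposition (γ t) d v ∧
        (∀ z : Circle, d.toOCircle z = D t z) ∧ ∀ z : Circle, v.toOCircle z = F t z := by
  obtain ⟨R, hR, Φ, U, hΦ, hU, hev⟩ := exists_extension_family hγ t₀ k
  obtain ⟨ρ, hρ, hρR⟩ := exists_between hR
  obtain ⟨m, hm, hmρ⟩ := exists_between hρ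
  obtain ⟨g, hW, hg⟩ := exists_welding_family hm hmρ hρR hΦ hU (hev.mono fun t ht => ht.1)
  have hm0 : 0 < m := by linarith
  have hm1 : m⁻¹ < 1 := inv_lt_one_of_one_lt₀ hm
  have hi : 0 ≤ m⁻¹ := (inv_pos.2 hm0).le
  have hmR : R⁻¹ ≤ m⁻¹ := inv_anti₀ hm0 (by linarith)
  have hΦm := hΦ.mono hmR (by linarith : m ≤ R)
  have hD := HolFam.circ hm hΦm (hU.mono hmR (by linarith)) (hg m) hW.self_of_nhds.nice_m
  obtain ⟨σ, hσ1, hσm⟩ := exists_between hm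
  have hσ0 : 0 < σ := by linarith
  have hσ : σ ∈ Ioo m⁻¹ m := ⟨by linarith, hσm⟩
  -- On `|z| = σ` the circle map has modulus at least some `μ > 1`.
  obtain ⟨z₀, hz₀, hmin⟩ := (isCompact_sphere (0 : ℂ) σ).exists_isMinOn ⟨σ, by simp; linarith⟩
    (hW.self_of_nhds.circ_differentiableOn.continuousOn.mono
      (sphere_subset_ann hσ.1 hσ.2)).norm
  have hμ : 1 < ‖WeldingSolution.circ (Φ t₀) (U t₀) (g t₀) z₀‖ :=
    hW.self_of_nhds.one_lt_norm_circ hev.self_of_nhds.2.1 (by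
      rw [mem_ann, mem_sphere_zero_iff_norm.1 hz₀]
      exact ⟨hσ1, hσm⟩)
  obtain ⟨s, hs, hsμ⟩ := exists_between (lt_min hμ hm)
  have hs0 : 0 < s := by linarith
  have hsm : s ≤ m := (hsμ.trans_le (min_le_right _ _)).le
  have hfar : ∀ ζ : Circle, s < ‖WeldingSolution.circ (Φ t₀) (U t₀) (g t₀) (σ * ζ)‖ := fun ζ =>
    (hsμ.trans_le (min_le_left _ _)).trans_le
      (hmin (mem_sphere_zero_iff_norm.2 (norm_mul_circle hσ0 ζ)))
  have hfar' := (hD.smoothFam hi hσ).eventually_forall_mem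
    (isOpen_lt continuous_const continuous_norm) hfar
  refine ⟨s, hs, _, fun t => CT (WeldingSolution.circ (Φ t) (U t) (g t)) σ (Φ t),
    hD.mono (inv_anti₀ hs0 hsm) hsm, HolFam.of_smoothFam ?_ fun r hr => ?_, ?_⟩
  · filter_upwards [hD.diff, hΦm.diff, hfar'] with t h1 h2 h3 z hz
    have hsub := sphere_subset_ann hσ.1 hσ.2
    refine (CT_differentiableAt hσ0 (h1.continuousOn.mono hsub)
      ((h1.deriv (isOpen_ann _ _)).continuousOn.mono hsub)
      (h2.continuousOn.mono hsub) ?_).differentiableWithinAt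
    rintro ⟨ζ, hζ, rfl⟩
    obtain ⟨ζ, rfl⟩ := exists_circle_mul hσ0 (mem_sphere_zero_iff_norm.1 hζ)
    exact (h3 ζ).not_gt hz.2
  · have hr0 : 0 < r := (inv_pos.2 hs0).trans hr.1
    refine SmoothFam.CT (X := Circle) (p := fun _ z => (r : ℂ) * z) (hD.smoothFam hi hσ)
      ((hD.deriv hm).smoothFam hi hσ) (hΦm.smoothFam hi hσ)
      (SmoothFam.of_continuous (by fun_prop)) fun z ζ e => ?_
    have h1 := hfar ζ
    rw [e, norm_mul_circle hr0] at h1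
    exact h1.not_gt hr.2
  · filter_upwards [hev, hW] with t h1 h2
    obtain ⟨d, v, hdv, hd, hv⟩ := h2.exists_isDecomposition h1.2.1 (γ t) h1.2.2
    exact ⟨d, v, hdv, hd, hv σ ⟨hσ1, hσm⟩⟩

theorem isSmoothCurve_const (f : OCircle) : IsSmoothCurve fun _ => f := by
  refine ⟨fun k _ => if k = 0 then f else 0, by simp, fun k t => ?_⟩
  have h : slope (fun _ : ℝ => if k = 0 then f else 0) t = fun _ => 0 := by
    funext s
    rw [slope_def_module, sub_self, smul_zero]
  simp only [Nat.succ_ne_zero, if_false, h]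
  exact tendsto_const_nhds

/-- Every complex deformation is decomposable, as the value of a constant curve. -/
theorem exists_isDecomposition (φ : DefC) : ∃ d v, IsDecomposition φ d v := by
  obtain ⟨_, _, _, _, _, _, h⟩ :=
    exists_decomposition_family (γ := fun _ => φ) (isSmoothCurve_const φ.1) 0 0
  obtain ⟨d, v, hdv, _⟩ := h.self_of_nhds
  exact ⟨d, v, hdv⟩

/-- Frölicher smoothness of a map between spaces of functions may be tested on the smooth curves which
generate the structure. -/
theorem frSmooth_of_isSmoothCurve {X Y : Type} {ι : X → OCircle} {κ : Y → OCircle} {Q : X → Y}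
    (h : ∀ γ : ℝ → X, IsSmoothCurve (ι ∘ γ) → IsSmoothCurve (κ ∘ Q ∘ γ)) :
    FrSmooth (subspaceFr ι) (subspaceFr κ) Q :=
  fun _ hγ f hf => hγ (f ∘ Q) fun η hη => hf (Q ∘ η) (h η hη)

section Smooth

variable {diffPart : DefC → DiffAn} {univPart : DefC → UnivN}
  (h : ∀ φ, IsDecomposition φ (diffPart φ) (univPart φ))
include h

theorem frSmooth_diffPart : FrSmooth DefC.fr DiffAn.fr diffPart := by
  refine frSmooth_of_isSmoothCurve fun γ hγ => isSmoothCurve_of_holFam fun t₀ k => ?_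
  obtain ⟨R, hR, D, F, hD, -, hev⟩ := exists_decomposition_family hγ t₀ k
  refine ⟨R, hR, D, hD, ?_⟩
  filter_upwards [hev] with t ⟨d, v, hdv, hd, _⟩ z
  rw [← hd z, ← ((h (γ t)).unique hdv).1]
  rfl

theorem frSmooth_univPart : FrSmooth DefC.fr UnivN.fr univPart := by
  refine frSmooth_of_isSmoothCurve fun γ hγ => isSmoothCurve_of_holFam fun t₀ k => ?_
  obtain ⟨R, hR, D, F, -, hF, hev⟩ := exists_decomposition_family hγ t₀ k
  refine ⟨R, hR, F, hF, ?_⟩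
  filter_upwards [hev] with t ⟨d, v, hdv, _, hv⟩ z
  rw [← hv z, ← ((h (γ t)).unique hdv).2]
  rfl

end Smooth
end CDef

end

theorem mainTheorem8 :
    (∀ φ : CDef.DefC, ∃! p : CDef.DiffAn × CDef.UnivN, CDef.IsDecomposition φ p.1 p.2) ∧
    (∀ (diffPart : CDef.DefC → CDef.DiffAn) (univPart : CDef.DefC → CDef.UnivN),
      (∀ φ, CDef.IsDecomposition φ (diffPart φ) (univPart φ)) →
        CDef.FrSmooth CDef.DefC.fr CDef.DiffAn.fr diffPart ∧
        CDef.FrSmooth CDef.DefC.fr CDef.UnivN.fr univPart) := by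
  refine ⟨fun φ => ?_, fun diffPart univPart h =>
    ⟨CDef.frSmooth_diffPart h, CDef.frSmooth_univPart h⟩⟩
  obtain ⟨d, v, hdv⟩ := CDef.exists_isDecomposition φ
  refine ⟨(d, v), hdv, fun p hp => ?_⟩
  obtain ⟨h1, h2⟩ := CDef.IsDecomposition.unique hp hdv
  exact Prod.ext h1 h2
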